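/- Let $\Omega\subset\mathbb{C}$ be a bounded simply connected domain with boundary $\Gamma=\partial\Omega$, let $A^2(\Omega)$ be the space of holomorphic functions on $\Omega$ that are square integrable with respect to area, and suppose that the best approximation to $\bar z$ in $A^2(\Omega)$, in the norm of $L^2(\Omega)$, is a polynomial $p$. A Schwarz function of $\Gamma$ is a function $S$ analytic in a neighbourhood of $\Gamma$ with $S(z)=\bar z$ on $\Gamma$; a local Schwarz function at $\zeta\in\Gamma$ is a germ $S$ analytic at $\zeta$ with $S(z)=\bar z$ for all $z\in\Gamma$ near $\zeta$. 1. If $\deg p\ge 1$, then the Schwarz function of $\Gamma$ cannot be meromorphic in $\Omega$: there is no meromorphic function $S$ on $\Omega$ with $\lim_{z\to\zeta,\,z\in\Omega}S(z)=\bar\zeta$ for every $\zeta\in\Gamma$. 2. If $\Omega$ is not a disk, then the Schwarz function of $\Gamma$ has algebraic singularities and no finite poles. That is, there is a finite set $E\subset\mathbb{C}$ such that (a) $\Gamma$ has a local Schwarz function at each point of $\Gamma\setminus E$; (b) every local Schwarz function at a point $\zeta\in\Gamma$ can be continued analytically along every curve $\gamma:[0,1]\to\mathbb{C}$ with $\gamma(0)=\zeta$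 and $\gamma(t)\notin E$ for $t>0$; (c) if an analytic continuation, along any curve, of a local Schwarz function ends at a point $z_1$ of a punctured disk $\{0<|z-e|<r\}$ that does not meet $E$, then the resulting germ at $z_1$ is a branch of $h\big((z-e)^{1/m}\big)$ for some integer $m\ge1$ and some $h$ holomorphic in $\{|\tau|<r^{1/m}\}$. Moreover, if $\Gamma$ has a Schwarz function $S$, then $S$ has a singularity in $\Omega$: there is a curve $\gamma:[0,1]\to\mathbb{C}$ with $\gamma(0)\in\Gamma$ and $\gamma(t)\in\Omega$ for $t>0$ along which $S$ cannot be continued analytically. 3. If $\Omega$ is a quadrature domain, i.e. there are finitely many points $a_j\in\Omega$ and constants $c_{jk}$ $(0\le k<m)$ with $\int_\Omega f\,dA=\sum_{j}\sum_{k<m}c_{jk}f^{(k)}(a_j)$ for all $f\in A^2(\Omega)$, then $\Omega$ is a disk. Hence no simply connected quadrature domain other than a disk has a polynomial best approximation. -/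

import Mathlib

open Set Filter Topology MeasureTheory

/-- Membership in the Bergman space `A²(Ω)`: holomorphic on `Ω` and square integrable on `Ω` with
respect to area measure. -/
def MemBergman (Ω : Set ℂ) (f : ℂ → ℂ) : Prop :=
  DifferentiableOn ℂ f Ω ∧ MemLp f 2 (volume.restrict Ω)

/-- `f` is the best approximation to `z ↦ conj z` in `A²(Ω)` with respect to the norm of `L²(Ω)`. -/
def IsBestApproxConj (Ω : Set ℂ) (f : ℂ → ℂ) : Prop :=
  MemBergman Ω f ∧ ∀ g : ℂ → ℂ, MemBergman Ω g →
    eLpNorm (fun z => (starRingEnd ℂ) z - f z) 2 (volume.restrict Ω) ≤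
      eLpNorm (fun z => (starRingEnd ℂ) z - g z) 2 (volume.restrict Ω)

/-- `Ω` is an open disk of positive radius. -/
def IsDisk (Ω : Set ℂ) : Prop :=
  ∃ (c : ℂ) (r : ℝ), 0 < r ∧ Ω = Metric.ball c r

/-- The germ of `S` at the boundary point `ζ` is the (local) Schwarz function of `∂Ω` at `ζ`: it is
analytic at `ζ`, and `S z = conj z` for all `z ∈ ∂Ω` near `ζ`. -/
def IsSchwarzGermAt (Ω : Set ℂ) (S : ℂ → ℂ) (ζ : ℂ) : Prop :=
  ζ ∈ frontier Ω ∧ AnalyticAt ℂ S ζ ∧ ∀ᶠ z in 𝓝[frontier Ω] ζ, S z = (starRingEnd ℂ) z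

/-- `S` is a Schwarz function of `∂Ω`: analytic in a neighbourhood of `∂Ω`, with `S z = conj z` on
`∂Ω`. -/
def IsSchwarzFunction (Ω : Set ℂ) (S : ℂ → ℂ) : Prop :=
  AnalyticOnNhd ℂ S (frontier Ω) ∧ ∀ z ∈ frontier Ω, S z = (starRingEnd ℂ) z

/-- The Schwarz function of `∂Ω` is meromorphic in `Ω`: some function meromorphic in `Ω` has the
boundary values `conj ζ` at all `ζ ∈ ∂Ω`. Only the behaviour inside `Ω` is looked at, so this covers
domains with singular boundary; it holds in particular if a function that is analytic in a
neighbourhood of `∂Ω` and equal to `conj` on `∂Ω` extends meromorphically to `Ω`. -/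
def HasMeromorphicSchwarzFunction (Ω : Set ℂ) : Prop :=
  ∃ S : ℂ → ℂ, MeromorphicOn S Ω ∧
    ∀ ζ ∈ frontier Ω, Tendsto S (𝓝[Ω] ζ) (𝓝 ((starRingEnd ℂ) ζ))

/-- `f` is an analytic continuation along the curve `γ` of the germ of `S` at `γ 0`: `f t` is
analytic at `γ t`, `f 0` has the same germ as `S` at `γ 0`, and for `s` close to `t` the functions
`f s` and `f t` have the same germ at `γ s`. -/
def IsAnalyticContinuationAlong (S : ℂ → ℂ) (γ : C(unitInterval, ℂ))
    (f : unitInterval → ℂ → ℂ) : Prop :=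
  (∀ t, AnalyticAt ℂ (f t) (γ t)) ∧
  f 0 =ᶠ[𝓝 (γ 0)] S ∧
  ∀ t, ∀ᶠ s in 𝓝 t, f s =ᶠ[𝓝 (γ s)] f t

/-- The germ of `g` at the point `z₁` of the punctured disk `0 < |z - e| < r` has at worst an
algebraic singularity at `e`, and no pole there: it is a branch of `h ((z - e) ^ (1 / m))` with
`m ≥ 1` and `h` holomorphic on the full disk `|τ| < r ^ (1 / m)`, that is, a Puiseux series without
negative exponents. -/
def IsPoleFreeAlgebraicBranch (g : ℂ → ℂ) (z₁ e : ℂ) (r : ℝ) : Prop :=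
  ∃ (m : ℕ) (h : ℂ → ℂ) (τ₁ : ℂ), 0 < m ∧
    DifferentiableOn ℂ h {τ : ℂ | ‖τ‖ ^ m < r} ∧
    e + τ₁ ^ m = z₁ ∧
    ∀ᶠ τ in 𝓝 τ₁, g (e + τ ^ m) = h τ

/-- Apart from a finite set `E ⊆ ℂ`, `∂Ω` has a local Schwarz function at each of its points; every
local Schwarz function of `∂Ω` continues analytically along all curves that avoid `E`; and near every
finite point each continuation has at worst an algebraic singularity, and no pole. If `∂Ω` has a
(global) Schwarz function, then it does have a singularity in `Ω`: it cannot be continued along every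
curve that starts on `∂Ω` and then stays in `Ω`. -/
def SchwarzFunctionHasAlgebraicSingularitiesNoPoles (Ω : Set ℂ) : Prop :=
  (∃ E : Set ℂ, E.Finite ∧
    (∀ ζ ∈ frontier Ω \ E, ∃ S : ℂ → ℂ, IsSchwarzGermAt Ω S ζ) ∧
    ∀ (S : ℂ → ℂ) (γ : C(unitInterval, ℂ)), IsSchwarzGermAt Ω S (γ 0) →
      ((∀ t, t ≠ 0 → γ t ∉ E) →
        ∃ f : unitInterval → ℂ → ℂ, IsAnalyticContinuationAlong S γ f) ∧
      (∀ f : unitInterval → ℂ → ℂ, IsAnalyticContinuationAlong S γ f →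
        ∀ (e : ℂ) (r : ℝ), Disjoint (Metric.ball e r \ {e}) E →
          γ 1 ∈ Metric.ball e r \ {e} → IsPoleFreeAlgebraicBranch (f 1) (γ 1) e r)) ∧
  (∀ S : ℂ → ℂ, IsSchwarzFunction Ω S →
    ∃ γ : C(unitInterval, ℂ), γ 0 ∈ frontier Ω ∧ (∀ t, t ≠ 0 → γ t ∈ Ω) ∧
      ¬ ∃ f : unitInterval → ℂ → ℂ, IsAnalyticContinuationAlong S γ f)

/-- `Ω` is a quadrature domain: the integral over `Ω` of every `f` in `A²(Ω)` is a fixed finite linear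
combination of values of `f` and its derivatives at finitely many points of `Ω`. (For bounded `Ω`,
this is implied by the same identity for all integrable holomorphic functions.) -/
def IsQuadratureDomain (Ω : Set ℂ) : Prop :=
  ∃ (N : Finset ℂ) (m : ℕ) (c : ℂ → ℕ → ℂ), (↑N : Set ℂ) ⊆ Ω ∧
    ∀ f : ℂ → ℂ, MemBergman Ω f →
      ∫ z in Ω, f z = ∑ a ∈ N, ∑ k ∈ Finset.range m, c a k * iteratedDeriv k f a

/-! Write Γ for the boundary and φ = z - conj p. The error conj z - p is orthogonal to A²(Ω), so ∫ φ
g = 0 for every g in A²(Ω). For w outside Ω, simple connectedness provides a branch of (z - w)^(-s),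
which lies in A²(Ω) for s < 1; letting s → 1 shows that the Cauchy transform T of φ vanishes off Ω.
If P' = p, then v = |z|² - 2 Re P satisfies ∂v/∂z̄ = φ, so v + T/π is holomorphic in Ω, continuous
on the closure and real on Γ, hence constant. Absorbing the constant into P gives |ζ|² = 2 Re P(ζ)
on Γ (`exists_primitive_of_isBestApproxConj`). With P^# the polynomial with conjugated coefficients,
the points (ζ, conj ζ), ζ in Γ, therefore lie on the algebraic curve z w = P(z) + P^#(w). Everything
else is read off from this curve. Put n = deg P.

If n ≤ 1, then Γ lies on a circle and Ω is a disk. If n ≥ 2, conj ζ is not the boundary value of a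
quotient G/q with G holomorphic in Ω and q a polynomial with zeros in Ω
(`not_tendsto_eval_mul_conj`): after multiplication by q^n the curve equation holds in all of Ω, and
at a zero of q only the leading term of P^# survives, so G vanishes there too and the factor
cancels; once q is constant, a holomorphic function would have the boundary values conj ζ, which is
impossible. This excludes a meromorphic Schwarz function, and also quadrature domains: for these the
Cauchy transform of 1 is rational off Ω, and conj w plus 1/π times that transform is holomorphic in
Ω.

For the singularities, the leading coefficient of the curve in w is constant, so its projection to
the z-plane is proper, and off the finitely many branch points it is a covering map. Lifting paths
continues the germs; lifting e + exp ω from a half-plane gives Puiseux series, bounded and hence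
without negative exponents.

Finally, suppose that a Schwarz function S continued along all curves in Ω. By monodromy its germs
near Γ extend holomorphically to Ω, so S has a primitive on the part of Ω near Γ. Formally ∫_Γ S dz
= 0 while ∫_Γ conj z dz = 2i area(Ω), and the two integrands agree on Γ. As Γ may be irregular, the
line integrals are replaced by area integrals against cutoffs built from conj z - S
(`not_exists_primitive_schwarz`). -/

/-! ### Integrability of the Cauchy kernel and continuity of the Cauchy transform. -/

lemma integrableOn_ball_inv_norm (R : ℝ) (w : ℂ) :
    IntegrableOn (fun z : ℂ => ‖z - w‖⁻¹) (Metric.ball w R) := by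
  have h0 : IntegrableOn (fun z : ℂ => ‖z‖⁻¹) (Metric.ball 0 R) := by
    refine integrableOn_ball_of_norm_le_rpow (C := 1) (α := 1) (by simp) (by simp) ?_ ?_
    · filter_upwards with x
      simp [Real.rpow_neg_one]
    · exact (measurable_norm.inv).aestronglyMeasurable
  have hmp : MeasurePreserving (fun z : ℂ => z - w) volume volume := measurePreserving_sub_right volume w
  have := (hmp.integrableOn_comp_preimage (MeasurableEquiv.subRight w).measurableEmbedding
    (s := Metric.ball 0 R) (f := fun z : ℂ => ‖z‖⁻¹)).2 h0
  convert! this using 1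
  ext z; simp [dist_eq_norm]

/-- In polar coordinates the Jacobian cancels the singularity. The linear dependence on R makes the
truncation error of the Cauchy kernel uniformly small. -/
lemma setIntegral_ball_inv_norm {R : ℝ} (hR : 0 ≤ R) (w : ℂ) :
    ∫ z in Metric.ball w R, ‖z - w‖⁻¹ = 2 * Real.pi * R := by
  have h1 : ∫ z in Metric.ball w R, ‖z - w‖⁻¹ = ∫ z in Metric.ball (0:ℂ) R, ‖z‖⁻¹ := by
    have hmp : MeasurePreserving (fun z : ℂ => z - w) volume volume :=
      measurePreserving_sub_right volume w
    have := hmp.setIntegral_preimage_emb (MeasurableEquiv.subRight w).measurableEmbedding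
      (fun z : ℂ => ‖z‖⁻¹) (Metric.ball 0 R)
    rw [← this]
    congr 2
    ext z; simp [dist_eq_norm]
  rw [h1, ← integral_indicator Metric.isOpen_ball.measurableSet]
  have h2 : (Metric.ball (0:ℂ) R).indicator (fun z : ℂ => ‖z‖⁻¹) =
      fun z => (fun y : ℝ => (Iio R).indicator (fun y => y⁻¹) y) ‖z‖ := by
    ext z; by_cases h : ‖z‖ < R <;> simp [h]
  rw [h2, integral_fun_norm_addHaar]
  have h3 : ∫ y in Ioi (0:ℝ), y ^ (Module.finrank ℝ ℂ - 1) • (Iio R).indicator (fun y => y⁻¹) y = R := by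
    have : ∫ y in Ioi (0:ℝ), y ^ (Module.finrank ℝ ℂ - 1) • (Iio R).indicator (fun y => y⁻¹) y
        = ∫ y in Ioi (0:ℝ), (Iio R).indicator (fun _ => (1:ℝ)) y := by
      refine setIntegral_congr_fun measurableSet_Ioi fun y hy => ?_
      have hy' : y ≠ 0 := ne_of_gt hy
      by_cases h : y < R <;> simp [h, Complex.finrank_real_complex, hy']
    rw [this, setIntegral_indicator measurableSet_Iio, Ioi_inter_Iio]
    simp [hR]
  rw [h3]
  simp [Complex.finrank_real_complex, Measure.real, Complex.volume_ball, mul_assoc]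

/-- The Cauchy transform of `φ` over `Ω`. -/
noncomputable def cauchyTransform (Ω : Set ℂ) (φ : ℂ → ℂ) (w : ℂ) : ℂ :=
  ∫ z in Ω, φ z / (z - w)

lemma integrableOn_inv_norm {Ω : Set ℂ} (hΩ : Bornology.IsBounded Ω) (w : ℂ) :
    IntegrableOn (fun z : ℂ => ‖z - w‖⁻¹) Ω := by
  obtain ⟨R, hR⟩ := hΩ.subset_ball w
  exact (integrableOn_ball_inv_norm R w).mono_set hR

lemma exists_setIntegral_inv_norm_le {Ω : Set ℂ} (hΩ : Bornology.IsBounded Ω) {K : Set ℂ}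
    (hK : Bornology.IsBounded K) :
    ∃ M : ℝ, ∀ w ∈ K, ∫ z in Ω, ‖z - w‖⁻¹ ≤ M := by
  obtain ⟨R, hR⟩ := (hΩ.union hK).subset_ball 0
  have hR0 : ∀ w ∈ K, 0 < R := fun w hw => Metric.pos_of_mem_ball (hR (Or.inr hw))
  refine ⟨2 * Real.pi * (2 * R), fun w hw => ?_⟩
  rw [← setIntegral_ball_inv_norm (by linarith [hR0 w hw]) w]
  refine setIntegral_mono_set (integrableOn_ball_inv_norm _ w) (by filter_upwards with z; positivity) ?_
  refine LE.le.eventuallyLE fun z hz => ?_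
  have h1 := hR (Or.inl hz)
  have h2 := hR (Or.inr hw)
  rw [Metric.mem_ball] at *
  linarith [dist_triangle_right z w 0]

lemma integrableOn_cauchyKernel {Ω : Set ℂ} (hΩ : Bornology.IsBounded Ω) (hm : MeasurableSet Ω)
    {φ : ℂ → ℂ} (hφ : Measurable φ) {M : ℝ} (hM : ∀ z ∈ Ω, ‖φ z‖ ≤ M) (w : ℂ) :
    IntegrableOn (fun z => φ z / (z - w)) Ω := by
  refine Integrable.mono' ((integrableOn_inv_norm hΩ w).const_mul M) ?_ ?_
  · exact (hφ.div (measurable_id.sub_const w)).aestronglyMeasurable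
  · filter_upwards [ae_restrict_mem hm] with z hz
    rw [norm_div, div_eq_mul_inv]
    gcongr
    exact hM z hz

lemma continuous_cauchyTransform {Ω : Set ℂ} (hΩ : Bornology.IsBounded Ω) (hm : MeasurableSet Ω)
    {φ : ℂ → ℂ} (hφ : Measurable φ) {M : ℝ} (hM : ∀ z ∈ Ω, ‖φ z‖ ≤ M) :
    Continuous (cauchyTransform Ω φ) := by
  have hMeas : volume Ω < ⊤ := hΩ.measure_lt_top
  have : IsFiniteMeasure (volume.restrict Ω) := ⟨by simpa using hMeas⟩
  -- Truncation of 1/ζ = conj ζ / |ζ|²: continuous, bounded by 1/δ, equal to 1/ζ for |ζ| ≥ δ. The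
  -- Cauchy transform is a uniform limit of the transforms with this kernel.
  let k : ℝ → ℂ → ℂ := fun δ ζ => (starRingEnd ℂ) ζ / ((max ‖ζ‖ δ : ℝ) : ℂ) ^ 2
  have hkc : ∀ δ > 0, Continuous (k δ) := fun δ hδ => by
    refine Continuous.div (by fun_prop) (by fun_prop) fun ζ => ?_
    have : 0 < max ‖ζ‖ δ := lt_max_of_lt_right hδ
    exact pow_ne_zero _ (by exact_mod_cast this.ne')
  have hkb : ∀ δ > 0, ∀ ζ, ‖k δ ζ‖ ≤ δ⁻¹ := fun δ hδ ζ => by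
    have h1 : 0 < max ‖ζ‖ δ := lt_max_of_lt_right hδ
    simp only [k, norm_div, norm_pow, Complex.norm_real, Real.norm_eq_abs, abs_of_pos h1,
      RCLike.norm_conj]
    rw [div_le_iff₀ (by positivity), inv_mul_eq_div, le_div_iff₀ hδ, pow_two]
    exact mul_le_mul (le_max_left _ _) (le_max_right _ _) hδ.le h1.le
  have hkd : ∀ δ > 0, ∀ ζ, ‖ζ⁻¹ - k δ ζ‖ ≤ (Metric.ball (0:ℂ) δ).indicator (fun ζ => ‖ζ‖⁻¹) ζ := by
    intro δ hδ ζ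
    by_cases h : ‖ζ‖ < δ
    · have : ζ⁻¹ - k δ ζ = ζ⁻¹ * ((1 - (‖ζ‖ / δ) ^ 2 : ℝ) : ℂ) := by
        rcases eq_or_ne ζ 0 with rfl | h0
        · simp [k]
        · simp only [k, max_eq_right h.le]
          have hδ' : (δ : ℂ) ≠ 0 := by exact_mod_cast hδ.ne'
          push_cast
          field_simp
          rw [Complex.mul_conj']
      rw [indicator_of_mem (by simpa using h), this, norm_mul, norm_inv, Complex.norm_real]
      have h2 : ‖ζ‖ / δ ≤ 1 := by rw [div_le_one hδ]; exact h.le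
      have h3 : 0 ≤ ‖ζ‖ / δ := by positivity
      refine mul_le_of_le_one_right (by positivity) ?_
      rw [Real.norm_eq_abs, abs_le]
      constructor <;> nlinarith
    · rw [indicator_of_notMem (by simpa using h)]
      have h' := not_lt.1 h
      have h0 : ζ ≠ 0 := by rintro rfl; simp at h'; linarith
      have hz : (‖ζ‖ : ℂ) ≠ 0 := by simpa using h0
      simp only [k, max_eq_left h']
      rw [← Complex.mul_conj']
      have : (starRingEnd ℂ) ζ ≠ 0 := by simpa using h0
      field_simp
      simp
  have hM0 : ∀ z ∈ Ω, ‖φ z‖ ≤ |M| := fun z hz => (hM z hz).trans (le_abs_self M)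
  refine continuous_of_uniform_approx_of_continuous fun u hu => ?_
  obtain ⟨ε, hε, hεu⟩ := Metric.mem_uniformity_dist.1 hu
  -- The error is at most |M| · 2πδ; the summand 1 keeps the denominator positive and the final
  -- inequality strict.
  let δ : ℝ := ε / (|M| * (2 * Real.pi) + 1)
  have hδ : 0 < δ := by positivity
  refine ⟨fun w => ∫ z in Ω, φ z * k δ (z - w), ?_, ?_⟩
  · refine continuous_of_dominated (bound := fun _ => |M| * δ⁻¹) ?_ ?_ (integrable_const _) ?_
    · intro w
      exact (hφ.mul ((hkc δ hδ).measurable.comp (measurable_id.sub_const w))).aestronglyMeasurable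
    · intro w
      filter_upwards [ae_restrict_mem hm] with z hz
      rw [norm_mul]
      exact mul_le_mul (hM0 z hz) (hkb δ hδ _) (norm_nonneg _) (abs_nonneg _)
    · filter_upwards with z
      exact continuous_const.mul ((hkc δ hδ).comp (continuous_const.sub continuous_id))
  · intro w
    refine hεu ?_
    rw [dist_eq_norm, cauchyTransform, ← integral_sub]
    · calc _ ≤ ∫ z in Ω, |M| * (Metric.ball w δ).indicator (fun ζ => ‖ζ - w‖⁻¹) z := by
            refine norm_integral_le_of_norm_le ?_ ?_
            · refine Integrable.const_mul ?_ _
              exact ((integrableOn_ball_inv_norm δ w).integrable_indicator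
                Metric.isOpen_ball.measurableSet).integrableOn
            · filter_upwards [ae_restrict_mem hm] with z hz
              rw [div_eq_mul_inv, ← mul_sub, norm_mul]
              refine mul_le_mul (hM0 z hz) ?_ (norm_nonneg _) (abs_nonneg _)
              refine (hkd δ hδ (z - w)).trans (le_of_eq ?_)
              by_cases h : ‖z - w‖ < δ <;> simp [h, dist_eq_norm, indicator]
        _ ≤ |M| * (2 * Real.pi * δ) := by
            rw [integral_const_mul, ← setIntegral_ball_inv_norm hδ.le w,
              ← integral_indicator Metric.isOpen_ball.measurableSet]
            refine mul_le_mul_of_nonneg_left ?_ (abs_nonneg M)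
            refine integral_mono_measure Measure.restrict_le_self ?_ ?_
            · filter_upwards with z
              exact indicator_nonneg (fun x _ => inv_nonneg.2 (norm_nonneg (x - w))) z
            · exact (integrableOn_ball_inv_norm δ w).integrable_indicator
                Metric.isOpen_ball.measurableSet
        _ < ε := by
            have h : |M| * (2 * Real.pi * δ) = ε * (|M| * (2 * Real.pi)) / (|M| * (2 * Real.pi) + 1) := by
              simp only [δ]; field_simp
            rw [h, div_lt_iff₀ (by positivity)]
            nlinarith
    · exact integrableOn_cauchyKernel hΩ hm hφ hM w
    · refine Measure.integrableOn_of_bounded (M := |M| * δ⁻¹) hMeas.ne ?_ ?_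
      · exact (hφ.mul ((hkc δ hδ).measurable.comp (measurable_id.sub_const w))).aestronglyMeasurable
      · filter_upwards [ae_restrict_mem hm] with z hz
        rw [norm_mul]
        exact mul_le_mul (hM0 z hz) (hkb δ hδ _) (norm_nonneg _) (abs_nonneg _)

/-! ### The Cauchy transform solves the ∂̄-equation. -/

open Complex in
lemma integral_div_affine_eq_log (p e : ℂ) (a b : ℝ)
    (h : ∀ t ∈ uIcc a b, p + t * e ∈ slitPlane) :
    ∫ t in a..b, e / (p + t * e) = log (p + b * e) - log (p + a * e) := by
  refine intervalIntegral.integral_eq_sub_of_hasDerivAt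
    (f := fun t : ℝ => log (p + t * e)) (fun t ht => ?_) ?_
  · have h1 : HasDerivAt (fun t : ℝ => p + t * e) e t := by
      simpa using ((hasDerivAt_id t).ofReal_comp.mul_const e).const_add p
    exact h1.clog_real (h t ht)
  · refine ContinuousOn.intervalIntegrable ?_
    refine ContinuousOn.div (by fun_prop) (by fun_prop) fun t ht => slitPlane_ne_zero (h t ht)

/-- The integral of `f` over the boundary of a rectangle. -/
noncomputable def rectIntegral (f : ℂ → ℂ) (a b c d : ℝ) : ℂ :=
  (∫ x : ℝ in a..b, f (x + c * Complex.I)) - (∫ x : ℝ in a..b, f (x + d * Complex.I)) +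
    Complex.I • (∫ y : ℝ in c..d, f (b + y * Complex.I)) -
    Complex.I • (∫ y : ℝ in c..d, f (a + y * Complex.I))

-- Each side is integrated with the principal logarithm of w - z, which is analytic along the
-- bottom, top and right sides. The left side crosses the cut, so log (z - w) is used there (the
-- sign `s = -1`); the mismatches of πi at the two left corners add up to the 2πi.
open Complex in
lemma rectIntegral_cauchyKernel_of_mem {z : ℂ} {a b c d : ℝ} (hz : z ∈ Ioo a b ×ℂ Ioo c d) :
    rectIntegral (fun w => (z - w)⁻¹) a b c d = -(2 * Real.pi * I) := by
  obtain ⟨⟨ha, hb⟩, hc, hd⟩ := hz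
  have key : ∀ (p e : ℂ) (s : ℂ) (α β : ℝ), e ≠ 0 → s ^ 2 = 1 →
      (∀ t ∈ uIcc α β, s * (p - z) + t * (s * e) ∈ slitPlane) →
      e * ∫ t in α..β, (z - (p + t * e))⁻¹ =
        -(log (s * (p - z) + β * (s * e)) - log (s * (p - z) + α * (s * e))) := by
    intro p e s α β he hs h
    have hs0 : s ≠ 0 := by rintro rfl; simp at hs
    rw [← integral_div_affine_eq_log _ _ _ _ h, ← intervalIntegral.integral_const_mul,
      ← intervalIntegral.integral_neg]
    congr 1; ext t
    rw [show s * (p - z) + t * (s * e) = -s * (z - (p + t * e)) by ring]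
    rw [div_eq_mul_inv, mul_inv, inv_neg]
    field_simp
  have e1 := key (c * I) 1 1 a b one_ne_zero (by simp) (fun t _ => by
    right; simp; linarith)
  have e2 := key (d * I) 1 1 a b one_ne_zero (by simp) (fun t _ => by
    right; simp; linarith)
  have e3 := key b I 1 c d I_ne_zero (by simp) (fun t _ => by
    left; simp; linarith)
  have e4 := key a I (-1) c d I_ne_zero (by simp) (fun t _ => by
    left; simp; linarith)
  have lp : ∀ w : ℂ, 0 < w.im → log w = log (-w) + Real.pi * I := fun w hw => by
    rw [log, log, arg_neg_eq_arg_sub_pi_of_im_pos hw]; push_cast; rw [norm_neg]; ring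
  have ln : ∀ w : ℂ, w.im < 0 → log w = log (-w) - Real.pi * I := fun w hw => by
    rw [log, log, arg_neg_eq_arg_add_pi_of_im_neg hw]; push_cast; rw [norm_neg]; ring
  have hA := ln (a + c * I - z) (by simpa using hc)
  have hD := lp (a + d * I - z) (by simpa using hd)
  rw [rectIntegral]
  simp only [smul_eq_mul]
  simp only [one_mul, mul_one] at e1 e2 e3
  have f1 : ∀ (x : ℝ) (y : ℝ), (x : ℂ) + y * I = y * I + x := fun x y => by ring
  simp only [f1 _ c, f1 _ d]
  rw [e1, e2, e3, e4]
  rw [show (c * I - z + a : ℂ) = a + c * I - z by ring, hA,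
    show (d * I - z + a : ℂ) = a + d * I - z by ring, hD,
    show (-1 * (a - z) + d * (-1 * I) : ℂ) = -(a + d * I - z) by ring,
    show (-1 * (a - z) + c * (-1 * I) : ℂ) = -(a + c * I - z) by ring,
    show (c * I - z + b : ℂ) = b - z + c * I by ring,
    show (d * I - z + b : ℂ) = b - z + d * I by ring]
  ring

open Complex in
lemma rectIntegral_cauchyKernel_of_notMem {z : ℂ} {a b c d : ℝ} (hab : a ≤ b) (hcd : c ≤ d)
    (hz : z ∉ Icc a b ×ℂ Icc c d) :
    rectIntegral (fun w => (z - w)⁻¹) a b c d = 0 := by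
  have h := integral_boundary_rect_eq_zero_of_differentiableOn (fun w : ℂ => (z - w)⁻¹)
    (a + c * I) (b + d * I) ?_
  · simpa [rectIntegral] using h
  · intro w hw
    refine DifferentiableAt.differentiableWithinAt ?_
    refine DifferentiableAt.inv (by fun_prop) (sub_ne_zero.2 ?_)
    rintro rfl
    simp [uIcc_of_le hab, uIcc_of_le hcd] at hw
    exact hz hw

/-- Fubini, justified by the bound on ∫ |z - w|⁻¹ that is uniform for w on the path. -/
lemma intervalIntegral_cauchyTransform {Ω : Set ℂ} (hΩ : Bornology.IsBounded Ω)
    (hm : MeasurableSet Ω) {φ : ℂ → ℂ} (hφ : Measurable φ) {M : ℝ} (hM : ∀ z ∈ Ω, ‖φ z‖ ≤ M)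
    {γ : ℝ → ℂ} (hγ : Continuous γ) {a b : ℝ} (hab : a ≤ b) :
    (∫ t in a..b, cauchyTransform Ω φ (γ t) = ∫ z in Ω, φ z * ∫ t in a..b, (z - γ t)⁻¹) ∧
    IntegrableOn (fun z => φ z * ∫ t in a..b, (z - γ t)⁻¹) Ω := by
  simp only [intervalIntegral.integral_of_le hab]
  have hint : Integrable (Function.uncurry fun (t : ℝ) (z : ℂ) => φ z / (z - γ t))
      ((volume.restrict (Ioc a b)).prod (volume.restrict Ω)) := by
    have hms : Measurable (Function.uncurry fun (t : ℝ) (z : ℂ) => φ z / (z - γ t)) :=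
      (hφ.comp measurable_snd).div (measurable_snd.sub (hγ.measurable.comp measurable_fst))
    rw [integrable_prod_iff hms.aestronglyMeasurable]
    refine ⟨?_, ?_⟩
    · filter_upwards with t
      exact integrableOn_cauchyKernel hΩ hm hφ hM (γ t)
    · obtain ⟨N, hN⟩ := exists_setIntegral_inv_norm_le hΩ
        ((isCompact_Icc (a := a) (b := b)).image hγ).isBounded
      have hfin : volume (Ioc a b) ≠ ⊤ := by simp
      refine Measure.integrableOn_of_bounded (M := |M| * N) hfin ?_ ?_
      · exact (hms.norm.stronglyMeasurable.integral_prod_right (ν := volume.restrict Ω)).aestronglyMeasurable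
      · filter_upwards [ae_restrict_mem measurableSet_Ioc] with t ht
        rw [Real.norm_of_nonneg (integral_nonneg fun z => norm_nonneg _)]
        have h2 : ∫ z in Ω, ‖z - γ t‖⁻¹ ≤ N := hN _ ⟨t, ⟨ht.1.le, ht.2⟩, rfl⟩
        calc _ ≤ ∫ z in Ω, |M| * ‖z - γ t‖⁻¹ := by
              refine integral_mono_ae (integrableOn_cauchyKernel hΩ hm hφ hM (γ t)).norm
                ((integrableOn_inv_norm hΩ _).const_mul _) ?_
              filter_upwards [ae_restrict_mem hm] with z hz
              simp only [Function.uncurry_apply_pair, div_eq_mul_inv, norm_mul, norm_inv]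
              gcongr
              exact (hM z hz).trans (le_abs_self M)
          _ ≤ |M| * N := by
              rw [integral_const_mul]; gcongr
  refine ⟨?_, ?_⟩
  · simp only [cauchyTransform]
    rw [integral_integral_swap hint]
    simp only [div_eq_mul_inv, integral_const_mul]
  · have := hint.integral_prod_right
    simp only [Function.uncurry_apply_pair, div_eq_mul_inv, integral_const_mul] at this
    exact this

lemma volume_rect_frontier (a b c d : ℝ) :
    volume ((Icc a b ×ℂ Icc c d) \ (Ioo a b ×ℂ Ioo c d)) = 0 := by
  have h1 : Convex ℝ (Icc a b ×ℂ Icc c d) := by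
    have := ((convex_Icc a b).linear_preimage Complex.reLm).inter
      ((convex_Icc c d).linear_preimage Complex.imLm)
    exact this
  have h2 := h1.addHaar_frontier volume
  rwa [frontier, (isClosed_Icc.reProdIm isClosed_Icc).closure_eq, Complex.interior_reProdIm,
    interior_Icc, interior_Icc] at h2

/-- After Fubini only the winding number of the rectangle about z is left, and the boundary of the
rectangle, where it is undefined, is a null set. -/
lemma rectIntegral_cauchyTransform {Ω : Set ℂ} (hΩ : Bornology.IsBounded Ω)
    (hm : MeasurableSet Ω) {φ : ℂ → ℂ} (hφ : Measurable φ) {M : ℝ} (hM : ∀ z ∈ Ω, ‖φ z‖ ≤ M)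
    {a b c d : ℝ} (hab : a ≤ b) (hcd : c ≤ d) (hR : Icc a b ×ℂ Icc c d ⊆ Ω) :
    rectIntegral (cauchyTransform Ω φ) a b c d =
      -(2 * Real.pi * Complex.I) * ∫ z in Icc a b ×ℂ Icc c d, φ z := by
  obtain ⟨e1, i1⟩ := intervalIntegral_cauchyTransform hΩ hm hφ hM
    (γ := fun x : ℝ => x + c * Complex.I) (by fun_prop) hab
  obtain ⟨e2, i2⟩ := intervalIntegral_cauchyTransform hΩ hm hφ hM
    (γ := fun x : ℝ => x + d * Complex.I) (by fun_prop) hab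
  obtain ⟨e3, i3⟩ := intervalIntegral_cauchyTransform hΩ hm hφ hM
    (γ := fun y : ℝ => b + y * Complex.I) (by fun_prop) hcd
  obtain ⟨e4, i4⟩ := intervalIntegral_cauchyTransform hΩ hm hφ hM
    (γ := fun y : ℝ => a + y * Complex.I) (by fun_prop) hcd
  rw [rectIntegral, e1, e2, e3, e4, ← integral_sub i1 i2, ← integral_smul, ← integral_smul,
    ← integral_add (by exact i1.sub i2) (by exact i3.smul Complex.I),
    ← integral_sub (by exact (i1.sub i2).add (i3.smul Complex.I)) (by exact i4.smul Complex.I)]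
  have hRm : MeasurableSet (Icc a b ×ℂ Icc c d) :=
    (isClosed_Icc.reProdIm isClosed_Icc).measurableSet
  have hae : ∀ᵐ z ∂(volume : Measure ℂ), z ∉ (Icc a b ×ℂ Icc c d) \ (Ioo a b ×ℂ Ioo c d) :=
    measure_eq_zero_iff_ae_notMem.1 (volume_rect_frontier a b c d)
  calc _ = ∫ z in Ω, (Icc a b ×ℂ Icc c d).indicator
        (fun z => -(2 * Real.pi * Complex.I) * φ z) z := by
        refine integral_congr_ae (ae_restrict_of_ae ?_)
        filter_upwards [hae] with z hz
        trans φ z * rectIntegral (fun w => (z - w)⁻¹) a b c d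
        · simp only [rectIntegral, smul_eq_mul]; ring
        · by_cases h : z ∈ Icc a b ×ℂ Icc c d
          · rw [indicator_of_mem h, rectIntegral_cauchyKernel_of_mem (by simp at hz; exact hz h)]
            ring
          · rw [indicator_of_notMem h, rectIntegral_cauchyKernel_of_notMem hab hcd h, mul_zero]
    _ = _ := by
        rw [setIntegral_indicator hRm, inter_eq_right.2 hR, integral_const_mul]

lemma setIntegral_reProdIm {f : ℂ → ℂ} {a b c d : ℝ} (hab : a ≤ b) (hcd : c ≤ d)
    (hf : IntegrableOn f (Icc a b ×ℂ Icc c d)) :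
    ∫ z in Icc a b ×ℂ Icc c d, f z =
      ∫ x in a..b, ∫ y in c..d, f (x + y * Complex.I) := by
  have hmp := Complex.volume_preserving_equiv_real_prod.symm
  have hemb := Complex.measurableEquivRealProd.symm.measurableEmbedding
  have hset : (Complex.measurableEquivRealProd.symm) ⁻¹' (Icc a b ×ℂ Icc c d) =
      Icc a b ×ˢ Icc c d := by
    ext ⟨x, y⟩
    simp only [mem_preimage, Complex.mem_reProdIm, mem_prod]
    rfl
  have h1 := hmp.setIntegral_preimage_emb hemb f (Icc a b ×ℂ Icc c d)
  have h2 := (hmp.integrableOn_comp_preimage hemb (f := f) (s := Icc a b ×ℂ Icc c d)).2 hf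
  rw [hset] at h1 h2
  rw [← h1, intervalIntegral.integral_of_le hab, ← integral_Icc_eq_integral_Ioc]
  rw [Measure.volume_eq_prod, setIntegral_prod (fun q => f (Complex.measurableEquivRealProd.symm q)) h2]
  refine setIntegral_congr_fun measurableSet_Icc fun x hx => ?_
  rw [intervalIntegral.integral_of_le hcd, ← integral_Icc_eq_integral_Ioc]
  refine setIntegral_congr_fun measurableSet_Icc fun y hy => ?_
  rw [← Complex.mk_eq_add_mul_I]
  rfl

lemma rectIntegral_swap_re (f : ℂ → ℂ) (a b c d : ℝ) :
    rectIntegral f b a c d = -rectIntegral f a b c d := by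
  simp only [rectIntegral, intervalIntegral.integral_symm a b]; ring

lemma rectIntegral_swap_im (f : ℂ → ℂ) (a b c d : ℝ) :
    rectIntegral f a b d c = -rectIntegral f a b c d := by
  simp only [rectIntegral, intervalIntegral.integral_symm c d, smul_neg]; ring

/-- If `∂v/∂z̄ = φ` on `Ω`, then `v` plus the normalized Cauchy transform of `φ` is holomorphic. -/
lemma differentiableOn_add_cauchyTransform {Ω : Set ℂ} (hΩo : IsOpen Ω)
    (hΩ : Bornology.IsBounded Ω) {φ : ℂ → ℂ} (hφ : Measurable φ) {M : ℝ}
    (hM : ∀ z ∈ Ω, ‖φ z‖ ≤ M) {v : ℂ → ℂ} {v' : ℂ → ℂ →L[ℝ] ℂ}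
    (hv : ∀ z ∈ Ω, HasFDerivAt v (v' z) z)
    (hv' : ∀ z ∈ Ω, v' z 1 + Complex.I * v' z Complex.I = 2 * φ z) :
    DifferentiableOn ℂ (fun w => v w + (Real.pi : ℂ)⁻¹ * cauchyTransform Ω φ w) Ω := by
  have hc := continuous_cauchyTransform hΩ hΩo.measurableSet hφ hM
  set T := cauchyTransform Ω φ with hT
  have hvc : ContinuousOn v Ω := fun z hz => (hv z hz).continuousAt.continuousWithinAt
  set g : ℂ → ℂ := fun w => v w + (Real.pi : ℂ)⁻¹ * T w with hg
  have hgc : ContinuousOn g Ω := hvc.add (continuous_const.mul hc).continuousOn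
  -- Morera: T is only known to be continuous, so rectangle integrals are computed. Green's formula
  -- for v and the winding number computation for T give opposite contributions.
  rw [← Complex.isConservativeOn_and_continuousOn_iff_isDifferentiableOn hΩo]
  refine ⟨?_, hgc⟩
  have key : ∀ a b c d : ℝ, a ≤ b → c ≤ d → Icc a b ×ℂ Icc c d ⊆ Ω →
      rectIntegral g a b c d = 0 := by
    intro a b c d hab hcd hR
    have hi : ∀ (γ : ℝ → ℂ) (α β : ℝ), Continuous γ → (∀ t ∈ uIcc α β, γ t ∈ Ω) →
        ∫ t in α..β, g (γ t) = (∫ t in α..β, v (γ t)) + (Real.pi : ℂ)⁻¹ * ∫ t in α..β, T (γ t) := by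
      intro γ α β hγ hm
      rw [← intervalIntegral.integral_const_mul, ← intervalIntegral.integral_add]
      · exact (hvc.comp hγ.continuousOn hm).intervalIntegrable
      · exact ((continuous_const.mul (hc.comp hγ))).intervalIntegrable _ _
    have m1 : ∀ y ∈ Icc c d, ∀ t ∈ uIcc a b, ((t : ℂ) + y * Complex.I) ∈ Ω := fun y hy t ht =>
      hR (by rw [uIcc_of_le hab] at ht; simpa [Complex.mem_reProdIm] using ⟨ht, hy⟩)
    have m2 : ∀ x ∈ Icc a b, ∀ t ∈ uIcc c d, ((x : ℂ) + t * Complex.I) ∈ Ω := fun y hy t ht =>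
      hR (by rw [uIcc_of_le hcd] at ht; simpa [Complex.mem_reProdIm] using ⟨hy, ht⟩)
    have split : rectIntegral g a b c d =
        rectIntegral v a b c d + (Real.pi : ℂ)⁻¹ * rectIntegral T a b c d := by
      simp only [rectIntegral]
      rw [hi (fun t => t + c * Complex.I) a b (by fun_prop) (m1 c ⟨le_rfl, hcd⟩),
        hi (fun t => t + d * Complex.I) a b (by fun_prop) (m1 d ⟨hcd, le_rfl⟩),
        hi (fun t => b + t * Complex.I) c d (by fun_prop) (m2 b ⟨hab, le_rfl⟩),
        hi (fun t => a + t * Complex.I) c d (by fun_prop) (m2 a ⟨le_rfl, hab⟩)]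
      simp only [smul_eq_mul]; ring
    have hcomp : IsCompact (Icc a b ×ℂ Icc c d) := isCompact_Icc.reProdIm isCompact_Icc
    have hφi : IntegrableOn φ (Icc a b ×ℂ Icc c d) := by
      refine Measure.integrableOn_of_bounded (M := M) hcomp.measure_lt_top.ne
        hφ.aestronglyMeasurable ?_
      filter_upwards [ae_restrict_mem hcomp.measurableSet] with z hz using hM z (hR hz)
    have hEq : ∀ z ∈ Icc a b ×ℂ Icc c d,
        Complex.I • v' z 1 - v' z Complex.I = 2 * Complex.I * φ z := fun z hz => by
      have := hv' z (hR hz)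
      linear_combination Complex.I * this - v' z Complex.I * Complex.I_mul_I
    have green := Complex.integral_boundary_rect_of_continuousOn_of_hasFDerivAt_real v v'
      (a + c * Complex.I) (b + d * Complex.I)
      (by simpa [uIcc_of_le hab, uIcc_of_le hcd] using hvc.mono hR)
      (fun z hz => hv z (hR (by
        simp [hab, hcd] at hz
        exact ⟨Ioo_subset_Icc_self hz.1, Ioo_subset_Icc_self hz.2⟩)))
      (by
        simp only [Complex.add_re, Complex.ofReal_re, Complex.mul_re, Complex.I_re, mul_zero,
          Complex.ofReal_im, Complex.I_im, mul_one, sub_self, add_zero, Complex.add_im,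
          Complex.mul_im, zero_add, uIcc_of_le hab, uIcc_of_le hcd]
        exact IntegrableOn.congr_fun (hφi.const_mul (2 * Complex.I)) (fun z hz => (hEq z hz).symm)
          hcomp.measurableSet)
    have green' : rectIntegral v a b c d = 2 * Complex.I * ∫ z in Icc a b ×ℂ Icc c d, φ z := by
      rw [← integral_const_mul, ← setIntegral_congr_fun hcomp.measurableSet hEq]
      rw [setIntegral_reProdIm hab hcd]
      · simpa [rectIntegral] using green
      · exact IntegrableOn.congr_fun (hφi.const_mul (2 * Complex.I)) (fun z hz => (hEq z hz).symm)
          hcomp.measurableSet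
    rw [split, green', rectIntegral_cauchyTransform hΩ hΩo.measurableSet hφ hM hab hcd hR]
    have : (Real.pi : ℂ) ≠ 0 := by exact_mod_cast Real.pi_ne_zero
    field_simp
    ring
  intro z w hzw
  rw [← add_eq_zero_iff_eq_neg, Complex.wedgeIntegral_add_wedgeIntegral_eq]
  change rectIntegral g z.re w.re z.im w.im = 0
  rw [Complex.Rectangle] at hzw
  rcases le_total z.re w.re with h1 | h1 <;> rcases le_total z.im w.im with h2 | h2
  · rw [uIcc_of_le h1, uIcc_of_le h2] at hzw
    exact key _ _ _ _ h1 h2 hzw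
  · rw [uIcc_of_le h1, uIcc_of_ge h2] at hzw
    rw [rectIntegral_swap_im, key _ _ _ _ h1 h2 hzw, neg_zero]
  · rw [uIcc_of_ge h1, uIcc_of_le h2] at hzw
    rw [rectIntegral_swap_re, key _ _ _ _ h1 h2 hzw, neg_zero]
  · rw [uIcc_of_ge h1, uIcc_of_ge h2] at hzw
    rw [rectIntegral_swap_im, rectIntegral_swap_re, key _ _ _ _ h1 h2 hzw, neg_zero, neg_zero]

/-! ### Branches of (z - w)^(-s) for w outside the domain. -/

/-- A continuous logarithm exists by simple connectedness; being a local inverse of exp, it is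
holomorphic. The functions exp (-s L) are then branches of (z - w)^(-s). -/
lemma exists_differentiableOn_log_sub {Ω : Set ℂ} (hΩo : IsOpen Ω) (hsc : IsSimplyConnected Ω)
    {w : ℂ} (hw : w ∉ Ω) :
    ∃ L : ℂ → ℂ, (∀ z ∈ Ω, HasDerivAt L (z - w)⁻¹ z) ∧ ∀ z ∈ Ω, Complex.exp (L z) = z - w := by
  obtain ⟨L, hLc, hL⟩ := Complex.exists_continuousOn_eqOn_exp_comp hsc hΩo
    (g := fun z : ℂ => z - w) (by fun_prop) (by
      rintro ⟨z, hz, h⟩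
      exact hw (by rwa [← sub_eq_zero.1 h]))
  have hL' : ∀ z ∈ Ω, Complex.exp (L z) = z - w := fun z hz => hL hz
  refine ⟨L, fun z hz => ?_, hL'⟩
  have h1 : HasDerivAt (fun x => Complex.exp x + w) (z - w) (L z) := by
    simpa [hL' z hz] using (Complex.hasDerivAt_exp (L z)).add_const w
  refine HasDerivAt.of_local_left_inverse (hLc.continuousAt (hΩo.mem_nhds hz)) h1 ?_ ?_
  · rw [← hL' z hz]; exact Complex.exp_ne_zero _
  · filter_upwards [hΩo.mem_nhds hz] with y hy
    rw [hL' y hy]; ring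

lemma norm_exp_neg_mul_log {L : ℂ → ℂ} {z w : ℂ} (h : Complex.exp (L z) = z - w) (s : ℝ) :
    ‖Complex.exp (-(s * L z))‖ = ‖z - w‖ ^ (-s) := by
  rw [← h, Complex.norm_exp, Complex.norm_exp, ← Real.exp_mul]
  simp [mul_comm]

/-- The square of the modulus is |z - w|^(-2s), locally integrable in the plane since 2s < 2. -/
lemma memBergman_exp_neg_mul_log {Ω : Set ℂ} (hΩo : IsOpen Ω) (hΩ : Bornology.IsBounded Ω)
    {w : ℂ} {L : ℂ → ℂ} (hL : ∀ z ∈ Ω, HasDerivAt L (z - w)⁻¹ z)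
    (hexp : ∀ z ∈ Ω, Complex.exp (L z) = z - w) {s : ℝ} (hs : s < 1) :
    MemBergman Ω (fun z => Complex.exp (-(s * L z))) := by
  have hd : DifferentiableOn ℂ (fun z => Complex.exp (-(s * L z))) Ω := fun z hz =>
    (((hL z hz).differentiableAt.const_mul (s : ℂ)).neg.cexp).differentiableWithinAt
  refine ⟨hd, ?_⟩
  rw [memLp_two_iff_integrable_sq_norm (hd.continuousOn.aestronglyMeasurable hΩo.measurableSet)]
  obtain ⟨R, hR⟩ := hΩ.subset_ball w
  have h0 : IntegrableOn (fun z : ℂ => ‖z‖ ^ (-(2 * s))) (Metric.ball 0 R) := by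
    refine integrableOn_ball_of_norm_le_rpow (C := 1) (α := 2 * s) (by simp) ?_ ?_ ?_
    · simp [Complex.finrank_real_complex]; linarith
    · filter_upwards with x
      rw [one_mul, Real.norm_of_nonneg (by positivity)]
    · exact (measurable_norm.pow_const _).aestronglyMeasurable
  have hmp : MeasurePreserving (fun z : ℂ => z - w) volume volume :=
    measurePreserving_sub_right volume w
  have h1 := (hmp.integrableOn_comp_preimage (MeasurableEquiv.subRight w).measurableEmbedding
    (s := Metric.ball 0 R) (f := fun z : ℂ => ‖z‖ ^ (-(2 * s)))).2 h0
  have h2 : IntegrableOn (fun z : ℂ => ‖z - w‖ ^ (-(2 * s))) Ω :=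
    h1.mono_set fun z hz => by simpa [dist_eq_norm] using hR hz
  refine h2.congr ?_
  filter_upwards [ae_restrict_mem hΩo.measurableSet] with z hz
  rw [norm_exp_neg_mul_log (hexp z hz), ← Real.rpow_natCast, ← Real.rpow_mul (norm_nonneg _)]
  congr 1; push_cast; ring

/-- For w on the boundary 1/(z - w) need not be square integrable, so it is approached through
exponents s < 1. On a bounded domain |z - w|^(-s) is dominated by a constant multiple of |z - w|⁻¹.
-/
lemma tendsto_integral_mul_exp_neg_mul_log {Ω : Set ℂ} (hΩo : IsOpen Ω)
    (hΩ : Bornology.IsBounded Ω) {w : ℂ} (hw : w ∉ Ω) {L : ℂ → ℂ}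
    (hL : ∀ z ∈ Ω, HasDerivAt L (z - w)⁻¹ z)
    (hexp : ∀ z ∈ Ω, Complex.exp (L z) = z - w) {φ : ℂ → ℂ} (hφ : Measurable φ) {M : ℝ}
    (hM : ∀ z ∈ Ω, ‖φ z‖ ≤ M) :
    Tendsto (fun s : ℝ => ∫ z in Ω, φ z * Complex.exp (-(s * L z))) (𝓝[<] 1)
      (𝓝 (cauchyTransform Ω φ w)) := by
  obtain ⟨R, hR⟩ := hΩ.subset_ball w
  have hLc : ContinuousOn L Ω := fun z hz => (hL z hz).continuousAt.continuousWithinAt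
  refine tendsto_integral_filter_of_dominated_convergence
    (fun z => (|M| * max R 1) * ‖z - w‖⁻¹) ?_ ?_ ((integrableOn_inv_norm hΩ w).const_mul _) ?_
  · filter_upwards with s
    refine hφ.aestronglyMeasurable.mul ?_
    exact ContinuousOn.aestronglyMeasurable (by fun_prop) hΩo.measurableSet
  · filter_upwards [Ioo_mem_nhdsLT (show (0:ℝ) < 1 by norm_num)] with s hs
    filter_upwards [ae_restrict_mem hΩo.measurableSet] with z hz
    rw [norm_mul, norm_exp_neg_mul_log (hexp z hz), mul_assoc]
    have h0 : 0 < ‖z - w‖ := norm_pos_iff.2 (sub_ne_zero.2 (by rintro rfl; exact hw hz))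
    have h1 : ‖z - w‖ ^ (-s) = ‖z - w‖ ^ (1 - s) * ‖z - w‖⁻¹ := by
      rw [← Real.rpow_neg_one, ← Real.rpow_add h0]; congr 1; ring
    have h2 : ‖z - w‖ ≤ max R 1 := by
      have := hR hz
      rw [Metric.mem_ball, dist_eq_norm] at this
      exact this.le.trans (le_max_left _ _)
    have h3 : ‖z - w‖ ^ (1 - s) ≤ max R 1 :=
      calc ‖z - w‖ ^ (1 - s) ≤ (max R 1) ^ (1 - s) :=
            Real.rpow_le_rpow h0.le h2 (by linarith [hs.2])
        _ ≤ (max R 1) ^ (1 : ℝ) :=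
            Real.rpow_le_rpow_of_exponent_le (le_max_right _ _) (by linarith [hs.1])
        _ = _ := Real.rpow_one _
    rw [h1]
    gcongr
    exact (hM z hz).trans (le_abs_self M)
  · filter_upwards [ae_restrict_mem hΩo.measurableSet] with z hz
    rw [div_eq_mul_inv, ← hexp z hz, ← Complex.exp_neg]
    refine Tendsto.const_mul _ ?_
    have : Continuous fun s : ℝ => Complex.exp (-(s * L z)) := by fun_prop
    have := this.tendsto 1
    simp only [Complex.ofReal_one, one_mul] at this
    exact this.mono_left nhdsWithin_le_nhds

/-! ### Orthogonality of the error, and the equation |z|² = 2 Re P on the boundary. -/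

lemma inner_eq_zero_of_forall_norm_le {E : Type*} [NormedAddCommGroup E] [InnerProductSpace ℂ E]
    {x y : E} (h : ∀ t : ℂ, ‖x‖ ≤ ‖x - t • y‖) : inner ℂ x y = 0 := by
  have h1 := Submodule.norm_eq_iInf_iff_inner_eq_zero (Submodule.span ℂ {y}) (u := x) (v := 0)
    (Submodule.zero_mem _)
  rw [sub_zero] at h1
  refine h1.1 ?_ y (Submodule.mem_span_singleton_self y)
  refine le_antisymm (le_ciInf fun v => ?_) ?_
  · obtain ⟨t, ht⟩ := Submodule.mem_span_singleton.1 v.2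
    rw [← ht]; exact h t
  · refine (ciInf_le ⟨0, ?_⟩ (0 : Submodule.span ℂ {y})).trans (by simp)
    rintro _ ⟨v, rfl⟩; exact norm_nonneg _

lemma memLp_of_continuous {Ω : Set ℂ} (hm : MeasurableSet Ω) (hΩ : Bornology.IsBounded Ω)
    {f : ℂ → ℂ} (hf : Continuous f) : MemLp f 2 (volume.restrict Ω) := by
  have : IsFiniteMeasure (volume.restrict Ω) := ⟨by simpa using hΩ.measure_lt_top⟩
  obtain ⟨C, hC⟩ := (hΩ.isCompact_closure.image hf).isBounded.exists_norm_le
  refine MemLp.of_bound hf.aestronglyMeasurable C ?_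
  filter_upwards [ae_restrict_mem hm] with z hz
  exact hC _ ⟨z, subset_closure hz, rfl⟩

/-- The error of the best approximation is orthogonal to the Bergman space. -/
lemma IsBestApproxConj.integral_mul_eq_zero {Ω : Set ℂ} (hΩo : IsOpen Ω)
    (hΩ : Bornology.IsBounded Ω) {f : ℂ → ℂ} (hf : IsBestApproxConj Ω f) {g : ℂ → ℂ}
    (hg : MemBergman Ω g) :
    ∫ z in Ω, (z - (starRingEnd ℂ) (f z)) * g z = 0 := by
  have hconj : MemLp (fun z : ℂ => (starRingEnd ℂ) z) 2 (volume.restrict Ω) :=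
    memLp_of_continuous hΩo.measurableSet hΩ Complex.continuous_conj
  have hF : MemLp (fun z : ℂ => (starRingEnd ℂ) z - f z) 2 (volume.restrict Ω) := hconj.sub hf.1.2
  have h0 := inner_eq_zero_of_forall_norm_le (x := hF.toLp) (y := hg.2.toLp) fun t => by
    have h1 := hf.2 (fun z => f z + t • g z)
      ⟨hf.1.1.add (hg.1.const_smul t), hf.1.2.add (hg.2.const_smul t)⟩
    rw [← MemLp.toLp_const_smul, ← MemLp.toLp_sub, Lp.norm_toLp, Lp.norm_toLp]
    refine ENNReal.toReal_mono (hF.sub (hg.2.const_smul t)).2.ne ?_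
    convert! h1 using 2
    ext z; simp; ring
  rw [L2.inner_def] at h0
  have h2 : ∫ z in Ω, (starRingEnd ℂ) ((z - (starRingEnd ℂ) (f z)) * g z) =
      (starRingEnd ℂ) (∫ z in Ω, (z - (starRingEnd ℂ) (f z)) * g z) := integral_conj
  rw [← h0]
  refine integral_congr_ae ?_
  filter_upwards [hF.coeFn_toLp, hg.2.coeFn_toLp] with z h1 h2
  rw [h1, h2]
  simp [mul_comm]

lemma IsBestApproxConj.cauchyTransform_eq_zero {Ω : Set ℂ} (hΩo : IsOpen Ω)
    (hΩ : Bornology.IsBounded Ω) (hsc : IsSimplyConnected Ω) {f : ℂ → ℂ} (hfc : Continuous f)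
    (hf : IsBestApproxConj Ω f) {w : ℂ} (hw : w ∉ Ω) :
    cauchyTransform Ω (fun z => z - (starRingEnd ℂ) (f z)) w = 0 := by
  obtain ⟨L, hL, hexp⟩ := exists_differentiableOn_log_sub hΩo hsc hw
  have hc : Continuous fun z => z - (starRingEnd ℂ) (f z) :=
    continuous_id.sub (Complex.continuous_conj.comp hfc)
  obtain ⟨C, hC⟩ := (hΩ.isCompact_closure.image hc).isBounded.exists_norm_le
  refine tendsto_nhds_unique (tendsto_integral_mul_exp_neg_mul_log hΩo hΩ hw hL hexp
    hc.measurable (M := C) fun z hz => hC _ ⟨z, subset_closure hz, rfl⟩) ?_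
  refine tendsto_const_nhds.congr' ?_
  filter_upwards [self_mem_nhdsWithin] with s hs
  exact (hf.integral_mul_eq_zero hΩo hΩ (memBergman_exp_neg_mul_log hΩo hΩ hL hexp hs)).symm

/-- A function holomorphic on `Ω`, continuous up to the boundary, and with real boundary values
is constant. -/
lemma eq_const_of_im_eq_zero_frontier {Ω : Set ℂ} (hΩo : IsOpen Ω) (hΩ : Bornology.IsBounded Ω)
    (hpc : IsConnected Ω) {H : ℂ → ℂ} (hH : DiffContOnCl ℂ H Ω)
    (h0 : ∀ z ∈ frontier Ω, (H z).im = 0) : ∃ c : ℝ, ∀ z ∈ Ω, H z = c := by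
  -- The modulus of exp (-s i H) is exp (s Im H), which is 1 on the boundary; the maximum principle
  -- with s = 1 and s = -1 gives Im H = 0.
  have key : ∀ s : ℝ, ∀ z ∈ Ω, s * (H z).im ≤ 0 := fun s z hz => by
    have hd : DiffContOnCl ℂ (fun z => Complex.exp (-(s * Complex.I) * H z)) Ω :=
      (Complex.differentiable_exp.comp_diffContOnCl (hH.const_smul (-(s * Complex.I))))
    have := Complex.norm_le_of_forall_mem_frontier_norm_le hΩ hd (C := 1) (fun w hw => by
      simp [Complex.norm_exp, h0 w hw]) (subset_closure hz)
    rw [Complex.norm_exp] at this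
    simpa using this
  have him : ∀ z ∈ Ω, (H z).im = 0 := fun z hz =>
    le_antisymm (by simpa using key 1 z hz) (by simpa using key (-1) z hz)
  obtain ⟨z₀, hz₀⟩ := hpc.nonempty
  refine ⟨(H z₀).re, fun z hz => ?_⟩
  obtain ⟨c, hc⟩ := AnalyticOnNhd.eq_const_of_im_eq_const (c₀ := 0)
    (hH.differentiableOn.analyticOnNhd hΩo) him hΩo hpc
  have h1 : H z = H z₀ := (hc z hz).trans (hc z₀ hz₀).symm
  rw [h1]
  exact Complex.ext (by simp) (by simp [him z₀ hz₀])

lemma exists_polynomial_derivative_eq (p : Polynomial ℂ) :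
    ∃ P : Polynomial ℂ, P.derivative = p := by
  induction p using Polynomial.induction_on' with
  | add p q hp hq =>
    obtain ⟨P, rfl⟩ := hp
    obtain ⟨Q, rfl⟩ := hq
    exact ⟨P + Q, Polynomial.derivative_add⟩
  | monomial n a =>
    refine ⟨Polynomial.monomial (n + 1) (a / (n + 1)), ?_⟩
    rw [Polynomial.derivative_monomial]
    have : (n : ℂ) + 1 ≠ 0 := by exact_mod_cast n.succ_ne_zero
    simp [this]

/-- If the best approximation to `conj z` is a polynomial `p`, then `|z|² = 2 Re P(z)` on the
boundary, for some primitive `P` of `p`. -/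
theorem exists_primitive_of_isBestApproxConj {Ω : Set ℂ} (hΩo : IsOpen Ω)
    (hΩ : Bornology.IsBounded Ω) (hsc : IsSimplyConnected Ω) {p : Polynomial ℂ}
    (hp : IsBestApproxConj Ω (fun z => p.eval z)) :
    ∃ P : Polynomial ℂ, P.derivative = p ∧ ∀ ζ ∈ frontier Ω,
      ζ * (starRingEnd ℂ) ζ = P.eval ζ + (starRingEnd ℂ) (P.eval ζ) := by
  obtain ⟨P₀, hP₀⟩ : ∃ P₀ : Polynomial ℂ, P₀.derivative = p :=
    exists_polynomial_derivative_eq p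
  have hpc : Continuous fun z => p.eval z := p.continuous
  have hc : Continuous fun z => z - (starRingEnd ℂ) (p.eval z) :=
    continuous_id.sub (Complex.continuous_conj.comp hpc)
  obtain ⟨C, hC⟩ := (hΩ.isCompact_closure.image hc).isBounded.exists_norm_le
  have hC' : ∀ z ∈ Ω, ‖z - (starRingEnd ℂ) (p.eval z)‖ ≤ C :=
    fun z hz => hC _ ⟨z, subset_closure hz, rfl⟩
  -- This is |z|² - 2 Re P₀, with ∂v/∂z̄ = z - conj p, the density of the Cauchy transform. Hence v
  -- + T/π is holomorphic, and on the boundary it equals the real function v.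
  let v : ℂ → ℂ := fun z => z * (starRingEnd ℂ) z - P₀.eval z - (starRingEnd ℂ) (P₀.eval z)
  let v' : ℂ → ℂ →L[ℝ] ℂ := fun z =>
    (z • (Complex.conjCLE : ℂ →L[ℝ] ℂ) + (starRingEnd ℂ) z • ContinuousLinearMap.id ℝ ℂ) -
      p.eval z • ContinuousLinearMap.id ℝ ℂ -
      (Complex.conjCLE : ℂ →L[ℝ] ℂ).comp (p.eval z • ContinuousLinearMap.id ℝ ℂ)
  have hPd : ∀ z, HasFDerivAt (fun z => P₀.eval z) (p.eval z • ContinuousLinearMap.id ℝ ℂ) z := by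
    intro z
    have := (P₀.hasDerivAt z).hasFDerivAt.restrictScalars ℝ
    rw [hP₀] at this
    refine this.congr_fderiv ?_
    ext x; simp [mul_comm]
  have hv : ∀ z, HasFDerivAt v (v' z) z := fun z => by
    refine HasFDerivAt.sub (HasFDerivAt.sub ?_ (hPd z)) ?_
    · exact (hasFDerivAt_id (𝕜 := ℝ) z).mul (Complex.conjCLE : ℂ →L[ℝ] ℂ).hasFDerivAt
    · exact (Complex.conjCLE : ℂ →L[ℝ] ℂ).hasFDerivAt.comp z (hPd z)
  have hdiff := differentiableOn_add_cauchyTransform hΩo hΩ hc.measurable hC' (v := v) (v' := v')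
    (fun z _ => hv z) (fun z _ => by
      simp [v']
      linear_combination ((starRingEnd ℂ) (p.eval z) - p.eval z - z + (starRingEnd ℂ) z) *
        Complex.I_mul_I)
  set T := cauchyTransform Ω (fun z => z - (starRingEnd ℂ) (p.eval z)) with hT
  have hTc : Continuous T := continuous_cauchyTransform hΩ hΩo.measurableSet hc.measurable hC'
  have hT0 : ∀ w ∉ Ω, T w = 0 := fun w hw => hp.cauchyTransform_eq_zero hΩo hΩ hsc hpc hw
  have hvc : Continuous v := continuous_iff_continuousAt.2 fun z => (hv z).continuousAt
  have hHc : Continuous fun w => v w + (Real.pi : ℂ)⁻¹ * T w := hvc.add (continuous_const.mul hTc)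
  have hfr : ∀ z ∈ frontier Ω, v z + (Real.pi : ℂ)⁻¹ * T z = v z := fun z hz => by
    rw [hT0 z (by rw [hΩo.frontier_eq] at hz; exact hz.2)]; simp
  obtain ⟨c, hcst⟩ := eq_const_of_im_eq_zero_frontier hΩo hΩ hsc.isPathConnected.isConnected
    ⟨hdiff, hHc.continuousOn⟩ (fun z hz => by
      rw [hfr z hz]
      simp [v]; ring)
  -- Half of the constant value c, because P enters as P + conj P.
  refine ⟨P₀ + Polynomial.C (c / 2 : ℂ), by simp [hP₀], fun ζ hζ => ?_⟩
  have h1 : v ζ + (Real.pi : ℂ)⁻¹ * T ζ = c := by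
    have hcl : closure Ω ⊆ {w | v w + (Real.pi : ℂ)⁻¹ * T w = c} :=
      closure_minimal hcst (isClosed_eq hHc continuous_const)
    exact hcl (frontier_subset_closure hζ)
  rw [hfr ζ hζ] at h1
  simp only [Polynomial.eval_add, Polynomial.eval_C, map_add, map_div₀, Complex.conj_ofReal]
  simp only [v] at h1
  have h2 : (starRingEnd ℂ) (2 : ℂ) = 2 := Complex.conj_ofNat 2
  rw [h2]
  linear_combination h1

/-! ### Impossible boundary values. -/

lemma exists_diffContOnCl_of_tendsto {Ω : Set ℂ} (hΩo : IsOpen Ω) {G b : ℂ → ℂ}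
    (hG : DifferentiableOn ℂ G Ω) (hb : ∀ ζ ∈ frontier Ω, Tendsto G (𝓝[Ω] ζ) (𝓝 (b ζ))) :
    ∃ F : ℂ → ℂ, DiffContOnCl ℂ F Ω ∧ EqOn F G Ω ∧ ∀ ζ ∈ frontier Ω, F ζ = b ζ := by
  have heq : EqOn (extendFrom Ω G) G Ω := extendFrom_extends hG.continuousOn
  refine ⟨extendFrom Ω G, ⟨hG.congr heq, continuousOn_extendFrom subset_rfl fun x hx => ?_⟩, heq,
    fun ζ hζ => extendFrom_eq (frontier_subset_closure hζ) (hb ζ hζ)⟩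
  by_cases h : x ∈ Ω
  · exact ⟨G x, hG.continuousOn x h⟩
  · exact ⟨b x, hb x (by rw [hΩo.frontier_eq]; exact ⟨hx, h⟩)⟩

lemma eqOn_zero_of_tendsto_zero {Ω : Set ℂ} (hΩo : IsOpen Ω) (hΩ : Bornology.IsBounded Ω)
    {G : ℂ → ℂ} (hG : DifferentiableOn ℂ G Ω)
    (hb : ∀ ζ ∈ frontier Ω, Tendsto G (𝓝[Ω] ζ) (𝓝 0)) : ∀ z ∈ Ω, G z = 0 := by
  obtain ⟨F, hF, hFG, hFb⟩ := exists_diffContOnCl_of_tendsto hΩo hG (b := fun _ => 0) hb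
  intro z hz
  have := Complex.norm_le_of_forall_mem_frontier_norm_le hΩ hF (C := 0) (fun w hw => by
    simp [hFb w hw]) (subset_closure hz)
  rw [← hFG hz]
  simpa using this

/-- No holomorphic function on a bounded domain has the boundary values `conj ζ`. -/
lemma not_tendsto_conj_frontier {Ω : Set ℂ} (hΩo : IsOpen Ω) (hΩ : Bornology.IsBounded Ω)
    (hc : IsConnected Ω) {G : ℂ → ℂ} (hG : DifferentiableOn ℂ G Ω)
    (hb : ∀ ζ ∈ frontier Ω, Tendsto G (𝓝[Ω] ζ) (𝓝 ((starRingEnd ℂ) ζ))) : False := by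
  obtain ⟨F, hF, -, hFb⟩ := exists_diffContOnCl_of_tendsto hΩo hG hb
  have hid : DiffContOnCl ℂ (fun z : ℂ => z) Ω := differentiable_id.diffContOnCl
  -- On the boundary F + z = 2 Re z and i (F - z) = 2 Im z are real, so both are constant in Ω, and
  -- then so is z.
  obtain ⟨c₁, h₁⟩ := eq_const_of_im_eq_zero_frontier hΩo hΩ hc (hF.add hid) (fun z hz => by
    simp [hFb z hz])
  obtain ⟨c₂, h₂⟩ := eq_const_of_im_eq_zero_frontier hΩo hΩ hc ((hF.sub hid).const_smul Complex.I)
    (fun z hz => by simp [hFb z hz])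
  obtain ⟨z₀, hz₀⟩ := hc.nonempty
  have h3 : ∀ z ∈ Ω, z = z₀ := fun z hz => by
    have a1 := h₁ z hz
    have a2 := h₂ z hz
    have b1 := h₁ z₀ hz₀
    have b2 := h₂ z₀ hz₀
    simp only [Pi.add_apply, Pi.smul_apply, Pi.sub_apply, smul_eq_mul] at a1 a2 b1 b2
    have h4 : Complex.I * (2 * (z - z₀)) = 0 := by
      linear_combination Complex.I * (a1 - b1) - (a2 - b2)
    have h5 := (mul_eq_zero.1 h4).resolve_left Complex.I_ne_zero
    exact sub_eq_zero.1 ((mul_eq_zero.1 h5).resolve_left two_ne_zero)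
  have h4 : Ω = {z₀} := subset_antisymm h3 (by simpa using hz₀)
  exact not_isOpen_singleton z₀ (h4 ▸ hΩo)

lemma eval_map_conj (P : Polynomial ℂ) (z : ℂ) :
    (P.map (starRingEnd ℂ)).eval ((starRingEnd ℂ) z) = (starRingEnd ℂ) (P.eval z) := by
  rw [Polynomial.eval_map, Polynomial.eval₂_hom]

/-- If `|z|² = 2 Re P(z)` on the boundary and `deg P ≥ 2`, then `conj ζ` is not the boundary value
of a function `G / q` with `G` holomorphic and `q` a polynomial with all its zeros in `Ω`. -/
lemma not_tendsto_eval_mul_conj {Ω : Set ℂ} (hΩo : IsOpen Ω) (hΩ : Bornology.IsBounded Ω)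
    (hc : IsConnected Ω) {P : Polynomial ℂ} (hn : 2 ≤ P.natDegree)
    (hP : ∀ ζ ∈ frontier Ω, ζ * (starRingEnd ℂ) ζ = P.eval ζ + (starRingEnd ℂ) (P.eval ζ)) :
    ∀ (d : ℕ) (q : Polynomial ℂ), q ≠ 0 → q.natDegree = d → (∀ a, q.IsRoot a → a ∈ Ω) →
    ∀ G : ℂ → ℂ, DifferentiableOn ℂ G Ω →
      (∀ ζ ∈ frontier Ω, Tendsto G (𝓝[Ω] ζ) (𝓝 (q.eval ζ * (starRingEnd ℂ) ζ))) → False := by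
  intro d
  induction d with
  | zero =>
    intro q hq0 hqd _ G hG hb
    obtain ⟨c, rfl⟩ := Polynomial.natDegree_eq_zero.1 hqd
    have hc0 : c ≠ 0 := by simpa using hq0
    refine not_tendsto_conj_frontier hΩo hΩ hc (hG.const_smul c⁻¹) fun ζ hζ => ?_
    have := (hb ζ hζ).const_mul c⁻¹
    simp only [Polynomial.eval_C, inv_mul_cancel_left₀ hc0] at this
    exact this
  | succ d ih =>
    intro q hq0 hqd hroot G hG hb
    obtain ⟨a, ha⟩ := Complex.exists_root (f := q)
      (Polynomial.natDegree_pos_iff_degree_pos.1 (by omega))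
    have haΩ := hroot a ha
    obtain ⟨q₁, rfl⟩ := Polynomial.dvd_iff_isRoot.2 ha
    have hq1 : q₁ ≠ 0 := right_ne_zero_of_mul hq0
    set q := (Polynomial.X - Polynomial.C a) * q₁ with hq
    set n := P.natDegree with hn'
    set Pc := P.map (starRingEnd ℂ) with hPc
    have hPcn : Pc.natDegree = n := Polynomial.natDegree_map_eq_of_injective
      (starRingEnd ℂ).injective P
    -- With S = G/q this is q^n (z S - P(z) - P^#(S)), written without denominators. It tends to 0
    -- at the boundary, hence vanishes in Ω.
    let Φ : ℂ → ℂ := fun z => z * G z * q.eval z ^ (n - 1) - P.eval z * q.eval z ^ n -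
      ∑ k ∈ Finset.range (n + 1), Pc.coeff k * G z ^ k * q.eval z ^ (n - k)
    have hΦ0 : ∀ z ∈ Ω, Φ z = 0 := by
      refine eqOn_zero_of_tendsto_zero hΩo hΩ ?_ fun ζ hζ => ?_
      · refine DifferentiableOn.sub (DifferentiableOn.sub ?_ ?_) ?_
        · exact (differentiableOn_id.mul hG).mul (q.differentiable.differentiableOn.pow _)
        · exact (P.differentiable.differentiableOn).mul (q.differentiable.differentiableOn.pow _)
        · refine DifferentiableOn.fun_sum fun k _ => ?_
          exact ((differentiableOn_const _).mul (hG.pow k)).mul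
            (q.differentiable.differentiableOn.pow _)
      · have hz : Tendsto (fun z : ℂ => z) (𝓝[Ω] ζ) (𝓝 ζ) := nhdsWithin_le_nhds
        have hqt : Tendsto (fun z => q.eval z) (𝓝[Ω] ζ) (𝓝 (q.eval ζ)) :=
          (q.continuous.tendsto ζ).mono_left nhdsWithin_le_nhds
        have hPt : Tendsto (fun z => P.eval z) (𝓝[Ω] ζ) (𝓝 (P.eval ζ)) :=
          (P.continuous.tendsto ζ).mono_left nhdsWithin_le_nhds
        have hG' := hb ζ hζ
        have key : Tendsto Φ (𝓝[Ω] ζ) (𝓝 (ζ * (q.eval ζ * (starRingEnd ℂ) ζ) * q.eval ζ ^ (n - 1) -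
            P.eval ζ * q.eval ζ ^ n - ∑ k ∈ Finset.range (n + 1),
              Pc.coeff k * (q.eval ζ * (starRingEnd ℂ) ζ) ^ k * q.eval ζ ^ (n - k))) :=
          (((hz.mul hG').mul (hqt.pow _)).sub (hPt.mul (hqt.pow _))).sub
            (tendsto_finsetSum _ fun k _ => ((hG'.pow k).const_mul _).mul (hqt.pow _))
        convert! key using 2
        have e1 : q.eval ζ ^ n = q.eval ζ * q.eval ζ ^ (n - 1) := by
          rw [← pow_succ']; congr 1; omega
        have e2 : ∑ k ∈ Finset.range (n + 1),
              Pc.coeff k * (q.eval ζ * (starRingEnd ℂ) ζ) ^ k * q.eval ζ ^ (n - k) =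
            q.eval ζ ^ n * (starRingEnd ℂ) (P.eval ζ) := by
          rw [← eval_map_conj, ← hPc, Polynomial.eval_eq_sum_range (p := Pc), hPcn, Finset.mul_sum]
          refine Finset.sum_congr rfl fun k hk => ?_
          have hk' : k ≤ n := by simpa [Nat.lt_succ_iff] using hk
          rw [← Nat.sub_add_cancel hk', pow_add, mul_pow]
          simp only [Nat.sub_add_cancel hk']
          ring
        rw [e2, e1]
        linear_combination (-(q.eval ζ * q.eval ζ ^ (n - 1))) * hP ζ hζ
    -- At a root a of q every term with a factor q drops out; since n ≥ 2 only the leading term of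
    -- P^# remains, which forces G(a) = 0.
    have hGa : G a = 0 := by
      have h1 := hΦ0 a haΩ
      have h2 : q.eval a = 0 := ha
      have h3 : ∑ k ∈ Finset.range (n + 1), Pc.coeff k * G a ^ k * (0 : ℂ) ^ (n - k) =
          Pc.coeff n * G a ^ n := by
        rw [Finset.sum_range_succ, Finset.sum_eq_zero, zero_add, Nat.sub_self, pow_zero, mul_one]
        intro k hk
        have : n - k ≠ 0 := by have := Finset.mem_range.1 hk; omega
        simp [this]
      have h4 : Pc.coeff n ≠ 0 := by
        rw [← hPcn]
        exact Polynomial.leadingCoeff_ne_zero.2 (by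
          rintro h; rw [h] at hPcn; simp at hPcn; omega)
      simp only [Φ, h2, h3] at h1
      rw [zero_pow (by omega), zero_pow (by omega)] at h1
      have h5 : Pc.coeff n * G a ^ n = 0 := by linear_combination -h1
      exact eq_zero_of_pow_eq_zero ((mul_eq_zero.1 h5).resolve_left h4)
    -- Cancel the common factor z - a: as G(a) = 0, `dslope G a` is G/(z - a) away from a.
    refine ih q₁ hq1 ?_ ?_ (dslope G a) ?_ ?_
    · rw [hq, Polynomial.natDegree_mul (Polynomial.X_sub_C_ne_zero a) hq1,
        Polynomial.natDegree_X_sub_C] at hqd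
      omega
    · intro b hb'
      exact hroot b (by simp [hq, hb'.eq_zero])
    · exact (Complex.differentiableOn_dslope (hΩo.mem_nhds haΩ)).2 hG
    · intro ζ hζ
      have hζΩ : ζ ∉ Ω := by rw [hΩo.frontier_eq] at hζ; exact hζ.2
      have hne : ζ - a ≠ 0 := sub_ne_zero.2 (by rintro rfl; exact hζΩ haΩ)
      have h1 : Tendsto (fun z : ℂ => (z - a)⁻¹ * G z) (𝓝[Ω] ζ)
          (𝓝 ((ζ - a)⁻¹ * (q.eval ζ * (starRingEnd ℂ) ζ))) := by
        refine Tendsto.mul ?_ (hb ζ hζ)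
        refine Tendsto.mono_left (Tendsto.inv₀ ?_ hne) nhdsWithin_le_nhds
        exact (continuous_id.sub continuous_const).tendsto ζ
      have h2 : (ζ - a)⁻¹ * (q.eval ζ * (starRingEnd ℂ) ζ) = q₁.eval ζ * (starRingEnd ℂ) ζ := by
        simp only [hq, Polynomial.eval_mul, Polynomial.eval_sub, Polynomial.eval_X,
          Polynomial.eval_C]
        field_simp
      rw [h2] at h1
      refine h1.congr' ?_
      have h3 : ∀ᶠ z in 𝓝[Ω] ζ, z ≠ a := nhdsWithin_le_nhds
        (isOpen_ne.mem_nhds (by rintro rfl; exact hζΩ haΩ))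
      filter_upwards [h3] with z hz
      rw [dslope_of_ne _ hz, slope_def_field, hGa]
      ring

/-! ### Domains with boundary on a circle. -/

/-- The function |z - c| has no local maximum on an open set, so its maximum over the closure is
attained on the boundary only. Thus Ω lies in the open ball of that radius, which is connected and
contains no boundary point of Ω. -/
lemma isDisk_of_frontier_subset {Ω : Set ℂ} (hΩo : IsOpen Ω) (hΩ : Bornology.IsBounded Ω)
    (hne : Ω.Nonempty) {c : ℂ} {ρ : ℝ} (h : ∀ ζ ∈ frontier Ω, ‖ζ - c‖ ^ 2 = ρ) : IsDisk Ω := by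
  have hgrow : ∀ z ∈ Ω, ∃ z' ∈ Ω, ‖z - c‖ < ‖z' - c‖ := by
    intro z hz
    obtain ⟨ε, hε, hb⟩ := Metric.isOpen_iff.1 hΩo z hz
    rcases eq_or_ne z c with rfl | hzc
    · refine ⟨z + (ε / 2 : ℝ), hb ?_, ?_⟩
      · simp [abs_of_pos hε]; linarith
      · simp [hε.ne']
    · have h0 : 0 < ‖z - c‖ := norm_pos_iff.2 (sub_ne_zero.2 hzc)
      refine ⟨z + (ε / 2 / ‖z - c‖ : ℝ) * (z - c), hb ?_, ?_⟩
      · rw [Metric.mem_ball, dist_eq_norm, add_sub_cancel_left, norm_mul, Complex.norm_real,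
          Real.norm_of_nonneg (by positivity), div_mul_cancel₀ _ h0.ne']
        linarith
      · have : z + (ε / 2 / ‖z - c‖ : ℝ) * (z - c) - c =
            ((1 + ε / 2 / ‖z - c‖ : ℝ) : ℂ) * (z - c) := by push_cast; ring
        rw [this, norm_mul, Complex.norm_real, Real.norm_of_nonneg (by positivity)]
        have h1 : 0 < ε / 2 / ‖z - c‖ := by positivity
        nlinarith
  obtain ⟨m, hm, hmax⟩ := hΩ.isCompact_closure.exists_isMaxOn hne.closure
    (f := fun z => ‖z - c‖) (by fun_prop)
  have hmf : m ∈ frontier Ω := by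
    rw [hΩo.frontier_eq]
    refine ⟨hm, fun hmΩ => ?_⟩
    obtain ⟨z', hz', hlt⟩ := hgrow m hmΩ
    exact absurd (hmax (subset_closure hz')) (not_le.2 hlt)
  have hlt : ∀ z ∈ Ω, ‖z - c‖ < ‖m - c‖ := fun z hz => by
    obtain ⟨z', hz', hl⟩ := hgrow z hz
    exact hl.trans_le (hmax (subset_closure hz'))
  obtain ⟨z₀, hz₀⟩ := hne
  have hr : 0 < ‖m - c‖ := (norm_nonneg _).trans_lt (hlt z₀ hz₀)
  have hsub : Ω ⊆ Metric.ball c ‖m - c‖ := fun z hz => by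
    simpa [dist_eq_norm] using hlt z hz
  refine ⟨c, ‖m - c‖, hr, subset_antisymm hsub ?_⟩
  refine (convex_ball c ‖m - c‖).isPreconnected.subset_of_closure_inter_subset hΩo
    ⟨z₀, hsub hz₀, hz₀⟩ ?_
  rintro z ⟨hz, hzb⟩
  by_contra hzΩ
  have h1 : z ∈ frontier Ω := by rw [hΩo.frontier_eq]; exact ⟨hz, hzΩ⟩
  have h2 := (h z h1).trans (h m hmf).symm
  have h3 : ‖z - c‖ = ‖m - c‖ := (sq_eq_sq₀ (norm_nonneg _) (norm_nonneg _)).1 h2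
  rw [Metric.mem_ball, dist_eq_norm, h3] at hzb
  exact lt_irrefl _ hzb

/-- Completing the square: |ζ|² = 2 Re (aζ + b) is |ζ - conj a|² = |a|² + 2 Re b. -/
lemma isDisk_of_natDegree_le_one {Ω : Set ℂ} (hΩo : IsOpen Ω) (hΩ : Bornology.IsBounded Ω)
    (hne : Ω.Nonempty) {P : Polynomial ℂ} (hn : P.natDegree ≤ 1)
    (hP : ∀ ζ ∈ frontier Ω, ζ * (starRingEnd ℂ) ζ = P.eval ζ + (starRingEnd ℂ) (P.eval ζ)) :
    IsDisk Ω := by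
  obtain ⟨a, b, rfl⟩ : ∃ a b : ℂ, P = Polynomial.C a * Polynomial.X + Polynomial.C b :=
    ⟨_, _, Polynomial.eq_X_add_C_of_natDegree_le_one hn⟩
  refine isDisk_of_frontier_subset hΩo hΩ hne (c := (starRingEnd ℂ) a)
    (ρ := ‖a‖ ^ 2 + 2 * b.re) fun ζ hζ => ?_
  have h := hP ζ hζ
  simp only [Polynomial.eval_add, Polynomial.eval_mul, Polynomial.eval_C, Polynomial.eval_X,
    map_add, map_mul] at h
  have : ((‖ζ - (starRingEnd ℂ) a‖ ^ 2 : ℝ) : ℂ) = ((‖a‖ ^ 2 + 2 * b.re : ℝ) : ℂ) := by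
    have hb : (b.re : ℂ) = (b + (starRingEnd ℂ) b) / 2 := Complex.re_eq_add_conj b
    push_cast
    rw [← Complex.mul_conj', ← Complex.mul_conj', hb]
    simp only [map_sub, Complex.conj_conj]
    linear_combination h
  exact_mod_cast this

/-! ### No meromorphic Schwarz function. -/

/-- A function that has, near each point of `Ω`, a removable singularity, agrees off a discrete set
with a holomorphic function on `Ω`. -/
lemma exists_differentiableOn_of_removable {Ω : Set ℂ} {T : ℂ → ℂ}
    (h : ∀ z ∈ Ω, ∃ g : ℂ → ℂ, AnalyticAt ℂ g z ∧ g =ᶠ[𝓝[≠] z] T) :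
    ∃ G : ℂ → ℂ, DifferentiableOn ℂ G Ω ∧ ∀ z ∈ Ω, Tendsto T (𝓝[≠] z) (𝓝 (G z)) := by
  have hG : ∀ z ∈ Ω, ∀ g : ℂ → ℂ, AnalyticAt ℂ g z → g =ᶠ[𝓝[≠] z] T →
      Tendsto T (𝓝[≠] z) (𝓝 (g z)) := fun z _ g hg hgT =>
    (hg.continuousAt.tendsto.mono_left nhdsWithin_le_nhds).congr' hgT
  -- The value is defined by the punctured limit, since T may take arbitrary values at isolated
  -- points.
  refine ⟨fun z => limUnder (𝓝[≠] z) T, fun z hz => ?_, fun z hz => ?_⟩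
  · obtain ⟨g, hg, hgT⟩ := h z hz
    refine DifferentiableAt.differentiableWithinAt ?_
    refine hg.differentiableAt.congr_of_eventuallyEq ?_
    have h1 : ∀ᶠ y in 𝓝 z, y ≠ z → ∀ᶠ x in 𝓝 y, g x = T x := by
      have h2 := eventually_nhdsWithin_iff.1 hgT
      filter_upwards [eventually_eventually_nhds.2 h2] with y hy hyz
      filter_upwards [hy, isOpen_ne.mem_nhds hyz] with x hx hxz using hx hxz
    filter_upwards [h1, hg.eventually_analyticAt] with y hy hgy
    have hyT : Tendsto T (𝓝[≠] y) (𝓝 (g y)) := by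
      refine (hgy.continuousAt.tendsto.mono_left nhdsWithin_le_nhds).congr' ?_
      rcases eq_or_ne y z with rfl | hyz
      · exact hgT
      · exact nhdsWithin_le_nhds (hy hyz)
    exact hyT.limUnder_eq
  · obtain ⟨g, hg, hgT⟩ := h z hz
    have := hG z hz g hg hgT
    dsimp only
    rwa [this.limUnder_eq]

lemma exists_analyticAt_of_meromorphicAt_of_bounded {S : ℂ → ℂ} {z : ℂ} (hS : MeromorphicAt S z)
    {C : ℝ} (hb : ∀ᶠ y in 𝓝[≠] z, ‖S y‖ ≤ C) :
    ∃ g : ℂ → ℂ, AnalyticAt ℂ g z ∧ g =ᶠ[𝓝[≠] z] S := by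
  obtain ⟨ε, hε, hs⟩ := Metric.mem_nhdsWithin_iff.1 (hb.and hS.eventually_analyticAt)
  refine ⟨Function.update S z (limUnder (𝓝[≠] z) S), ?_, ?_⟩
  · have hd := Complex.differentiableOn_update_limUnder_of_bddAbove (f := S)
      (Metric.ball_mem_nhds z hε)
      (fun y hy => (hs ⟨hy.1, hy.2⟩).2.differentiableAt.differentiableWithinAt)
      ⟨C, by rintro _ ⟨y, hy, rfl⟩; exact (hs ⟨hy.1, hy.2⟩).1⟩
    exact hd.analyticAt (Metric.ball_mem_nhds z hε)
  · filter_upwards [self_mem_nhdsWithin] with y hy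
    exact Function.update_of_ne hy _ _

/-- The boundary values make S bounded near each boundary point, so its poles lie in a compact
subset of Ω and are cleared by one polynomial q. What is left of q S has removable singularities and
contradicts `not_tendsto_eval_mul_conj`. -/
theorem not_hasMeromorphicSchwarzFunction {Ω : Set ℂ} (hΩo : IsOpen Ω)
    (hΩ : Bornology.IsBounded Ω)
    (hc : IsConnected Ω) {P : Polynomial ℂ} (hn : 2 ≤ P.natDegree)
    (hP : ∀ ζ ∈ frontier Ω, ζ * (starRingEnd ℂ) ζ = P.eval ζ + (starRingEnd ℂ) (P.eval ζ)) :
    ¬ HasMeromorphicSchwarzFunction Ω := by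
  rintro ⟨S, hS, hSb⟩
  have hU : ∀ ζ ∈ frontier Ω, ∃ U : Set ℂ, IsOpen U ∧ ζ ∈ U ∧ ∀ z ∈ U ∩ Ω, ‖S z‖ ≤ ‖ζ‖ + 1 := by
    intro ζ hζ
    have h1 : ∀ᶠ z in 𝓝[Ω] ζ, ‖S z‖ < ‖ζ‖ + 1 :=
      (hSb ζ hζ).norm.eventually (gt_mem_nhds (by simp))
    obtain ⟨U, hU, hζU, hsub⟩ := mem_nhdsWithin.1 h1
    exact ⟨U, hU, hζU, fun z hz => le_of_lt (hsub hz)⟩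
  choose! U hUo hUζ hUb using hU
  let V : Set ℂ := ⋃ ζ ∈ frontier Ω, U ζ
  have hVo : IsOpen V := isOpen_biUnion hUo
  have hK : IsCompact (closure Ω \ V) := hΩ.isCompact_closure.diff hVo
  have hKΩ : closure Ω \ V ⊆ Ω := fun z hz => by
    by_contra hzΩ
    have hzf : z ∈ frontier Ω := by rw [hΩo.frontier_eq]; exact ⟨hz.1, hzΩ⟩
    exact hz.2 (mem_biUnion hzf (hUζ z hzf))
  have hN : ∀ x ∈ closure Ω \ V, {y | y ≠ x → AnalyticAt ℂ S y} ∈ 𝓝 x := fun x hx =>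
    eventually_nhdsWithin_iff.1 (hS x (hKΩ hx)).eventually_analyticAt
  obtain ⟨t, htK, ht⟩ := hK.elim_nhds_subcover _ hN
  have hpole : ∀ x ∈ t, ∃ k : ℕ, AnalyticAt ℂ (fun z => (z - x) ^ k • S z) x := fun x hx =>
    hS x (hKΩ (htK x hx))
  choose! k hk using hpole
  let q : Polynomial ℂ := ∏ x ∈ t, (Polynomial.X - Polynomial.C x) ^ k x
  have hq0 : q ≠ 0 := Finset.prod_ne_zero_iff.2 fun x _ =>
    pow_ne_zero _ (Polynomial.X_sub_C_ne_zero x)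
  have hroot : ∀ a, q.IsRoot a → a ∈ Ω := by
    intro a ha
    rw [Polynomial.IsRoot, Polynomial.eval_prod, Finset.prod_eq_zero_iff] at ha
    obtain ⟨x, hx, hxa⟩ := ha
    rw [Polynomial.eval_pow] at hxa
    have h1 := eq_zero_of_pow_eq_zero hxa
    simp only [Polynomial.eval_sub, Polynomial.eval_X, Polynomial.eval_C, sub_eq_zero] at h1
    rw [h1]
    exact hKΩ (htK x hx)
  have hqa : ∀ z, AnalyticAt ℂ (fun z => q.eval z) z := fun z =>
    q.differentiable.analyticAt z
  obtain ⟨G, hG, hGlim⟩ := exists_differentiableOn_of_removable (Ω := Ω)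
    (T := fun z => q.eval z * S z) (by
      intro z hz
      by_cases hzV : z ∈ V
      · obtain ⟨ζ, hζ, hzU⟩ := mem_iUnion₂.1 hzV
        obtain ⟨g, hg, hgS⟩ := exists_analyticAt_of_meromorphicAt_of_bounded (hS z hz)
          (C := ‖ζ‖ + 1) (by
            filter_upwards [nhdsWithin_le_nhds (((hUo ζ hζ).inter hΩo).mem_nhds ⟨hzU, hz⟩)]
              with y hy using hUb ζ hζ y hy)
        refine ⟨fun z => q.eval z * g z, (hqa z).mul hg, ?_⟩
        filter_upwards [hgS] with y hy
        rw [hy]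
      · obtain ⟨x, hx, hzx⟩ := mem_iUnion₂.1 (ht ⟨subset_closure hz, hzV⟩)
        rcases eq_or_ne z x with rfl | hne
        · refine ⟨fun y => (∏ x ∈ t.erase z, (Polynomial.X - Polynomial.C x) ^ k x).eval y *
            ((y - z) ^ k z • S y), ?_, Eventually.of_forall fun y => ?_⟩
          · exact (Polynomial.differentiable _).analyticAt _ |>.mul (hk z hx)
          · simp only [q]
            rw [← Finset.mul_prod_erase t _ hx, Polynomial.eval_mul]
            simp only [Polynomial.eval_pow, Polynomial.eval_sub, Polynomial.eval_X,
              Polynomial.eval_C, smul_eq_mul]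
            ring
        · exact ⟨_, (hqa z).mul (hzx hne), Eventually.of_forall fun y => rfl⟩)
  refine not_tendsto_eval_mul_conj hΩo hΩ hc hn hP _ q hq0 rfl hroot G hG fun ζ hζ => ?_
  have hlim : Tendsto (fun z => q.eval z * S z) (𝓝[Ω] ζ) (𝓝 (q.eval ζ * (starRingEnd ℂ) ζ)) :=
    ((q.continuous.tendsto ζ).mono_left nhdsWithin_le_nhds).mul (hSb ζ hζ)
  -- The values of G are limits of values of q S at nearby points, so the boundary limit passes from
  -- q S to G through closed neighbourhoods.
  rw [(closed_nhds_basis _).tendsto_right_iff]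
  rintro N ⟨hN1, hN2⟩
  obtain ⟨W, hW, hζW, hsub⟩ := mem_nhdsWithin.1 (hlim hN1)
  filter_upwards [inter_mem_nhdsWithin Ω (hW.mem_nhds hζW)] with z hz
  refine hN2.mem_of_tendsto (hGlim z hz.1) ?_
  filter_upwards [nhdsWithin_le_nhds ((hW.inter hΩo).mem_nhds ⟨hz.2, hz.1⟩)] with y hy
  exact hsub hy

/-! ### Quadrature domains. -/

lemma iteratedDeriv_exp_neg_mul_log {Ω : Set ℂ} (hΩo : IsOpen Ω) {w : ℂ} {L : ℂ → ℂ}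
    (hL : ∀ z ∈ Ω, HasDerivAt L (z - w)⁻¹ z)
    (hexp : ∀ z ∈ Ω, Complex.exp (L z) = z - w) (s : ℂ) (k : ℕ) :
    ∀ z ∈ Ω, iteratedDeriv k (fun z => Complex.exp (-(s * L z))) z =
      (-1) ^ k * (∏ j ∈ Finset.range k, (s + j)) * Complex.exp (-((s + k) * L z)) := by
  induction k with
  | zero => intro z _; simp
  | succ k ih =>
    intro z hz
    rw [iteratedDeriv_succ]
    have h1 : iteratedDeriv k (fun z => Complex.exp (-(s * L z))) =ᶠ[𝓝 z] fun z =>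
        (-1) ^ k * (∏ j ∈ Finset.range k, (s + j)) * Complex.exp (-((s + k) * L z)) := by
      filter_upwards [hΩo.mem_nhds hz] with y hy using ih y hy
    rw [h1.deriv_eq]
    have h2 := ((((hL z hz).const_mul (s + k)).neg.cexp).const_mul
      ((-1) ^ k * (∏ j ∈ Finset.range k, (s + j)))).deriv
    simp only [Pi.neg_apply] at h2
    rw [h2, Finset.prod_range_succ, ← hexp z hz, ← Complex.exp_neg]
    have h3 : Complex.exp (-((s + (k + 1 : ℕ)) * L z)) =
        Complex.exp (-((s + k) * L z)) * Complex.exp (-L z) := by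
      rw [← Complex.exp_add]; congr 1; push_cast; ring
    rw [h3]
    ring

/-- For a quadrature domain, the Cauchy transform of `1` is a rational function off `Ω`. -/
lemma cauchyTransform_one_eq_of_quadrature {Ω : Set ℂ} (hΩo : IsOpen Ω)
    (hΩ : Bornology.IsBounded Ω) (hsc : IsSimplyConnected Ω) {N : Finset ℂ} {m : ℕ}
    {c : ℂ → ℕ → ℂ} (hN : (↑N : Set ℂ) ⊆ Ω)
    (hq : ∀ f : ℂ → ℂ, MemBergman Ω f →
      ∫ z in Ω, f z = ∑ a ∈ N, ∑ k ∈ Finset.range m, c a k * iteratedDeriv k f a)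
    {w : ℂ} (hw : w ∉ Ω) :
    cauchyTransform Ω (fun _ => 1) w = ∑ a ∈ N, ∑ k ∈ Finset.range m,
      c a k * ((-1) ^ k * (∏ j ∈ Finset.range k, (1 + (j : ℂ))) * ((a - w) ^ (k + 1))⁻¹) := by
  obtain ⟨L, hL, hexp⟩ := exists_differentiableOn_log_sub hΩo hsc hw
  refine tendsto_nhds_unique (tendsto_integral_mul_exp_neg_mul_log hΩo hΩ hw hL hexp
    measurable_const (M := 1) fun z _ => by simp) ?_
  -- The quadrature identity is available for the exponents s < 1 only; its right side is continuous
  -- in s and passes to the limit s = 1.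
  have h1 : Tendsto (fun s : ℝ => ∑ a ∈ N, ∑ k ∈ Finset.range m,
      c a k * ((-1) ^ k * (∏ j ∈ Finset.range k, ((s : ℂ) + j)) *
        Complex.exp (-(((s : ℂ) + k) * L a)))) (𝓝[<] 1) (𝓝 (∑ a ∈ N, ∑ k ∈ Finset.range m,
      c a k * ((-1) ^ k * (∏ j ∈ Finset.range k, (1 + (j : ℂ))) * ((a - w) ^ (k + 1))⁻¹))) := by
    refine Tendsto.mono_left ?_ nhdsWithin_le_nhds
    have hc : Continuous (fun s : ℝ => ∑ a ∈ N, ∑ k ∈ Finset.range m,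
      c a k * ((-1) ^ k * (∏ j ∈ Finset.range k, ((s : ℂ) + j)) *
        Complex.exp (-(((s : ℂ) + k) * L a)))) := by fun_prop
    convert! hc.tendsto 1 using 2
    refine Finset.sum_congr rfl fun a ha => Finset.sum_congr rfl fun k _ => ?_
    rw [Complex.ofReal_one, ← hexp a (hN ha), ← Complex.exp_nat_mul, ← Complex.exp_neg]
    congr 4
    push_cast; ring
  refine h1.congr' ?_
  filter_upwards [self_mem_nhdsWithin] with s hs
  simp only [one_mul]
  rw [hq _ (memBergman_exp_neg_mul_log hΩo hΩ hL hexp hs)]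
  refine Finset.sum_congr rfl fun a ha => Finset.sum_congr rfl fun k _ => ?_
  rw [iteratedDeriv_exp_neg_mul_log hΩo hL hexp s k a (hN ha)]

lemma exists_polynomial_of_principal_parts (N : Finset ℂ) (m : ℕ) (b : ℂ → ℕ → ℂ) :
    ∃ R : Polynomial ℂ, ∀ w ∉ N, R.eval w =
      (∏ a ∈ N, (Polynomial.X - Polynomial.C a) ^ m).eval w *
        ∑ a ∈ N, ∑ k ∈ Finset.range m, b a k * ((a - w) ^ (k + 1))⁻¹ := by
  refine ⟨∑ a ∈ N, ∑ k ∈ Finset.range m, Polynomial.C (b a k * (-1) ^ (k + 1)) *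
    ((Polynomial.X - Polynomial.C a) ^ (m - (k + 1)) *
      ∏ a' ∈ N.erase a, (Polynomial.X - Polynomial.C a') ^ m), fun w hw => ?_⟩
  rw [Polynomial.eval_finsetSum, Finset.mul_sum]
  refine Finset.sum_congr rfl fun a ha => ?_
  rw [Polynomial.eval_finsetSum, Finset.mul_sum]
  refine Finset.sum_congr rfl fun k hk => ?_
  have hk' : k + 1 ≤ m := Finset.mem_range.1 hk
  have hne : w - a ≠ 0 := sub_ne_zero.2 (by rintro rfl; exact hw ha)
  rw [← Finset.mul_prod_erase N _ ha, show a - w = (-1) * (w - a) by ring, mul_pow, mul_inv,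
    ← inv_pow, show (-1 : ℂ)⁻¹ = -1 by norm_num]
  simp only [Polynomial.eval_mul, Polynomial.eval_pow, Polynomial.eval_sub, Polynomial.eval_X,
    Polynomial.eval_C]
  rw [pow_sub₀ _ hne hk']
  ring

/-- The function conj w + T/π, with T the Cauchy transform of 1, is holomorphic in Ω, and T = R/q
off Ω. So conj w + T/π - R/(πq) is meromorphic in Ω with the boundary values conj ζ; multiplied by q
it contradicts `not_tendsto_eval_mul_conj`. -/
theorem IsQuadratureDomain.natDegree_lt_two {Ω : Set ℂ} (hΩo : IsOpen Ω)
    (hΩ : Bornology.IsBounded Ω) (hsc : IsSimplyConnected Ω) {P : Polynomial ℂ}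
    (hP : ∀ ζ ∈ frontier Ω, ζ * (starRingEnd ℂ) ζ = P.eval ζ + (starRingEnd ℂ) (P.eval ζ))
    (hQ : IsQuadratureDomain Ω) : P.natDegree < 2 := by
  by_contra! hn
  obtain ⟨N, m, c, hN, hq⟩ := hQ
  obtain ⟨R, hR⟩ := exists_polynomial_of_principal_parts N m
    (fun a k => c a k * ((-1) ^ k * (∏ j ∈ Finset.range k, (1 + (j : ℂ)))))
  set q : Polynomial ℂ := ∏ a ∈ N, (Polynomial.X - Polynomial.C a) ^ m with hqdef
  set T := cauchyTransform Ω (fun _ => 1) with hT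
  have hTc : Continuous T := continuous_cauchyTransform hΩ hΩo.measurableSet measurable_const
    (M := 1) (by simp)
  have hh : DifferentiableOn ℂ (fun w => (starRingEnd ℂ) w + (Real.pi : ℂ)⁻¹ * T w) Ω :=
    differentiableOn_add_cauchyTransform hΩo hΩ measurable_const (M := 1) (by simp)
      (v := fun w => (starRingEnd ℂ) w) (v' := fun _ => (Complex.conjCLE : ℂ →L[ℝ] ℂ))
      (fun z _ => (Complex.conjCLE : ℂ →L[ℝ] ℂ).hasFDerivAt) (fun z _ => by
        simp; norm_num)
  have hq0 : q ≠ 0 := Finset.prod_ne_zero_iff.2 fun x _ =>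
    pow_ne_zero _ (Polynomial.X_sub_C_ne_zero x)
  have hroot : ∀ a, q.IsRoot a → a ∈ Ω := by
    intro a ha
    rw [Polynomial.IsRoot, Polynomial.eval_prod, Finset.prod_eq_zero_iff] at ha
    obtain ⟨x, hx, hxa⟩ := ha
    rw [Polynomial.eval_pow] at hxa
    have h1 := eq_zero_of_pow_eq_zero hxa
    simp only [Polynomial.eval_sub, Polynomial.eval_X, Polynomial.eval_C, sub_eq_zero] at h1
    rw [h1]
    exact hN hx
  refine not_tendsto_eval_mul_conj hΩo hΩ hsc.isPathConnected.isConnected hn hP _ q hq0 rfl hroot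
    (fun w => q.eval w * ((starRingEnd ℂ) w + (Real.pi : ℂ)⁻¹ * T w) -
      (Real.pi : ℂ)⁻¹ * R.eval w)
    ((q.differentiable.differentiableOn.mul hh).sub
      (R.differentiable.differentiableOn.const_mul _)) fun ζ hζ => ?_
  have hζΩ : ζ ∉ Ω := by rw [hΩo.frontier_eq] at hζ; exact hζ.2
  have hcont : Continuous (fun w => q.eval w * ((starRingEnd ℂ) w + (Real.pi : ℂ)⁻¹ * T w) -
      (Real.pi : ℂ)⁻¹ * R.eval w) :=
    (q.continuous.mul (Complex.continuous_conj.add (continuous_const.mul hTc))).sub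
      (continuous_const.mul R.continuous)
  have := (hcont.tendsto ζ).mono_left (nhdsWithin_le_nhds (s := Ω))
  convert! this using 2
  rw [hR ζ fun h => hζΩ (hN h), hT, cauchyTransform_one_eq_of_quadrature hΩo hΩ hsc hN hq hζΩ]
  simp only [mul_assoc]
  ring

/-! ### The curve z w = A(z) + B(w) and its projection to the z-plane. -/

/-- The polynomial whose zero set is the algebraic curve `z w = A(z) + B(w)`. -/
noncomputable def curveEq (A B : Polynomial ℂ) (z w : ℂ) : ℂ := z * w - A.eval z - B.eval w

/-- The branch points of the curve `z w = A(z) + B(w)` over the `z`-plane. -/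
def branchPoints (A B : Polynomial ℂ) : Set ℂ :=
  {z | ∃ w, z = B.derivative.eval w ∧ curveEq A B z w = 0}

lemma continuous_curveEq (A B : Polynomial ℂ) :
    Continuous fun v : ℂ × ℂ => curveEq A B v.1 v.2 := by
  unfold curveEq
  exact ((continuous_fst.mul continuous_snd).sub (A.continuous.comp continuous_fst)).sub
    (B.continuous.comp continuous_snd)

/-- Eliminating z: the w-coordinate of a ramification point is a root of the polynomial in the
hypothesis. -/
lemma finite_branchPoints {A B : Polynomial ℂ}
    (h : Polynomial.X * B.derivative - A.comp B.derivative - B ≠ 0) :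
    (branchPoints A B).Finite := by
  refine ((Polynomial.finite_setOfPred_isRoot h).image fun w => B.derivative.eval w).subset ?_
  rintro z ⟨w, rfl, hw⟩
  refine ⟨w, ?_, rfl⟩
  rw [curveEq] at hw
  simp only [mem_ofPred_eq, Polynomial.IsRoot, Polynomial.eval_sub, Polynomial.eval_mul,
    Polynomial.eval_X, Polynomial.eval_comp]
  linear_combination hw

lemma exists_implicit_curveEq {A B : Polynomial ℂ} {z₀ w₀ : ℂ} (h0 : curveEq A B z₀ w₀ = 0)
    (hne : z₀ ≠ B.derivative.eval w₀) :
    ∃ ψ : ℂ → ℂ, AnalyticAt ℂ ψ z₀ ∧ ψ z₀ = w₀ ∧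
      ∀ᶠ v : ℂ × ℂ in 𝓝 (z₀, w₀), curveEq A B v.1 v.2 = 0 ↔ ψ v.1 = v.2 := by
  let f : ℂ × ℂ → ℂ := fun v => curveEq A B v.1 v.2
  have hf : ContDiff ℂ ⊤ f := by
    refine ((contDiff_fst.mul contDiff_snd).sub (A.contDiff_aeval _ |>.comp contDiff_fst)).sub
      (B.contDiff_aeval _ |>.comp contDiff_snd)
  have hfd : (fderiv ℂ f (z₀, w₀)).comp (ContinuousLinearMap.inr ℂ ℂ ℂ) =
      (ContinuousLinearEquiv.unitsEquivAut ℂ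
        (Units.mk0 (z₀ - B.derivative.eval w₀) (sub_ne_zero.2 hne)) : ℂ →L[ℂ] ℂ) := by
    have h1 : HasFDerivAt f (fderiv ℂ f (z₀, w₀)) (z₀, w₀) :=
      (hf.differentiable (by simp)).differentiableAt.hasFDerivAt
    have h2 : HasFDerivAt (fun w : ℂ => f (z₀, w))
        ((fderiv ℂ f (z₀, w₀)).comp (ContinuousLinearMap.inr ℂ ℂ ℂ)) w₀ :=
      h1.comp w₀ (hasFDerivAt_prodMk_right z₀ w₀)
    have h3 : HasDerivAt (fun w : ℂ => f (z₀, w)) (z₀ - B.derivative.eval w₀) w₀ := by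
      have := (((hasDerivAt_id w₀).const_mul z₀).sub_const (A.eval z₀)).sub (B.hasDerivAt w₀)
      simpa [f, curveEq] using! this
    refine h2.unique h3.hasFDerivAt |>.trans ?_
    ext; simp
  have cdf : ContDiffAt ℂ ⊤ f (z₀, w₀) := hf.contDiffAt
  have inv : ((fderiv ℂ f (z₀, w₀)).comp (ContinuousLinearMap.inr ℂ ℂ ℂ)).IsInvertible :=
    ⟨_, hfd.symm⟩
  have pn : (⊤ : WithTop ℕ∞) ≠ 0 := by simp
  refine ⟨cdf.implicitFunction pn inv, ?_, cdf.implicitFunction_apply_self pn inv, ?_⟩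
  · exact (cdf.contDiffAt_implicitFunction pn inv).analyticAt
  · have := cdf.eventually_apply_eq_iff_implicitFunction pn inv
    have h4 : f (z₀, w₀) = 0 := h0
    simpa only [h4] using! this

/-- Local uniqueness of lifts, from the implicit function theorem. The base map F is kept general:
it will be the identity, ω ↦ e + exp ω and τ ↦ e + τ^M. -/
lemma eventuallyEq_of_curveEq {X : Type*} [TopologicalSpace X] {A B : Polynomial ℂ}
    {F φ₁ φ₂ : X → ℂ} {x : X} (hF : ContinuousAt F x)
    (h1 : ContinuousAt φ₁ x) (h2 : ContinuousAt φ₂ x) (h12 : φ₁ x = φ₂ x)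
    (e1 : ∀ᶠ y in 𝓝 x, curveEq A B (F y) (φ₁ y) = 0)
    (e2 : ∀ᶠ y in 𝓝 x, curveEq A B (F y) (φ₂ y) = 0) (hx : F x ∉ branchPoints A B) :
    φ₁ =ᶠ[𝓝 x] φ₂ := by
  have h0 := e1.self_of_nhds
  obtain ⟨ψ, -, -, hψ⟩ := exists_implicit_curveEq h0 fun h => hx ⟨_, h, h0⟩
  have t1 : Tendsto (fun y => (F y, φ₁ y)) (𝓝 x) (𝓝 (F x, φ₁ x)) := hF.prodMk_nhds h1
  have t2 : Tendsto (fun y => (F y, φ₂ y)) (𝓝 x) (𝓝 (F x, φ₁ x)) := by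
    rw [h12]; exact hF.prodMk_nhds h2
  filter_upwards [t1.eventually hψ, t2.eventually hψ, e1, e2] with y a1 a2 b1 b2
  exact (a1.1 b1).symm.trans (a2.1 b2)

/-- Covering theory yields lifts that are merely continuous; locally they coincide with the analytic
implicit function composed with F. -/
lemma analyticAt_of_curveEq {A B : Polynomial ℂ} {F φ : ℂ → ℂ} {x : ℂ} (hF : AnalyticAt ℂ F x)
    (hφ : ContinuousAt φ x) (e : ∀ᶠ y in 𝓝 x, curveEq A B (F y) (φ y) = 0)
    (hx : F x ∉ branchPoints A B) : AnalyticAt ℂ φ x := by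
  have h0 := e.self_of_nhds
  obtain ⟨ψ, hψa, -, hψ⟩ := exists_implicit_curveEq h0 fun h => hx ⟨_, h, h0⟩
  have t : Tendsto (fun y => (F y, φ y)) (𝓝 x) (𝓝 (F x, φ x)) := hF.continuousAt.prodMk_nhds hφ
  refine (hψa.comp hF).congr ?_
  filter_upwards [t.eventually hψ, e] with y a1 b1
  exact a1.1 b1

/-- The roots of the curve equation are locally bounded, as its leading coefficient is constant. -/
lemma exists_bound_of_curveEq (A : Polynomial ℂ) {B : Polynomial ℂ} (hB : 2 ≤ B.natDegree)
    (R : ℝ) : ∃ M : ℝ, ∀ z w : ℂ, ‖z‖ ≤ R → curveEq A B z w = 0 → ‖w‖ ≤ M := by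
  obtain ⟨C, hC⟩ := ((isCompact_closedBall (0:ℂ) R).image A.continuous).isBounded.exists_norm_le
  have hdeg : 0 < B.divX.degree := by
    rw [← Polynomial.natDegree_pos_iff_degree_pos, Polynomial.natDegree_divX_eq_natDegree_tsub_one]
    omega
  have ht := B.divX.tendsto_norm_atTop hdeg (z := fun w : ℂ => w) (l := Bornology.cobounded ℂ)
    tendsto_norm_cobounded_atTop
  have h1 : ∀ᶠ w in Bornology.cobounded ℂ, R + 1 ≤ ‖B.divX.eval w‖ := ht.eventually_ge_atTop _
  obtain ⟨M₀, hM₀⟩ : ∃ M₀ : ℝ, ∀ w : ℂ, ‖B.divX.eval w‖ < R + 1 → ‖w‖ ≤ M₀ := by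
    have : Bornology.IsBounded {w : ℂ | ‖B.divX.eval w‖ < R + 1} := by
      rw [← Bornology.isCobounded_compl_iff]
      filter_upwards [h1] with w hw
      simpa using hw
    obtain ⟨M₀, h⟩ := this.exists_norm_le
    exact ⟨M₀, fun w hw => h w hw⟩
  refine ⟨max M₀ (C + ‖B.coeff 0‖), fun z w hz hw => ?_⟩
  by_cases h : ‖B.divX.eval w‖ < R + 1
  · exact (hM₀ w h).trans (le_max_left _ _)
  · refine le_trans ?_ (le_max_right _ _)
    -- With B(w) = w B₁(w) + B(0) the equation reads w (z - B₁(w)) = A(z) + B(0), and |B₁(w)| ≥ R +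
    -- 1 makes the second factor at least 1 in modulus.
    have hBe : B.eval w = B.divX.eval w * w + B.coeff 0 := by
      conv_lhs => rw [← Polynomial.divX_mul_X_add B]
      simp
    have h2 : w * (z - B.divX.eval w) = A.eval z + B.coeff 0 := by
      rw [curveEq, hBe] at hw
      linear_combination hw
    have h3 : 1 ≤ ‖z - B.divX.eval w‖ := by
      have := norm_sub_norm_le (B.divX.eval w) z
      rw [norm_sub_rev] at this
      linarith [not_lt.1 h]
    calc ‖w‖ ≤ ‖w‖ * ‖z - B.divX.eval w‖ := le_mul_of_one_le_right (norm_nonneg _) h3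
      _ = ‖A.eval z + B.coeff 0‖ := by rw [← norm_mul, h2]
      _ ≤ C + ‖B.coeff 0‖ := (norm_add_le _ _).trans (by
          gcongr
          exact hC _ ⟨z, by simpa using hz, rfl⟩)

/-- The `w`-polynomial of the curve over the point `z`. -/
noncomputable def curvePoly (A B : Polynomial ℂ) (z : ℂ) : Polynomial ℂ :=
  Polynomial.C z * Polynomial.X - Polynomial.C (A.eval z) - B

lemma curvePoly_eval (A B : Polynomial ℂ) (z w : ℂ) :
    (curvePoly A B z).eval w = curveEq A B z w := by
  simp [curvePoly, curveEq]

lemma curvePoly_natDegree (A : Polynomial ℂ) {B : Polynomial ℂ} (hB : 2 ≤ B.natDegree) (z : ℂ) :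
    (curvePoly A B z).natDegree = B.natDegree := by
  rw [curvePoly, Polynomial.natDegree_sub_eq_right_of_natDegree_lt]
  have h1 : (Polynomial.C z * Polynomial.X - Polynomial.C (A.eval z)).natDegree ≤ 1 := by
    compute_degree
  omega

lemma curvePoly_ne_zero (A : Polynomial ℂ) {B : Polynomial ℂ} (hB : 2 ≤ B.natDegree) (z : ℂ) :
    curvePoly A B z ≠ 0 := by
  intro h
  have := curvePoly_natDegree A hB z
  rw [h] at this
  simp at this
  omega

/-- The projection of the curve to the `z`-plane is a covering map off the branch points. -/
lemma isCoveringMapOn_curve (A : Polynomial ℂ) {B : Polynomial ℂ} (hB : 2 ≤ B.natDegree) :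
    IsCoveringMapOn (fun v : {v : ℂ × ℂ // curveEq A B v.1 v.2 = 0} => v.1.1)
      (branchPoints A B)ᶜ := by
  have hclosed : IsClosed {v : ℂ × ℂ | curveEq A B v.1 v.2 = 0} :=
    isClosed_eq (continuous_curveEq A B) continuous_const
  have hproper : IsProperMap (fun v : {v : ℂ × ℂ // curveEq A B v.1 v.2 = 0} => v.1.1) := by
    rw [isProperMap_iff_isCompact_preimage]
    refine ⟨by fun_prop, fun {K} hK => ?_⟩
    obtain ⟨R, hR⟩ := hK.isBounded.exists_norm_le
    obtain ⟨M, hM⟩ := exists_bound_of_curveEq A hB R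
    rw [Subtype.isCompact_iff]
    refine (hK.prod (isCompact_closedBall (0:ℂ) M)).of_isClosed_subset ?_ ?_
    · have : (Subtype.val '' ((fun v : {v : ℂ × ℂ // curveEq A B v.1 v.2 = 0} => v.1.1) ⁻¹' K)) =
          {v : ℂ × ℂ | curveEq A B v.1 v.2 = 0} ∩ Prod.fst ⁻¹' K := by
        ext v; simp [and_comm]
      rw [this]
      exact hclosed.inter (hK.isClosed.preimage continuous_fst)
    · rintro _ ⟨v, hv, rfl⟩
      exact ⟨hv, by simpa using hM _ _ (hR _ hv) v.2⟩
  -- A closed map with finite fibres that is a local homeomorphism over an open set is a covering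
  -- there.
  refine hproper.isClosedMap.isCoveringMapOn_of_isLocalHomeomorphOn (fun z _ => ?_) ?_
  · refine Set.Finite.of_finite_image (f := fun v => v.1.2) ?_ ?_
    · refine (Polynomial.finite_setOfPred_isRoot (curvePoly_ne_zero A hB z)).subset ?_
      rintro _ ⟨v, rfl, rfl⟩
      simpa [Polynomial.IsRoot, curvePoly_eval] using v.2
    · rintro v hv v' hv' h
      exact Subtype.ext (Prod.ext (hv.trans hv'.symm) h)
  · rintro ⟨⟨z₀, w₀⟩, h0⟩ hz
    have h0' : curveEq A B z₀ w₀ = 0 := h0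
    obtain ⟨ψ, hψa, hψ0, hψ⟩ := exists_implicit_curveEq h0' fun h => hz ⟨_, h, h0'⟩
    obtain ⟨W, hW, hWo, hmem⟩ := eventually_nhds_iff.1 hψ
    obtain ⟨U, hU, hUo, hzU⟩ := eventually_nhds_iff.1 (hψa.eventually_analyticAt)
    have hψc : ContinuousOn ψ U := fun z hz => (hU z hz).continuousAt.continuousWithinAt
    let T : Set ℂ := U ∩ (fun z => (z, ψ z)) ⁻¹' W
    have hTo : IsOpen T := (continuousOn_id.prodMk hψc).isOpen_inter_preimage hUo hWo
    have hT : ∀ z ∈ T, curveEq A B z (ψ z) = 0 := fun z hz => (hW (z, ψ z) hz.2).2 rfl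
    classical
    let inv : ℂ → {v : ℂ × ℂ // curveEq A B v.1 v.2 = 0} := fun z =>
      if h : curveEq A B z (ψ z) = 0 then ⟨(z, ψ z), h⟩ else ⟨(z₀, w₀), h0⟩
    have hinv : ∀ z ∈ T, (inv z).1 = (z, ψ z) := fun z hz => by simp [inv, hT z hz]
    let e : OpenPartialHomeomorph {v : ℂ × ℂ // curveEq A B v.1 v.2 = 0} ℂ :=
      { toFun := fun v => v.1.1
        invFun := inv
        source := {v | v.1 ∈ W ∧ v.1.1 ∈ T}
        target := T
        map_source' := fun v hv => hv.2
        map_target' := fun z hz => by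
          rw [mem_ofPred_eq, hinv z hz]; exact ⟨hz.2, hz⟩
        left_inv' := fun v hv => Subtype.ext (by
          rw [hinv _ hv.2]
          exact Prod.ext rfl ((hW _ hv.1).1 v.2))
        right_inv' := fun z hz => by
          rw [hinv z hz]
        open_source := (hWo.preimage continuous_subtype_val).inter
          (hTo.preimage (continuous_fst.comp continuous_subtype_val))
        open_target := hTo
        continuousOn_toFun := (continuous_fst.comp continuous_subtype_val).continuousOn
        continuousOn_invFun := by
          refine Topology.IsInducing.subtypeVal.continuousOn_iff.2 ?_
          exact (continuousOn_id.prodMk (hψc.mono inter_subset_left)).congr hinv }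
    refine ⟨e, ⟨hmem, hzU, ?_⟩, rfl⟩
    change (z₀, ψ z₀) ∈ W
    rw [hψ0]; exact hmem

/-- Lifting of a holomorphic map on a convex open set to the curve. -/
lemma exists_lift_curve (A : Polynomial ℂ) {B : Polynomial ℂ} (hB : 2 ≤ B.natDegree) {U : Set ℂ}
    (hUo : IsOpen U) (hUc : Convex ℝ U) {F : ℂ → ℂ} (hF : DifferentiableOn ℂ F U)
    (hFb : ∀ x ∈ U, F x ∉ branchPoints A B) {x₁ w₁ : ℂ} (hx₁ : x₁ ∈ U)
    (h1 : curveEq A B (F x₁) w₁ = 0) :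
    ∃ φ : ℂ → ℂ, DifferentiableOn ℂ φ U ∧ φ x₁ = w₁ ∧ ∀ x ∈ U, curveEq A B (F x) (φ x) = 0 := by
  have hcs : ContractibleSpace U := hUc.contractibleSpace ⟨x₁, hx₁⟩
  have hlp : LocallyPathConnectedSpace U := hUo.locallyPathConnectedSpace
  obtain ⟨g, ⟨hg1, hg⟩, -⟩ := (isCoveringMapOn_curve A hB).existsUnique_continuousMap_lifts
    (A := U) ⟨fun x => F x, hF.continuousOn.domRestrict⟩ (a₀ := ⟨x₁, hx₁⟩)
    (e₀ := ⟨(F x₁, w₁), h1⟩) rfl (fun x => hFb x x.2)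
  classical
  let φ : ℂ → ℂ := fun x => if h : x ∈ U then (g ⟨x, h⟩).1.2 else 0
  have hφ : ∀ x (h : x ∈ U), φ x = (g ⟨x, h⟩).1.2 := fun x h => by simp [φ, h]
  have hgF : ∀ x (h : x ∈ U), (g ⟨x, h⟩).1.1 = F x := fun x h => congrFun hg ⟨x, h⟩
  have hcurve : ∀ x ∈ U, curveEq A B (F x) (φ x) = 0 := fun x hx => by
    rw [hφ x hx, ← hgF x hx]; exact (g ⟨x, hx⟩).2
  have hφc : ContinuousOn φ U := by
    rw [continuousOn_iff_continuous_domRestrict]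
    have : U.domRestrict φ = fun x => (g x).1.2 := by
      ext x; simp [hφ x.1 x.2]
    rw [this]
    exact (continuous_snd.comp continuous_subtype_val).comp g.continuous
  refine ⟨φ, fun x hx => ?_, by rw [hφ x₁ hx₁, hg1], hcurve⟩
  refine (analyticAt_of_curveEq (A := A) (B := B)
    ((hF.analyticOnNhd hUo) x hx) (hφc.continuousAt (hUo.mem_nhds hx)) ?_ (hFb x hx)
    ).differentiableAt.differentiableWithinAt
  filter_upwards [hUo.mem_nhds hx] with y hy using hcurve y hy

lemma eqOn_of_curveEq {A B : Polynomial ℂ} {U : Set ℂ}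
    (hUo : IsOpen U) (hUc : IsPreconnected U) {F : ℂ → ℂ} (hF : ContinuousOn F U)
    (hFb : ∀ x ∈ U, F x ∉ branchPoints A B) {φ₁ φ₂ : ℂ → ℂ} (h1 : DifferentiableOn ℂ φ₁ U)
    (h2 : DifferentiableOn ℂ φ₂ U) (e1 : ∀ x ∈ U, curveEq A B (F x) (φ₁ x) = 0)
    (e2 : ∀ x ∈ U, curveEq A B (F x) (φ₂ x) = 0) {x₁ : ℂ} (hx₁ : x₁ ∈ U)
    (h12 : φ₁ x₁ = φ₂ x₁) : EqOn φ₁ φ₂ U := by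
  refine (h1.analyticOnNhd hUo).eqOn_of_preconnected_of_eventuallyEq (h2.analyticOnNhd hUo)
    hUc hx₁ ?_
  have hmem := hUo.mem_nhds hx₁
  refine eventuallyEq_of_curveEq (hF.continuousAt hmem)
    (h1.continuousOn.continuousAt hmem) (h2.continuousOn.continuousAt hmem) h12 ?_ ?_ (hFb x₁ hx₁)
  · filter_upwards [hmem] with y hy using e1 y hy
  · filter_upwards [hmem] with y hy using e2 y hy

/-! ### Puiseux series at the branch points. -/

lemma periodic_int_of_periodic {φ : ℂ → ℂ} {c : ℝ} {t : ℂ} (ht : t.re = 0)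
    (h : ∀ ω : ℂ, ω.re < c → φ (ω + t) = φ ω) (l : ℤ) :
    ∀ ω : ℂ, ω.re < c → φ (ω + l * t) = φ ω := by
  induction l with
  | zero => simp
  | succ l ih =>
    intro ω hω
    have := h (ω + l * t) (by simpa [ht] using hω)
    rw [← ih ω hω]
    push_cast at this ⊢
    rw [← this]; ring_nf
  | pred l ih =>
    intro ω hω
    have h1 := h (ω + ((-(l : ℤ) - 1 : ℤ) : ℂ) * t) (by simpa [ht] using hω)
    rw [← h1, ← ih ω hω]
    push_cast
    ring_nf

/-- Near a point `e` a branch of the curve is given by a Puiseux series without negative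
exponents. -/
lemma isPoleFreeAlgebraicBranch_of_curveEq (A : Polynomial ℂ) {B : Polynomial ℂ}
    (hB : 2 ≤ B.natDegree) {g : ℂ → ℂ} {z₁ e : ℂ} {r : ℝ}
    (hd : Disjoint (Metric.ball e r \ {e}) (branchPoints A B)) (hz₁ : z₁ ∈ Metric.ball e r \ {e})
    (hg : ContinuousAt g z₁) (hcg : ∀ᶠ z in 𝓝 z₁, curveEq A B z (g z) = 0) :
    IsPoleFreeAlgebraicBranch g z₁ e r := by
  have hr : 0 < r := Metric.pos_of_mem_ball hz₁.1
  -- The half-plane U is the universal cover of the punctured disk under ω ↦ e + exp ω, so the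
  -- branch lifts to a single-valued φ on U.
  let U : Set ℂ := {ω | ω.re < Real.log r}
  have hUo : IsOpen U := isOpen_lt Complex.continuous_re continuous_const
  have hUc : Convex ℝ U := convex_halfSpace_lt Complex.reLm.isLinear _
  let F : ℂ → ℂ := fun ω => e + Complex.exp ω
  have hFd : Differentiable ℂ F := (differentiable_const _).add Complex.differentiable_exp
  have hFm : ∀ ω ∈ U, F ω ∈ Metric.ball e r \ {e} := fun ω hω => by
    refine ⟨?_, by simp [F]⟩
    rw [Metric.mem_ball, dist_eq_norm, add_sub_cancel_left, Complex.norm_exp]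
    rw [← Real.exp_log hr]
    exact Real.exp_lt_exp.2 hω
  have hFb : ∀ ω ∈ U, F ω ∉ branchPoints A B := fun ω hω => disjoint_left.1 hd (hFm ω hω)
  have hz0 : z₁ - e ≠ 0 := sub_ne_zero.2 hz₁.2
  let ω₁ := Complex.log (z₁ - e)
  have hω₁ : Complex.exp ω₁ = z₁ - e := Complex.exp_log hz0
  have hω₁U : ω₁ ∈ U := by
    change (Complex.log (z₁ - e)).re < Real.log r
    rw [Complex.log_re]
    refine Real.log_lt_log (norm_pos_iff.2 hz0) ?_
    simpa [dist_eq_norm] using hz₁.1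
  have hFω₁ : F ω₁ = z₁ := by simp [F, hω₁]
  obtain ⟨φ, hφd, hφ1, hφ⟩ := exists_lift_curve A hB hUo hUc hFd.differentiableOn hFb hω₁U
    (w₁ := g z₁) (by rw [hFω₁]; exact hcg.self_of_nhds)
  let p : ℂ := 2 * Real.pi * Complex.I
  have hpre : ∀ k : ℕ, (k * p).re = 0 := fun k => by simp [p]
  have hpU : ∀ (k : ℕ), ∀ ω ∈ U, ω + k * p ∈ U := fun k ω hω => by
    change (ω + k * p).re < _
    rw [Complex.add_re, hpre, add_zero]; exact hω
  have hexpp : ∀ (k : ℕ) ω, Complex.exp (ω + k * p) = Complex.exp ω := fun k ω => by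
    rw [Complex.exp_add]
    have : Complex.exp (k * p) = 1 := Complex.exp_nat_mul_two_pi_mul_I k
    rw [this, mul_one]
  have hφk : ∀ (k : ℕ), ∀ ω ∈ U, curveEq A B (F ω) (φ (ω + k * p)) = 0 := fun k ω hω => by
    have := hφ _ (hpU k ω hω)
    simpa only [F, hexpp] using this
  have hφkd : ∀ k : ℕ, DifferentiableOn ℂ (fun ω => φ (ω + k * p)) U := fun k =>
    hφd.comp (by fun_prop) (hpU k)
  -- Pigeonhole: n + 1 translates of ω₁ by multiples of 2πi give roots of one polynomial of degree
  -- n, where n is the degree of B. Two lifts that agree at a point agree everywhere, so φ has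
  -- period 2πi M with M = k - j.
  obtain ⟨j, k, hjk, hjkφ⟩ : ∃ j k : ℕ, j < k ∧ φ (ω₁ + j * p) = φ (ω₁ + k * p) := by
    obtain ⟨j, -, k, -, hne, heq⟩ := Finset.exists_ne_map_eq_of_card_lt_of_maps_to
      (s := Finset.range (B.natDegree + 1)) (t := (curvePoly A B z₁).roots.toFinset)
      (f := fun k : ℕ => φ (ω₁ + k * p)) (by
        rw [Finset.card_range]
        have h1 := Multiset.toFinset_card_le (curvePoly A B z₁).roots
        have h2 := (curvePoly A B z₁).card_roots'
        rw [curvePoly_natDegree A hB] at h2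
        omega) (fun k _ => by
        rw [Finset.mem_coe, Multiset.mem_toFinset, Polynomial.mem_roots (curvePoly_ne_zero A hB z₁)]
        have := hφk k ω₁ hω₁U
        rw [hFω₁] at this
        rw [Polynomial.IsRoot, curvePoly_eval, this])
    rcases lt_or_gt_of_ne hne with h | h
    · exact ⟨j, k, h, heq⟩
    · exact ⟨k, j, h, heq.symm⟩
  have heqk : EqOn (fun ω => φ (ω + j * p)) (fun ω => φ (ω + k * p)) U :=
    eqOn_of_curveEq hUo hUc.isPreconnected hFd.continuous.continuousOn hFb (hφkd j) (hφkd k)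
      (hφk j) (hφk k) hω₁U hjkφ
  obtain ⟨m, rfl⟩ := Nat.exists_eq_add_of_lt hjk
  set M := m + 1 with hM
  have hper1 : ∀ ω : ℂ, ω.re < Real.log r → φ (ω + M * p) = φ ω := by
    intro ω hω
    have hω' : ω - j * p ∈ U := by
      change (ω - j * p).re < _
      rw [Complex.sub_re, hpre, sub_zero]; exact hω
    have h1 := heqk hω'
    simp only [sub_add_cancel] at h1
    rw [h1]
    congr 1
    rw [hM]; push_cast; ring
  have hper := periodic_int_of_periodic (hpre M) hper1
  have hM0 : (M : ℂ) ≠ 0 := by exact_mod_cast m.succ_ne_zero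
  have hshift : ∀ a b : ℂ, Complex.exp a = Complex.exp b → M * b ∈ U → φ (M * a) = φ (M * b) := by
    intro a b hab hb
    obtain ⟨l, hl⟩ := Complex.exp_eq_exp_iff_exists_int.1 hab
    rw [← hper l _ hb, hl]
    congr 1
    simp only [p]; ring
  let V : Set ℂ := {τ : ℂ | ‖τ‖ ^ M < r}
  have hVo : IsOpen V := isOpen_lt (by fun_prop) continuous_const
  have h0V : (0:ℂ) ∈ V := by
    change ‖(0:ℂ)‖ ^ M < r
    simpa [hM] using hr
  -- Substituting ω = M log τ turns e + exp ω into e + τ^M; by the periodicity the choice of the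
  -- logarithm does not matter.
  let h₀ : ℂ → ℂ := fun τ => φ (M * Complex.log τ)
  have hlogU : ∀ τ ∈ V, τ ≠ 0 → M * Complex.log τ ∈ U := fun τ hτ h0 => by
    change (M * Complex.log τ).re < Real.log r
    rw [← Complex.ofReal_natCast, Complex.re_ofReal_mul, Complex.log_re, ← Real.log_pow]
    exact Real.log_lt_log (pow_pos (norm_pos_iff.2 h0) _) hτ
  have hexpM : ∀ τ : ℂ, τ ≠ 0 → Complex.exp (M * Complex.log τ) = τ ^ M := fun τ h0 => by
    rw [Complex.exp_nat_mul, Complex.exp_log h0]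
  have hh₀ : ∀ τ ∈ V, τ ≠ 0 → curveEq A B (e + τ ^ M) (h₀ τ) = 0 := fun τ hτ h0 => by
    have := hφ _ (hlogU τ hτ h0)
    simpa only [F, hexpM τ h0] using this
  have hh₀d : DifferentiableOn ℂ h₀ (V \ {0}) := by
    rintro τ₀ ⟨hτ₀, h0⟩
    have h0' : τ₀ ≠ 0 := h0
    refine DifferentiableAt.differentiableWithinAt ?_
    -- The principal logarithm is not analytic on the negative axis; this other branch is analytic
    -- at τ₀ in all cases.
    have h1 : h₀ =ᶠ[𝓝 τ₀] fun τ => φ (M * (Complex.log (τ / τ₀) + Complex.log τ₀)) := by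
      filter_upwards [isOpen_ne.mem_nhds h0', hVo.mem_nhds hτ₀] with τ hτ hτV
      have hτ' : τ ≠ 0 := hτ
      refine (hshift _ _ ?_ (hlogU τ hτV hτ')).symm
      rw [Complex.exp_add, Complex.exp_log (div_ne_zero hτ' h0'), Complex.exp_log h0',
        Complex.exp_log hτ']
      field_simp
    refine DifferentiableAt.congr_of_eventuallyEq ?_ h1
    have h2 : DifferentiableAt ℂ (fun τ => M * (Complex.log (τ / τ₀) + Complex.log τ₀)) τ₀ := by
      refine DifferentiableAt.const_mul (DifferentiableAt.add_const _ ?_) _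
      refine DifferentiableAt.clog (by fun_prop) ?_
      rw [div_self h0']; exact Complex.one_mem_slitPlane
    refine DifferentiableAt.comp τ₀ (g := φ) ?_ h2
    refine (hφd _ ?_).differentiableAt (hUo.mem_nhds ?_) <;>
    · simp only [div_self h0', Complex.log_one, zero_add]
      exact hlogU τ₀ hτ₀ h0'
  obtain ⟨C, hC⟩ := exists_bound_of_curveEq A hB (‖e‖ + r)
  -- Roots of the curve equation are locally bounded, so the singularity at τ = 0 is removable: this
  -- is why there are no poles.
  have hbdd : BddAbove (norm ∘ h₀ '' (V \ {0})) := by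
    refine ⟨C, ?_⟩
    rintro _ ⟨τ, ⟨hτ, h0⟩, rfl⟩
    refine hC _ _ ?_ (hh₀ τ hτ h0)
    refine (norm_add_le _ _).trans ?_
    rw [norm_pow]
    have : ‖τ‖ ^ M < r := hτ
    linarith
  let h : ℂ → ℂ := Function.update h₀ 0 (limUnder (𝓝[≠] 0) h₀)
  have hh : ∀ τ, τ ≠ 0 → h τ = h₀ τ := fun τ h0 => Function.update_of_ne h0 _ _
  have hhd : DifferentiableOn ℂ h V :=
    Complex.differentiableOn_update_limUnder_of_bddAbove (hVo.mem_nhds h0V) hh₀d hbdd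
  let τ₁ := Complex.exp (ω₁ / M)
  have hτ₁0 : τ₁ ≠ 0 := Complex.exp_ne_zero _
  have hτ₁M : τ₁ ^ M = z₁ - e := by
    rw [← Complex.exp_nat_mul, mul_div_cancel₀ _ hM0, hω₁]
  have hτ₁V : τ₁ ∈ V := by
    change ‖τ₁‖ ^ M < r
    rw [← norm_pow, hτ₁M]
    simpa [dist_eq_norm] using hz₁.1
  refine ⟨M, h, τ₁, m.succ_pos, hhd, by rw [hτ₁M]; ring, ?_⟩
  have hFτ : e + τ₁ ^ M = z₁ := by rw [hτ₁M]; ring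
  have hcont : ContinuousAt (fun τ : ℂ => e + τ ^ M) τ₁ := by fun_prop
  refine eventuallyEq_of_curveEq (A := A) (B := B) (F := fun τ => e + τ ^ M) hcont ?_ ?_ ?_ ?_ ?_ ?_
  · exact ContinuousAt.comp (g := g) (by rw [hFτ]; exact hg) hcont
  · exact hhd.continuousOn.continuousAt (hVo.mem_nhds hτ₁V)
  · rw [hh τ₁ hτ₁0, hFτ, ← hφ1]
    have h1 := hshift (Complex.log τ₁) (ω₁ / M) (by rw [Complex.exp_log hτ₁0])
      (by rw [mul_div_cancel₀ _ hM0]; exact hω₁U)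
    rw [mul_div_cancel₀ _ hM0] at h1
    exact h1.symm
  · have := hcont.tendsto
    rw [hFτ] at this
    exact this.eventually hcg
  · filter_upwards [hVo.mem_nhds hτ₁V, isOpen_ne.mem_nhds hτ₁0] with τ hτ h0
    rw [hh τ h0]; exact hh₀ τ hτ h0
  · rw [hFτ]; exact disjoint_left.1 hd hz₁

/-! ### Finiteness of the set of branch points. -/

/-- For the curve attached to a bounded domain with polynomial best approximation, the set of
branch points is finite. -/
lemma finite_branchPoints_of_frontier {Ω : Set ℂ} (hΩo : IsOpen Ω) (hΩ : Bornology.IsBounded Ω)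
    (hc : IsConnected Ω) {P : Polynomial ℂ} (hn : 2 ≤ P.natDegree)
    (hP : ∀ ζ ∈ frontier Ω, ζ * (starRingEnd ℂ) ζ = P.eval ζ + (starRingEnd ℂ) (P.eval ζ)) :
    (branchPoints P (P.map (starRingEnd ℂ))).Finite := by
  refine finite_branchPoints fun h => ?_
  set B := P.map (starRingEnd ℂ) with hB
  have hBn : B.natDegree = P.natDegree := Polynomial.natDegree_map_eq_of_injective
      (starRingEnd ℂ).injective P
  have hB'n : B.derivative.natDegree = B.natDegree - 1 := Polynomial.natDegree_derivative B
  rcases hn.eq_or_lt with h2 | h3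
  -- Case n = 2. If the eliminant vanished identically, then over each boundary point ζ the
  -- quadratic in w would have the double root w₀ with B'(w₀) = ζ, so conj ζ = w₀. Conjugating gives
  -- conj ζ = P'(ζ), boundary values of a polynomial, which is impossible.
  · have hBquad : B = Polynomial.C (B.coeff 2) * Polynomial.X ^ 2 +
        Polynomial.C (B.coeff 1) * Polynomial.X + Polynomial.C (B.coeff 0) :=
      Polynomial.eq_quadratic_of_degree_le_two
        (Polynomial.natDegree_le_iff_degree_le.1 (show B.natDegree ≤ 2 by omega))
    have hlead : B.coeff 2 ≠ 0 := by
      have : B.coeff B.natDegree ≠ 0 := Polynomial.leadingCoeff_ne_zero.2 (by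
        intro h0; rw [h0] at hBn; simp at hBn; omega)
      rwa [hBn, ← h2] at this
    have hBe : ∀ w, B.eval w = B.coeff 2 * w ^ 2 + B.coeff 1 * w + B.coeff 0 := fun w => by
      conv_lhs => rw [hBquad]
      simp
    have hB'e : ∀ w, B.derivative.eval w = 2 * B.coeff 2 * w + B.coeff 1 := fun w => by
      conv_lhs => rw [hBquad]
      simp only [Polynomial.derivative_add, Polynomial.derivative_mul, Polynomial.derivative_C,
        Polynomial.derivative_X_pow, Polynomial.derivative_X, Polynomial.eval_add,
        Polynomial.eval_mul, Polynomial.eval_C, Polynomial.eval_X, Polynomial.eval_pow,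
        Polynomial.eval_zero, Polynomial.eval_one]
      push_cast
      ring
    refine not_tendsto_conj_frontier hΩo hΩ hc
      (G := fun z => P.derivative.eval z) P.derivative.differentiable.differentiableOn
      fun ζ hζ => ?_
    have hcont := (P.derivative.continuous.tendsto ζ).mono_left (nhdsWithin_le_nhds (s := Ω))
    convert! hcont using 2
    obtain ⟨w₀, hw₀⟩ : ∃ w₀, B.derivative.eval w₀ = ζ :=
      ⟨(ζ - B.coeff 1) / (2 * B.coeff 2), by rw [hB'e]; field_simp; ring⟩
    have e1 := congrArg (Polynomial.eval w₀) h
    simp only [Polynomial.eval_sub, Polynomial.eval_mul, Polynomial.eval_X, Polynomial.eval_comp,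
      Polynomial.eval_zero, hw₀] at e1
    have e2 := hP ζ hζ
    rw [← eval_map_conj, ← hB] at e2
    have e3 : B.coeff 2 * ((starRingEnd ℂ) ζ - w₀) ^ 2 = 0 := by
      rw [hB'e] at hw₀
      rw [hBe] at e1 e2
      linear_combination e1 - e2 + ((starRingEnd ℂ) ζ - w₀) * -hw₀
    have e4 : (starRingEnd ℂ) ζ = w₀ :=
      sub_eq_zero.1 (eq_zero_of_pow_eq_zero ((mul_eq_zero.1 e3).resolve_left hlead))
    have e5 : B.derivative.eval ((starRingEnd ℂ) ζ) = (starRingEnd ℂ) (P.derivative.eval ζ) := by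
      rw [hB, Polynomial.derivative_map, eval_map_conj]
    rw [← e4, e5] at hw₀
    rw [← hw₀, Complex.conj_conj, hw₀]
  -- Case n ≥ 3: the composition has degree n (n - 1), the other two terms at most n.
  · have h1 : P.comp B.derivative = Polynomial.X * B.derivative - B := by
      linear_combination -h
    have h2 := congrArg Polynomial.natDegree h1
    rw [Polynomial.natDegree_comp, hB'n, hBn] at h2
    have h4 : (Polynomial.X * B.derivative - B).natDegree ≤ P.natDegree := by
      refine (Polynomial.natDegree_sub_le _ _).trans (max_le ?_ hBn.le)
      refine Polynomial.natDegree_mul_le.trans ?_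
      rw [Polynomial.natDegree_X, hB'n, hBn]
      omega
    have h5 : P.natDegree * 2 ≤ P.natDegree * (P.natDegree - 1) :=
      Nat.mul_le_mul_left _ (by omega)
    omega

/-! ### Families of germs along curves. -/

lemma forall_of_eventually_iff {X : Type*} [TopologicalSpace X] [PreconnectedSpace X]
    {p : X → Prop} (h : ∀ t, ∀ᶠ s in 𝓝 t, (p s ↔ p t)) {t₀ : X} (h0 : p t₀) (t : X) : p t := by
  have hcl : IsClopen {t | p t} := by
    refine ⟨isOpen_compl_iff.1 (isOpen_iff_mem_nhds.2 fun t ht => ?_),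
      isOpen_iff_mem_nhds.2 fun t ht => ?_⟩
    · filter_upwards [h t] with s hs using fun h' => ht (hs.1 h')
    · filter_upwards [h t] with s hs using hs.2 ht
  have := hcl.eq_univ ⟨t₀, h0⟩
  exact this.symm.subset (mem_univ t)

lemma eventuallyEq_iff_of_analyticOnNhd {U : Set ℂ} (hU : IsPreconnected U) (hUo : IsOpen U)
    {f g : ℂ → ℂ} (hf : AnalyticOnNhd ℂ f U) (hg : AnalyticOnNhd ℂ g U) {x y : ℂ} (hx : x ∈ U)
    (hy : y ∈ U) : f =ᶠ[𝓝 x] g ↔ f =ᶠ[𝓝 y] g :=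
  ⟨fun h => (hf.eqOn_of_preconnected_of_eventuallyEq hg hU hx h).eventuallyEq_of_mem
      (hUo.mem_nhds hy),
    fun h => (hf.eqOn_of_preconnected_of_eventuallyEq hg hU hy h).eventuallyEq_of_mem
      (hUo.mem_nhds hx)⟩

/-- A family of analytic germs along a curve, locally coherent. -/
def IsGermFamily (γ : C(unitInterval, ℂ)) (f : unitInterval → ℂ → ℂ) : Prop :=
  (∀ t, AnalyticAt ℂ (f t) (γ t)) ∧ ∀ t, ∀ᶠ s in 𝓝 t, f s =ᶠ[𝓝 (γ s)] f t

namespace IsGermFamily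

variable {γ : C(unitInterval, ℂ)} {f f' : unitInterval → ℂ → ℂ}

lemma comp (h : IsGermFamily γ f) (φ : C(unitInterval, unitInterval)) :
    IsGermFamily (γ.comp φ) (f ∘ φ) :=
  ⟨fun t => h.1 (φ t), fun t => (φ.continuous.tendsto t).eventually (h.2 (φ t))⟩

lemma const {S : ℂ → ℂ} (h : ∀ t, AnalyticAt ℂ S (γ t)) : IsGermFamily γ fun _ => S :=
  ⟨h, fun _ => Eventually.of_forall fun _ => EventuallyEq.rfl⟩

/-- Agreement of the two germs is a locally constant property of the parameter, by the identity
theorem on a small ball. -/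
lemma unique (h : IsGermFamily γ f) (h' : IsGermFamily γ f') {t₀ : unitInterval}
    (h0 : f t₀ =ᶠ[𝓝 (γ t₀)] f' t₀) (t : unitInterval) : f t =ᶠ[𝓝 (γ t)] f' t := by
  refine forall_of_eventually_iff (p := fun t => f t =ᶠ[𝓝 (γ t)] f' t) (fun t => ?_) h0 t
  obtain ⟨r, hr, ha⟩ := (h.1 t).exists_ball_analyticOnNhd
  obtain ⟨r', hr', ha'⟩ := (h'.1 t).exists_ball_analyticOnNhd
  have hm := lt_min hr hr'
  filter_upwards [h.2 t, h'.2 t, γ.continuous.continuousAt.preimage_mem_nhds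
    (Metric.ball_mem_nhds (γ t) hm)] with s h1 h2 h3
  have e1 : f s =ᶠ[𝓝 (γ s)] f' s ↔ f t =ᶠ[𝓝 (γ s)] f' t :=
    ⟨fun h => h1.symm.trans (h.trans h2), fun h => h1.trans (h.trans h2.symm)⟩
  rw [e1]
  exact eventuallyEq_iff_of_analyticOnNhd (convex_ball _ _).isPreconnected Metric.isOpen_ball
    (ha.mono (Metric.ball_subset_ball (min_le_left _ _)))
    (ha'.mono (Metric.ball_subset_ball (min_le_right _ _))) h3 (Metric.mem_ball_self hm)

/-- Permanence of functional relations: the left side of the equation is itself a germ family,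
compared with the zero family. -/
lemma curveEq_eq_zero {A B : Polynomial ℂ} (h : IsGermFamily γ f) {t₀ : unitInterval}
    (h0 : ∀ᶠ z in 𝓝 (γ t₀), curveEq A B z (f t₀ z) = 0) (t : unitInterval) :
    ∀ᶠ z in 𝓝 (γ t), curveEq A B z (f t z) = 0 := by
  have hc : IsGermFamily γ fun t z => curveEq A B z (f t z) := by
    refine ⟨fun t => ?_, fun t => ?_⟩
    · unfold curveEq
      refine ((analyticAt_id.mul (h.1 t)).sub ?_).sub ?_
      · exact (A.differentiable.analyticAt _)
      · exact (B.differentiable.analyticAt _).comp (h.1 t)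
    · filter_upwards [h.2 t] with s hs
      filter_upwards [hs] with z hz
      rw [hz]
  exact hc.unique (const (S := fun _ => 0) fun _ => analyticAt_const) h0 t

/-- The germs of a coherent family have representatives on balls of a fixed radius. -/
lemma exists_uniform (h : IsGermFamily γ f) : ∃ ρ > 0, ∃ F : unitInterval → ℂ → ℂ,
    ∀ s, F s =ᶠ[𝓝 (γ s)] f s ∧ AnalyticOnNhd ℂ (F s) (Metric.ball (γ s) ρ) := by
  have key : ∃ ρ > 0, ∀ s ∈ (univ : Set unitInterval), ∃ F : ℂ → ℂ,
      F =ᶠ[𝓝 (γ s)] f s ∧ AnalyticOnNhd ℂ F (Metric.ball (γ s) ρ) := by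
    refine isCompact_univ.induction_on (p := fun T : Set unitInterval => ∃ ρ > 0, ∀ s ∈ T,
      ∃ F : ℂ → ℂ, F =ᶠ[𝓝 (γ s)] f s ∧ AnalyticOnNhd ℂ F (Metric.ball (γ s) ρ))
      ⟨1, one_pos, by simp⟩ ?_ ?_ ?_
    · rintro T T' hT ⟨ρ, hρ, H⟩
      exact ⟨ρ, hρ, fun s hs => H s (hT hs)⟩
    · rintro T T' ⟨ρ, hρ, H⟩ ⟨ρ', hρ', H'⟩
      refine ⟨min ρ ρ', lt_min hρ hρ', ?_⟩
      rintro s (hs | hs)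
      · obtain ⟨F, h1, h2⟩ := H s hs
        exact ⟨F, h1, h2.mono (Metric.ball_subset_ball (min_le_left _ _))⟩
      · obtain ⟨F, h1, h2⟩ := H' s hs
        exact ⟨F, h1, h2.mono (Metric.ball_subset_ball (min_le_right _ _))⟩
    · intro t _
      obtain ⟨r, hr, ha⟩ := (h.1 t).exists_ball_analyticOnNhd
      refine ⟨_, mem_nhdsWithin_of_mem_nhds (inter_mem (h.2 t)
        (γ.continuous.continuousAt.preimage_mem_nhds
          (Metric.ball_mem_nhds (γ t) (half_pos hr)))), r / 2, half_pos hr, ?_⟩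
      rintro s ⟨h1, h2⟩
      have h1' : f s =ᶠ[𝓝 (γ s)] f t := h1
      refine ⟨f t, h1'.symm, ha.mono (Metric.ball_subset_ball' ?_)⟩
      have : dist (γ s) (γ t) < r / 2 := h2
      linarith
  obtain ⟨ρ, hρ, H⟩ := key
  choose F hF using fun s => H s (mem_univ s)
  exact ⟨ρ, hρ, F, hF⟩

/-- A coherent family of germs along a curve induces such families along all nearby curves. -/
lemma exists_nearby (h : IsGermFamily γ f) : ∃ ρ > 0, ∃ F : unitInterval → ℂ → ℂ,
    (∀ s, F s =ᶠ[𝓝 (γ s)] f s) ∧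
    ∀ γ' : C(unitInterval, ℂ), (∀ s, dist (γ' s) (γ s) < ρ) → IsGermFamily γ' F := by
  obtain ⟨ρ, hρ, F, hF⟩ := h.exists_uniform
  refine ⟨ρ, hρ, F, fun s => (hF s).1, fun γ' hd => ⟨fun t => (hF t).2 _ (hd t), fun t => ?_⟩⟩
  filter_upwards [h.2 t, γ.continuous.continuousAt.preimage_mem_nhds
    (Metric.ball_mem_nhds (γ t) hρ), γ'.continuous.continuousAt.preimage_mem_nhds
    (Metric.isOpen_ball.mem_nhds (hd t)),
    γ.continuous.continuousAt.eventually (hF t).1.eventually_nhds] with s h1 h2 h3 h5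
  have h4 : F s =ᶠ[𝓝 (γ s)] F t :=
    (hF s).1.trans (h1.trans (EventuallyEq.symm (f := F t) (g := f t) h5))
  -- The intersection of the two balls is convex and contains both γ s and γ' s, so agreement of
  -- germs transfers from one to the other.
  exact (eventuallyEq_iff_of_analyticOnNhd
    ((convex_ball _ _).inter (convex_ball _ _)).isPreconnected
    (Metric.isOpen_ball.inter Metric.isOpen_ball)
    ((hF s).2.mono inter_subset_left) ((hF t).2.mono inter_subset_right)
    ⟨Metric.mem_ball_self hρ, h2⟩ ⟨hd s, h3⟩).1 h4

/-- Existence of coherent families along a curve, from a uniform local extension property. -/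
lemma exists_of_extension {γ : C(unitInterval, ℂ)} {𝒢 : ℂ → (ℂ → ℂ) → Prop}
    (han : ∀ z g, 𝒢 z g → AnalyticAt ℂ g z)
    (hloc : ∀ t, ∃ r > 0, ∀ z ∈ Metric.ball (γ t) r, ∀ g, 𝒢 z g →
      ∃ G : ℂ → ℂ, G =ᶠ[𝓝 z] g ∧ ∀ y ∈ Metric.ball (γ t) r, 𝒢 y G)
    {g : ℂ → ℂ} (hg : 𝒢 (γ 0) g) :
    ∃ f, IsGermFamily γ f ∧ f 0 = g ∧ ∀ t, 𝒢 (γ t) (f t) := by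
  -- Here `𝒢 z g` means that g is an admissible germ at z, and `p t` that a continuation exists up
  -- to time t. The extension property on balls makes p locally constant.
  let p : unitInterval → Prop := fun t => ∃ f : unitInterval → ℂ → ℂ, f 0 = g ∧
    (∀ s ≤ t, 𝒢 (γ s) (f s)) ∧ ∀ s ≤ t, ∀ᶠ s' in 𝓝 s, s' ≤ t → f s' =ᶠ[𝓝 (γ s')] f s
  have hmono : ∀ {x y}, y ≤ x → p x → p y := by
    rintro x y hyx ⟨f, h0, h1, h2⟩
    refine ⟨f, h0, fun s hs => h1 s (hs.trans hyx), fun s hs => ?_⟩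
    filter_upwards [h2 s (hs.trans hyx)] with s' h h' using h (h'.trans hyx)
  have hp : ∀ t, p t := by
    refine forall_of_eventually_iff (t₀ := 0) (fun t => ?_)
      ⟨fun _ => g, rfl, fun s hs => by rw [le_antisymm hs unitInterval.nonneg']; exact hg,
        fun s _ => Eventually.of_forall fun _ _ => EventuallyEq.rfl⟩
    obtain ⟨r, hr, hext⟩ := hloc t
    obtain ⟨δ, hδ, hball⟩ := Metric.mem_nhds_iff.1
      (γ.continuous.continuousAt.preimage_mem_nhds (Metric.ball_mem_nhds (γ t) hr))
    have hconv : ∀ {x y s : unitInterval}, x ∈ Metric.ball t δ → y ∈ Metric.ball t δ →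
        x ≤ s → s ≤ y → s ∈ Metric.ball t δ := by
      intro x y s hx hy hxs hsy
      rw [Metric.mem_ball, Subtype.dist_eq, Real.dist_eq, abs_lt] at hx hy ⊢
      have h1 : (x : ℝ) ≤ s := hxs
      have h2 : (s : ℝ) ≤ y := hsy
      constructor <;> linarith [hx.1, hy.2]
    have key : ∀ {x y}, x ∈ Metric.ball t δ → y ∈ Metric.ball t δ → p x → p y := by
      intro x y hx hy hpx
      rcases le_or_gt y x with hyx | hxy
      · exact hmono hyx hpx
      obtain ⟨f, h0, h1, h2⟩ := hpx
      obtain ⟨G, hG, hG'⟩ := hext (γ x) (hball hx) (f x) (h1 x le_rfl)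
      classical
      refine ⟨fun s => if s ≤ x then f s else G, by simp [h0],
        fun s hs => ?_, fun s hs => ?_⟩
      · dsimp only
        split_ifs with hsx
        · exact h1 s hsx
        · exact hG' _ (hball (hconv hx hy (not_le.1 hsx).le hs))
      · rcases lt_trichotomy s x with hsx | rfl | hsx
        · filter_upwards [h2 s hsx.le, Iio_mem_nhds hsx] with s' h h' _
          have h'' : s' < x := h'
          simpa [h''.le, hsx.le] using h h''.le
        · filter_upwards [h2 s le_rfl, γ.continuous.continuousAt.eventually hG.eventually_nhds]
            with s' h h' _
          by_cases hs' : s' ≤ s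
          · simpa [hs'] using h hs'
          · simp only [hs', if_false, le_refl, if_true]
            exact h'
        · filter_upwards [Ioi_mem_nhds hsx] with s' h' _
          have h'' : x < s' := h'
          simp [h''.not_ge, hsx.not_ge]
    filter_upwards [Metric.ball_mem_nhds t hδ] with s hs
    exact ⟨key hs (Metric.mem_ball_self hδ), key (Metric.mem_ball_self hδ) hs⟩
  obtain ⟨f, h0, h1, h2⟩ := hp 1
  refine ⟨f, ⟨fun t => han _ _ (h1 t unitInterval.le_one'), fun t => ?_⟩, h0,
    fun t => h1 t unitInterval.le_one'⟩
  filter_upwards [h2 t unitInterval.le_one'] with s h using h unitInterval.le_one'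

/-- Attach a segment at the end of a curve. -/
lemma extend_segment (h : IsGermFamily γ f) {r : ℝ} {y : ℂ}
    (ha : AnalyticOnNhd ℂ (f 1) (Metric.ball (γ 1) r)) (hy : y ∈ Metric.ball (γ 1) r) :
    ∃ (γ' : C(unitInterval, ℂ)) (f' : unitInterval → ℂ → ℂ), IsGermFamily γ' f' ∧
      γ' 0 = γ 0 ∧ f' 0 = f 0 ∧ γ' 1 = y ∧ f' 1 = f 1 ∧
      ∀ t, γ' t ∈ range γ ∪ Metric.ball (γ 1) r := by
  have hr : 0 < r := Metric.pos_of_mem_ball hy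
  -- Runs through γ at double speed and then rests at its end, while the added term of γ' describes
  -- the segment to y in the second half.
  let φ : C(unitInterval, unitInterval) := ⟨fun t => projIcc 0 1 zero_le_one (2 * t),
    continuous_projIcc.comp (by fun_prop)⟩
  let γ' : C(unitInterval, ℂ) := ⟨fun t => γ (φ t) + ((max (2 * (t:ℝ)) 1 - 1 : ℝ) : ℂ) * (y - γ 1),
    by fun_prop⟩
  have hφ1 : ∀ t : unitInterval, 1 ≤ 2 * (t : ℝ) → φ t = 1 := fun t ht =>
    projIcc_of_right_le zero_le_one ht
  have hle : ∀ t : unitInterval, 2 * (t : ℝ) ≤ 1 → γ' t = γ (φ t) := fun t ht => by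
    simp [γ', max_eq_right ht]
  have hge : ∀ t : unitInterval, 1 ≤ 2 * (t : ℝ) → γ' t ∈ Metric.ball (γ 1) r := fun t ht => by
    simp only [γ', ContinuousMap.coe_mk, hφ1 t ht, max_eq_left ht]
    rw [Metric.mem_ball, dist_eq_norm] at hy ⊢
    rw [add_sub_cancel_left, norm_mul, Complex.norm_real, Real.norm_eq_abs,
      abs_of_nonneg (by linarith)]
    have := t.2.2
    nlinarith [norm_nonneg (y - γ 1)]
  have hφ0 : φ 0 = 0 := by
    simp only [φ, ContinuousMap.coe_mk]
    exact projIcc_of_le_left zero_le_one (by simp)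
  refine ⟨γ', f ∘ φ, ⟨fun t => ?_, fun t => ?_⟩, ?_, ?_, ?_, ?_, fun t => ?_⟩
  · rcases le_or_gt (2 * (t : ℝ)) 1 with ht | ht
    · rw [hle t ht]; exact h.1 _
    · simp only [Function.comp, hφ1 t ht.le]
      exact ha _ (hge t ht.le)
  · have h1 := (φ.continuous.tendsto t).eventually (h.2 (φ t))
    rcases lt_or_ge (2 * (t : ℝ)) 1 with ht | ht
    · have : ∀ᶠ s : unitInterval in 𝓝 t, 2 * (s : ℝ) < 1 :=
        ContinuousAt.eventually_lt (by fun_prop) continuousAt_const ht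
      filter_upwards [h1, this] with s hs hs'
      rw [hle s hs'.le]; exact hs
    · filter_upwards [h1] with s hs
      rcases le_or_gt (2 * (s : ℝ)) 1 with hs' | hs'
      · rw [hle s hs']; exact hs
      · simp only [Function.comp, hφ1 s hs'.le, hφ1 t ht]
        exact EventuallyEq.rfl
  · rw [hle 0 (by simp), hφ0]
  · simp [hφ0]
  · simp only [γ', ContinuousMap.coe_mk, hφ1 1 (by norm_num)]
    norm_num
  · simp [hφ1 1 (by norm_num)]
  · rcases le_or_gt (2 * (t : ℝ)) 1 with ht | ht
    · rw [hle t ht]; exact Or.inl (mem_range_self _)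
    · exact Or.inr (hge t ht.le)

end IsGermFamily

/-! ### The monodromy theorem. -/

/-- Monodromy theorem. -/
theorem exists_differentiableOn_of_forall_isGermFamily {Ω : Set ℂ} (hΩo : IsOpen Ω)
    (hsc : IsSimplyConnected Ω) {z₀ : ℂ} (hz₀ : z₀ ∈ Ω) {g : ℂ → ℂ}
    (hcont : ∀ γ : C(unitInterval, ℂ), γ 0 = z₀ → (∀ t, γ t ∈ Ω) →
      ∃ f, IsGermFamily γ f ∧ f 0 =ᶠ[𝓝 z₀] g) :
    ∃ F : ℂ → ℂ, DifferentiableOn ℂ F Ω ∧ F =ᶠ[𝓝 z₀] g := by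
  have hscs : SimplyConnectedSpace Ω := hsc
  have mono : ∀ (γ γ' : C(unitInterval, ℂ)) (f f' : unitInterval → ℂ → ℂ),
      IsGermFamily γ f → IsGermFamily γ' f' → γ 0 = z₀ → γ' 0 = z₀ → (∀ t, γ t ∈ Ω) →
      (∀ t, γ' t ∈ Ω) → f 0 =ᶠ[𝓝 z₀] g → f' 0 =ᶠ[𝓝 z₀] g → γ 1 = γ' 1 →
      f 1 =ᶠ[𝓝 (γ 1)] f' 1 := by
    intro γ γ' f f' h h' h0 h0' hm hm' hg hg' h1
    let p₁ : Path (⟨z₀, hz₀⟩ : Ω) ⟨γ 1, hm 1⟩ :=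
      { toFun := fun t => ⟨γ t, hm t⟩
        continuous_toFun := by fun_prop
        source' := Subtype.ext h0
        target' := rfl }
    let p₂ : Path (⟨z₀, hz₀⟩ : Ω) ⟨γ 1, hm 1⟩ :=
      { toFun := fun t => ⟨γ' t, hm' t⟩
        continuous_toFun := by fun_prop
        source' := Subtype.ext h0'
        target' := Subtype.ext h1.symm }
    obtain ⟨H⟩ := SimplyConnectedSpace.paths_homotopic p₁ p₂
    let K : unitInterval → C(unitInterval, ℂ) := fun u => ⟨fun t => (H (u, t) : ℂ), by fun_prop⟩
    have hKc : Continuous K := by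
      refine ContinuousMap.continuous_of_continuous_uncurry _ ?_
      change Continuous fun q : unitInterval × unitInterval => (H (q.1, q.2) : ℂ)
      exact continuous_subtype_val.comp H.continuous
    have hK0 : ∀ u, K u 0 = z₀ := fun u => congrArg Subtype.val (H.source u)
    have hK1 : ∀ u, K u 1 = γ 1 := fun u => congrArg Subtype.val (H.target u)
    have hKm : ∀ u t, K u t ∈ Ω := fun u t => (H (u, t)).2
    choose k hk hkg using fun u => hcont (K u) (hK0 u) (hKm u)
    -- The end germ is locally constant in the homotopy parameter: the family along K u induces one
    -- along every nearby K v, and continuations are unique.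
    have hall : ∀ u, k u 1 =ᶠ[𝓝 (γ 1)] k 0 1 := by
      refine forall_of_eventually_iff (t₀ := 0) (fun u => ?_) EventuallyEq.rfl
      obtain ⟨ρ, hρ, F, hF, hFK⟩ := (hk u).exists_nearby
      filter_upwards [hKc.continuousAt.preimage_mem_nhds (Metric.ball_mem_nhds (K u) hρ)] with v hv
      have hv' : ∀ s, dist (K v s) (K u s) < ρ := fun s =>
        (ContinuousMap.dist_apply_le_dist s).trans_lt hv
      have e0 : k v 0 =ᶠ[𝓝 (K v 0)] F 0 := by
        have := hF 0
        rw [hK0] at this ⊢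
        exact (hkg v).trans ((this.trans (hkg u)).symm)
      have e1 := (hk v).unique (hFK (K v) hv') e0 1
      have e2 := hF 1
      rw [hK1] at e1 e2
      have e3 := e1.trans e2
      exact ⟨fun h => e3.symm.trans h, fun h => e3.trans h⟩
    have hKγ : K 0 = γ := by ext t; exact congrArg Subtype.val (H.apply_zero t)
    have hKγ' : K 1 = γ' := by ext t; exact congrArg Subtype.val (H.apply_one t)
    have a0 := hk 0
    have a1 := hk 1
    rw [hKγ] at a0
    rw [hKγ'] at a1
    have b0 := h.unique a0 (t₀ := 0) (by rw [h0]; exact hg.trans (hkg 0).symm) 1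
    have b1 := h'.unique a1 (t₀ := 0) (by rw [h0']; exact hg'.trans (hkg 1).symm) 1
    rw [← h1] at b1
    exact b0.trans ((hall 1).symm.trans b1.symm)
  have hpath : ∀ z : Ω, ∃ γ : C(unitInterval, ℂ), γ 0 = z₀ ∧ γ 1 = z ∧ ∀ t, γ t ∈ Ω := by
    intro z
    obtain ⟨q⟩ := PathConnectedSpace.joined (⟨z₀, hz₀⟩ : Ω) z
    exact ⟨⟨fun t => (q t : ℂ), by fun_prop⟩, by simp, by simp, fun t => (q t).2⟩
  choose γ hγ0 hγ1 hγm using hpath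
  choose f hf hfg using fun z => hcont (γ z) (hγ0 z) (hγm z)
  classical
  let F : ℂ → ℂ := fun z => if h : z ∈ Ω then f ⟨z, h⟩ 1 z else 0
  have hF : ∀ z : Ω, F =ᶠ[𝓝 (z:ℂ)] f z 1 := by
    intro z
    have hfa := (hf z).1 1
    rw [hγ1] at hfa
    obtain ⟨r, hr, ha⟩ := hfa.exists_ball_analyticOnNhd
    obtain ⟨r', hr', hsub⟩ := Metric.isOpen_iff.1 hΩo z z.2
    filter_upwards [Metric.ball_mem_nhds (z:ℂ) (lt_min hr hr')] with y hy
    have hyΩ : y ∈ Ω := hsub (Metric.ball_subset_ball (min_le_right _ _) hy)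
    -- Compare the chosen path to y with the chosen path to z followed by a segment: both end in the
    -- same germ, so F is given by `f z 1` near z.
    obtain ⟨γ', f', h1, h2, h3, h4, h5, h6⟩ := (hf z).extend_segment (r := min r r') (y := y)
      (by rw [hγ1]; exact ha.mono (Metric.ball_subset_ball (min_le_left _ _)))
      (by rw [hγ1]; exact hy)
    have h7 : ∀ t, γ' t ∈ Ω := fun t => by
      rcases h6 t with ⟨s, hs⟩ | h
      · rw [← hs]; exact hγm z s
      · rw [hγ1] at h
        exact hsub (Metric.ball_subset_ball (min_le_right _ _) h)
    have := mono (γ ⟨y, hyΩ⟩) γ' _ f' (hf ⟨y, hyΩ⟩) h1 (hγ0 _) (by rw [h2, hγ0]) (hγm _) h7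
      (hfg _) (by rw [h3]; exact hfg z) (by rw [hγ1, h4])
    rw [hγ1, h5] at this
    simp only [F, hyΩ, dite_true]
    exact this.self_of_nhds
  refine ⟨F, fun z hz => ?_, ?_⟩
  · have h1 := (hf ⟨z, hz⟩).1 1
    rw [hγ1] at h1
    exact (h1.congr (hF ⟨z, hz⟩).symm).differentiableAt.differentiableWithinAt
  · refine (hF ⟨z₀, hz₀⟩).trans ?_
    have h1 := mono _ (ContinuousMap.const _ z₀) _ _ (hf ⟨z₀, hz₀⟩)
      (IsGermFamily.const (S := f ⟨z₀, hz₀⟩ 0) fun _ => by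
        have := (hf ⟨z₀, hz₀⟩).1 0
        rwa [hγ0] at this) (hγ0 _) rfl (hγm _) (fun _ => hz₀) (hfg _) (hfg _) (hγ1 _)
    rw [hγ1] at h1
    exact h1.trans (hfg _)

/-! ### Local Schwarz functions as branches of the curve. -/

lemma IsPreconnected.subset_of_disjoint_frontier {X : Type*} [TopologicalSpace X] {T Ω : Set X}
    (hT : IsPreconnected T) (hΩo : IsOpen Ω) (hd : Disjoint T (frontier Ω))
    (hne : (T ∩ Ω).Nonempty) : T ⊆ Ω := by
  refine hT.subset_left_of_subset_union hΩo isClosed_closure.isOpen_compl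
    (disjoint_compl_right.mono_right (compl_subset_compl.2 subset_closure)) (fun y hy => ?_) hne
  by_contra hnot
  simp only [mem_union, mem_compl_iff, not_or, not_not] at hnot
  refine disjoint_left.1 hd hy ?_
  rw [hΩo.frontier_eq]
  exact ⟨hnot.2, hnot.1⟩

/-- The boundary of a simply connected domain has no isolated points. -/
lemma frequently_mem_frontier {Ω : Set ℂ} (hΩo : IsOpen Ω) (hsc : IsSimplyConnected Ω) {ζ : ℂ}
    (hζ : ζ ∈ frontier Ω) : ∃ᶠ z in 𝓝[≠] ζ, z ∈ frontier Ω := by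
  intro hev
  have hζΩ : ζ ∉ Ω := by
    rw [hΩo.frontier_eq] at hζ; exact hζ.2
  obtain ⟨r, hr, hball⟩ := Metric.mem_nhdsWithin_iff.1 hev
  obtain ⟨z, hzΩ, hz⟩ := Metric.mem_closure_iff.1 (frontier_subset_closure hζ) r hr
  have hρ : 0 < dist z ζ := dist_pos.2 fun h => hζΩ (h ▸ hzΩ)
  have hrank : 1 < Module.rank ℝ ℂ := by
    rw [Complex.rank_real_complex]; norm_num
  -- If ζ were isolated, a small circle around it would lie in Ω, where 1/(y - ζ) has a primitive;
  -- but its integral over the circle is 2πi.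
  have hsub : Metric.sphere ζ (dist z ζ) ⊆ Ω := by
    refine (isPreconnected_sphere hrank ζ (dist z ζ)).subset_of_disjoint_frontier hΩo ?_
      ⟨z, rfl, hzΩ⟩
    refine disjoint_left.2 fun y hy hyf => hball ⟨?_, ?_⟩ hyf
    · rw [Metric.mem_ball, Metric.mem_sphere.1 hy, dist_comm]; exact hz
    · rintro rfl
      rw [Metric.mem_sphere, dist_self] at hy
      exact hρ.ne hy
  obtain ⟨L, hL, -⟩ := exists_differentiableOn_log_sub hΩo hsc hζΩ
  have h1 := circleIntegral.integral_eq_zero_of_hasDerivWithinAt hρ.le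
    fun y hy => (hL y (hsub hy)).hasDerivWithinAt (s := Metric.sphere ζ (dist z ζ))
  rw [circleIntegral.integral_sub_center_inv _ hρ.ne'] at h1
  simp at h1

lemma curveEq_conj_frontier {Ω : Set ℂ} {P : Polynomial ℂ}
    (hP : ∀ ζ ∈ frontier Ω, ζ * (starRingEnd ℂ) ζ = P.eval ζ + (starRingEnd ℂ) (P.eval ζ))
    {ζ : ℂ} (hζ : ζ ∈ frontier Ω) :
    curveEq P (P.map (starRingEnd ℂ)) ζ ((starRingEnd ℂ) ζ) = 0 := by
  rw [curveEq, eval_map_conj, hP ζ hζ]; ring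

lemma analyticAt_curveEq_comp (A B : Polynomial ℂ) {S : ℂ → ℂ} {z : ℂ} (hS : AnalyticAt ℂ S z) :
    AnalyticAt ℂ (fun z => curveEq A B z (S z)) z :=
  ((analyticAt_id.mul hS).sub (A.differentiable.analyticAt _)).sub
    ((B.differentiable.analyticAt _).comp hS)

/-- The analytic function z ↦ z S(z) - P(z) - P^#(S(z)) vanishes at boundary points, and these
accumulate at ζ. -/
lemma IsSchwarzGermAt.curveEq_eq_zero {Ω : Set ℂ} (hΩo : IsOpen Ω) (hsc : IsSimplyConnected Ω)
    {P : Polynomial ℂ}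
    (hP : ∀ ζ ∈ frontier Ω, ζ * (starRingEnd ℂ) ζ = P.eval ζ + (starRingEnd ℂ) (P.eval ζ))
    {S : ℂ → ℂ} {ζ : ℂ} (hS : IsSchwarzGermAt Ω S ζ) :
    ∀ᶠ z in 𝓝 ζ, curveEq P (P.map (starRingEnd ℂ)) z (S z) = 0 := by
  obtain ⟨hζ, hSa, hSc⟩ := hS
  refine (analyticAt_curveEq_comp P _ hSa).frequently_zero_iff_eventually_zero.1 ?_
  have h1 := eventually_nhdsWithin_iff.1 hSc
  have h2 := (frequently_mem_frontier hΩo hsc hζ).and_eventually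
    (h1.filter_mono nhdsWithin_le_nhds)
  refine h2.mono ?_
  rintro z ⟨hz, hz'⟩
  rw [hz' hz]
  exact curveEq_conj_frontier hP hz

/-- The germ is the implicit function through (ζ, conj ζ). For boundary points z near ζ the point
(z, conj z) is on the curve and close to (ζ, conj ζ), hence on its graph. -/
lemma exists_isSchwarzGermAt {Ω : Set ℂ} {P : Polynomial ℂ}
    (hP : ∀ ζ ∈ frontier Ω, ζ * (starRingEnd ℂ) ζ = P.eval ζ + (starRingEnd ℂ) (P.eval ζ))
    {ζ : ℂ} (hζ : ζ ∈ frontier Ω) (hb : ζ ∉ branchPoints P (P.map (starRingEnd ℂ))) :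
    ∃ S : ℂ → ℂ, IsSchwarzGermAt Ω S ζ := by
  have h0 := curveEq_conj_frontier hP hζ
  obtain ⟨ψ, hψa, -, hψ⟩ := exists_implicit_curveEq h0 fun h => hb ⟨_, h, h0⟩
  refine ⟨ψ, hζ, hψa, ?_⟩
  have ht : Tendsto (fun z => (z, (starRingEnd ℂ) z)) (𝓝 ζ) (𝓝 (ζ, (starRingEnd ℂ) ζ)) :=
    (continuous_id.prodMk Complex.continuous_conj).tendsto ζ
  filter_upwards [(ht.eventually hψ).filter_mono nhdsWithin_le_nhds, self_mem_nhdsWithin]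
    with z hz hzf
  exact hz.1 (curveEq_conj_frontier hP hzf)

lemma IsAnalyticContinuationAlong.isGermFamily {S : ℂ → ℂ} {γ : C(unitInterval, ℂ)}
    {f : unitInterval → ℂ → ℂ} (h : IsAnalyticContinuationAlong S γ f) : IsGermFamily γ f :=
  ⟨h.1, h.2.2⟩

/-- A branch of the curve continues along every path that starts at its centre and avoids the
branch points at all later times. -/
lemma exists_isAnalyticContinuationAlong_of_curveEq (A : Polynomial ℂ) {B : Polynomial ℂ}
    (hB : 2 ≤ B.natDegree) (hfin : (branchPoints A B).Finite) {S : ℂ → ℂ}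
    {γ : C(unitInterval, ℂ)} (hS : AnalyticAt ℂ S (γ 0))
    (hcS : ∀ᶠ z in 𝓝 (γ 0), curveEq A B z (S z) = 0)
    (hγ : ∀ t, t ≠ 0 → γ t ∉ branchPoints A B) :
    ∃ f, IsAnalyticContinuationAlong S γ f := by
  obtain ⟨r, hr, hrS⟩ := Metric.eventually_nhds_iff_ball.1
    (hS.eventually_analyticAt.and hcS)
  obtain ⟨δ, hδ, hball⟩ := Metric.mem_nhds_iff.1
    (γ.continuous.continuousAt.preimage_mem_nhds (Metric.ball_mem_nhds (γ 0) hr))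
  -- The point γ 0 may be a branch point. Up to a small time t₀ the function S itself serves; the
  -- covering is used only from t₀ on.
  obtain ⟨t₀, ht₀, hlt⟩ : ∃ t₀ : unitInterval, 0 < t₀ ∧ t₀ ∈ Metric.ball 0 δ := by
    refine ⟨⟨min (δ / 2) 1, by positivity, min_le_right _ _⟩, ?_, ?_⟩
    · rw [← Subtype.coe_lt_coe]
      change (0:ℝ) < min (δ / 2) 1
      positivity
    · rw [Metric.mem_ball, Subtype.dist_eq, Real.dist_eq]
      change |min (δ / 2) 1 - 0| < δ
      rw [sub_zero, abs_of_nonneg (by positivity)]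
      exact (min_le_left _ _).trans_lt (by linarith)
  have hsmall : ∀ t ≤ t₀, γ t ∈ Metric.ball (γ 0) r := fun t ht => by
    refine hball ?_
    rw [Metric.mem_ball, Subtype.dist_eq, Real.dist_eq] at hlt ⊢
    have h1 : (t : ℝ) ≤ t₀ := ht
    rw [abs_lt] at hlt ⊢
    have h2 := t.2.1
    constructor <;> simp only [Icc.coe_zero, sub_zero] at hlt ⊢ <;>
      linarith [hlt.2]
  -- The reparametrised curve rests at γ t₀ until time t₀, so the family f still has the germ of S
  -- there.
  let φ : C(unitInterval, unitInterval) := ⟨fun t => max t₀ t, by fun_prop⟩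
  have hφ : ∀ t, γ.comp φ t = γ (max t₀ t) := fun t => rfl
  have hφ0 : γ.comp φ 0 = γ t₀ := by rw [hφ, max_eq_left ht₀.le]
  obtain ⟨f, hf, hf0, hf𝒢⟩ := IsGermFamily.exists_of_extension (γ := γ.comp φ)
    (𝒢 := fun z g => AnalyticAt ℂ g z ∧ ∀ᶠ y in 𝓝 z, curveEq A B y (g y) = 0)
    (fun _ _ h => h.1) (fun t => by
      have hmem : γ.comp φ t ∈ (branchPoints A B)ᶜ :=
        hγ _ (ht₀.trans_le (le_max_left _ _)).ne'
      obtain ⟨ρ, hρ, hsub⟩ := Metric.isOpen_iff.1 hfin.isClosed.isOpen_compl _ hmem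
      refine ⟨ρ, hρ, fun z hz g hg => ?_⟩
      obtain ⟨G, hGd, hGz, hGc⟩ := exists_lift_curve A hB Metric.isOpen_ball
        (convex_ball (γ.comp φ t) ρ) differentiableOn_id (fun x hx => hsub hx) hz
        (w₁ := g z) hg.2.self_of_nhds
      have hev : ∀ y ∈ Metric.ball (γ.comp φ t) ρ, ∀ᶠ x in 𝓝 y, curveEq A B x (G x) = 0 :=
        fun y hy => by
          filter_upwards [Metric.isOpen_ball.mem_nhds hy] with x hx using hGc x hx
      have hGa := hGd.analyticOnNhd Metric.isOpen_ball
      refine ⟨G, ?_, fun y hy => ⟨hGa y hy, hev y hy⟩⟩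
      exact eventuallyEq_of_curveEq (F := id) continuousAt_id (hGa z hz).continuousAt
        hg.1.continuousAt hGz (hev z hz) hg.2 (hsub hz))
    (g := S) (by
      rw [hφ0]
      exact ⟨(hrS _ (hsmall t₀ le_rfl)).1, by
        filter_upwards [Metric.isOpen_ball.mem_nhds (hsmall t₀ le_rfl)] with z hz
        using (hrS z hz).2⟩)
  have hft₀ : f t₀ =ᶠ[𝓝 (γ t₀)] S := by
    let χ : C(unitInterval, unitInterval) := ⟨fun t => min t t₀, by fun_prop⟩
    have h1 := hf.comp χ
    have hχ : ∀ t, (γ.comp φ).comp χ t = γ t₀ := fun t => by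
      change γ (max t₀ (min t t₀)) = _
      rw [max_eq_left (min_le_right _ _)]
    have h2 := h1.unique (IsGermFamily.const (S := S) fun t => by
      rw [hχ]; exact (hrS _ (hsmall t₀ le_rfl)).1) (t₀ := 0) (by
        have : χ 0 = 0 := min_eq_left ht₀.le
        rw [Function.comp, this, hf0]) t₀
    have h3 : χ t₀ = t₀ := min_self _
    rwa [hχ, Function.comp, h3] at h2
  classical
  refine ⟨fun t => if t ≤ t₀ then S else f t, fun t => ?_, by simp [ht₀.le], fun t => ?_⟩
  · dsimp only
    split_ifs with h
    · exact (hrS _ (hsmall t h)).1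
    · have := hf.1 t
      rwa [hφ, max_eq_right (not_le.1 h).le] at this
  · rcases lt_trichotomy t t₀ with h | rfl | h
    · filter_upwards [Iio_mem_nhds h] with s hs
      have hs' : s < t₀ := hs
      simp [hs'.le, h.le]
    · filter_upwards [hf.2 t, γ.continuous.continuousAt.eventually hft₀.eventually_nhds]
        with s h1 h2
      by_cases hs : s ≤ t
      · simp [hs]
      · rw [hφ, max_eq_right (not_le.1 hs).le] at h1
        simp only [hs, if_false, le_refl, if_true]
        exact h1.trans h2
    · filter_upwards [hf.2 t, Ioi_mem_nhds h] with s h1 h2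
      have h2' : t₀ < s := h2
      rw [hφ, max_eq_right h2'.le] at h1
      simpa [h2'.not_ge, h.not_ge] using h1

/-! ### Extending a Schwarz function from the boundary into the domain. -/

/-- If `|z|² = 2 Re P(z)` on the boundary, then this holds nowhere inside. -/
lemma mul_conj_ne_of_mem {Ω : Set ℂ} (hΩo : IsOpen Ω) (hΩ : Bornology.IsBounded Ω)
    {P : Polynomial ℂ}
    (hP : ∀ ζ ∈ frontier Ω, ζ * (starRingEnd ℂ) ζ = P.eval ζ + (starRingEnd ℂ) (P.eval ζ))
    {z : ℂ} (hz : z ∈ Ω) : z * (starRingEnd ℂ) z ≠ P.eval z + (starRingEnd ℂ) (P.eval z) := by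
  intro heq
  obtain ⟨d, hd, hball⟩ := Metric.isOpen_iff.1 hΩo z hz
  have hdist : ∀ ζ ∈ frontier Ω, d ≤ ‖ζ - z‖ := fun ζ hζ => by
    by_contra hlt
    have h1 : ζ ∈ Ω := hball (by rw [Metric.mem_ball, dist_eq_norm]; exact not_le.1 hlt)
    rw [hΩo.frontier_eq] at hζ
    exact hζ.2 h1
  -- Where |x|² = 2 Re P(x), one has 2 Re φ(x) = |z|² - |x - z|². So Re φ would be larger at z than
  -- on the boundary, against the maximum principle for exp φ.
  let φ : ℂ → ℂ := fun x => (starRingEnd ℂ) z * x - P.eval x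
  have hφ : Differentiable ℂ φ := (differentiable_id.const_mul _).sub P.differentiable
  have key : ∀ x : ℂ, x * (starRingEnd ℂ) x = P.eval x + (starRingEnd ℂ) (P.eval x) →
      2 * (φ x).re = ‖z‖ ^ 2 - ‖x - z‖ ^ 2 := by
    intro x hx
    have h1 := congrArg Complex.re hx
    rw [Complex.mul_conj, Complex.ofReal_re, Complex.add_re, Complex.conj_re,
      Complex.normSq_apply] at h1
    rw [← Complex.normSq_eq_norm_sq, ← Complex.normSq_eq_norm_sq, Complex.normSq_apply,
      Complex.normSq_apply]
    simp only [φ, Complex.sub_re, Complex.mul_re, Complex.conj_re, Complex.conj_im, Complex.sub_im]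
    linarith
  have hmax := Complex.norm_le_of_forall_mem_frontier_norm_le (f := fun x => Complex.exp (φ x))
    (C := Real.exp ((‖z‖ ^ 2 - d ^ 2) / 2)) hΩ
    (Complex.differentiable_exp.comp hφ).diffContOnCl (fun ζ hζ => by
      rw [Complex.norm_exp]
      refine Real.exp_le_exp.2 ?_
      have h1 := key ζ (hP ζ hζ)
      have h2 := pow_le_pow_left₀ hd.le (hdist ζ hζ) 2
      linarith) (subset_closure hz)
  rw [Complex.norm_exp, Real.exp_le_exp] at hmax
  have h1 := key z heq
  rw [sub_self, norm_zero] at h1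
  nlinarith [pow_pos hd 2]

/-- Monodromy applied to germs of local primitives, which extend over balls after an additive
constant is adjusted. -/
lemma exists_primitive_of_isSimplyConnected {Ω : Set ℂ} (hΩo : IsOpen Ω)
    (hsc : IsSimplyConnected Ω) {F : ℂ → ℂ} (hF : DifferentiableOn ℂ F Ω) :
    ∃ G : ℂ → ℂ, ∀ z ∈ Ω, HasDerivAt G (F z) z := by
  obtain ⟨z₀, hz₀⟩ := hsc.nonempty
  have hloc : ∀ z ∈ Ω, ∃ r > 0, Metric.ball z r ⊆ Ω ∧
      ∃ G : ℂ → ℂ, ∀ y ∈ Metric.ball z r, HasDerivAt G (F y) y := fun z hz => by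
    obtain ⟨r, hr, hsub⟩ := Metric.isOpen_iff.1 hΩo z hz
    exact ⟨r, hr, hsub, (hF.mono hsub).isExactOn_ball⟩
  have han : ∀ z (g : ℂ → ℂ), (∀ᶠ y in 𝓝 z, HasDerivAt g (F y) y) → AnalyticAt ℂ g z :=
    fun z g h => Complex.analyticAt_iff_eventually_differentiableAt.2
      (h.mono fun y hy => hy.differentiableAt)
  obtain ⟨r₀, hr₀, -, g, hg⟩ := hloc z₀ hz₀
  have hg0 : ∀ᶠ y in 𝓝 z₀, HasDerivAt g (F y) y := by
    filter_upwards [Metric.ball_mem_nhds z₀ hr₀] with y hy using hg y hy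
  obtain ⟨G, hGd, hGg⟩ := exists_differentiableOn_of_forall_isGermFamily hΩo hsc hz₀ (g := g)
    fun γ hγ0 hγ => by
    obtain ⟨f, hf, hf0, -⟩ := IsGermFamily.exists_of_extension (γ := γ)
      (𝒢 := fun z g => ∀ᶠ y in 𝓝 z, HasDerivAt g (F y) y) han (fun t => by
        obtain ⟨r, hr, -, G, hG⟩ := hloc (γ t) (hγ t)
        refine ⟨r, hr, fun z hz k hk => ⟨fun y => G y + (k z - G z), ?_, fun y hy => ?_⟩⟩
        · obtain ⟨ε, hε, hball⟩ := Metric.eventually_nhds_iff_ball.1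
            (hk.and (Metric.isOpen_ball.mem_nhds hz))
          have h1 : ∀ y ∈ Metric.ball z ε, HasDerivAt (fun y => G y - k y) 0 y := fun y hy => by
            simpa using! (hG y (hball y hy).2).sub (hball y hy).1
          filter_upwards [Metric.ball_mem_nhds z hε] with y hy
          have h2 := Metric.isOpen_ball.is_const_of_deriv_eq_zero
            (convex_ball z ε).isPreconnected
            (fun y hy => (h1 y hy).differentiableAt.differentiableWithinAt)
            (fun y hy => (h1 y hy).deriv) hy (Metric.mem_ball_self hε)
          linear_combination h2
        · filter_upwards [Metric.isOpen_ball.mem_nhds hy] with x hx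
          exact (hG x hx).add_const _)
      (g := g) (by rw [hγ0]; exact hg0)
    exact ⟨f, hf, by rw [hf0]⟩
  refine ⟨G, ?_⟩
  have heq : EqOn (deriv G) F Ω := by
    refine (hGd.deriv hΩo |>.analyticOnNhd hΩo).eqOn_of_preconnected_of_eventuallyEq
      (hF.analyticOnNhd hΩo) hsc.isPathConnected.isConnected.isPreconnected hz₀ ?_
    filter_upwards [hGg.deriv, hg0] with y h1 h2
    rw [h1, h2.deriv]
  intro z hz
  have := (hGd.differentiableAt (hΩo.mem_nhds hz)).hasDerivAt
  rwa [heq hz] at this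

/-- If the germs of `S` continue along all curves that start on the boundary and then run in `Ω`,
then near the boundary `S` extends to a holomorphic function on `Ω`, locally. -/
lemma exists_extension_of_forall_continuation {Ω : Set ℂ} (hΩo : IsOpen Ω)
    (hsc : IsSimplyConnected Ω) {S : ℂ → ℂ}
    (hcont : ∀ γ : C(unitInterval, ℂ), γ 0 ∈ frontier Ω → (∀ t, t ≠ 0 → γ t ∈ Ω) →
      ∃ f : unitInterval → ℂ → ℂ, IsAnalyticContinuationAlong S γ f)
    {ζ₀ z : ℂ} {r : ℝ} (hζ₀ : ζ₀ ∈ frontier Ω) (hS : AnalyticOnNhd ℂ S (Metric.ball ζ₀ r))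
    (hz : z ∈ Ω) (hzr : z ∈ Metric.ball ζ₀ r) :
    ∃ F : ℂ → ℂ, DifferentiableOn ℂ F Ω ∧ F =ᶠ[𝓝 z] S := by
  have hr : 0 < r := Metric.pos_of_mem_ball hzr
  -- The segment from ζ₀ to z may leave Ω; ζ is its last boundary point, after which it stays in Ω.
  obtain ⟨ζ, hζ, hζr, hseg⟩ : ∃ ζ ∈ frontier Ω, ζ ∈ Metric.ball ζ₀ r ∧
      ∀ s : ℝ, 0 < s → s ≤ 1 → AffineMap.lineMap ζ z s ∈ Ω := by
    have hσc : Continuous fun s : ℝ => AffineMap.lineMap (k := ℝ) ζ₀ z s := by fun_prop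
    obtain ⟨t₁, ⟨ht₁, hm₁⟩, hmax⟩ := (isCompact_Icc (a := (0:ℝ)) (b := 1)).inter_right
      (isClosed_frontier.preimage hσc) |>.exists_isGreatest
      ⟨0, by simp, by simpa using hζ₀⟩
    have hz' : z ∉ frontier Ω := fun h => by
      rw [hΩo.frontier_eq] at h; exact h.2 hz
    have ht₁1 : t₁ < 1 := lt_of_le_of_ne ht₁.2 (by
      rintro rfl
      exact hz' (by simpa using hm₁))
    have hsub : (fun s : ℝ => AffineMap.lineMap (k := ℝ) ζ₀ z s) '' Ioc t₁ 1 ⊆ Ω := by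
      refine (isPreconnected_Ioc.image _ hσc.continuousOn).subset_of_disjoint_frontier hΩo ?_
        ⟨z, ⟨1, ⟨ht₁1, le_rfl⟩, by simp⟩, hz⟩
      rw [disjoint_left]
      rintro _ ⟨s, hs, rfl⟩ hsf
      exact hs.1.not_ge (hmax ⟨⟨ht₁.1.trans hs.1.le, hs.2⟩, hsf⟩)
    refine ⟨AffineMap.lineMap ζ₀ z t₁, hm₁, ?_, fun s hs0 hs1 => hsub ⟨t₁ + s * (1 - t₁), ?_, ?_⟩⟩
    · exact (convex_ball ζ₀ r).lineMap_mem (Metric.mem_ball_self hr) hzr ht₁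
    · constructor <;> nlinarith
    · simp only [AffineMap.lineMap_apply_module]
      module
  refine exists_differentiableOn_of_forall_isGermFamily hΩo hsc hz fun γ hγ0 hγ => ?_
  let ψ : C(unitInterval, unitInterval) := ⟨fun t => projIcc 0 1 zero_le_one (2 * t - 1),
    continuous_projIcc.comp (by fun_prop)⟩
  -- First the segment from ζ to z, on which the continuation agrees with S, then γ at double speed.
  let γ' : C(unitInterval, ℂ) := ⟨fun t => γ (ψ t) + ((1 - min (2 * (t:ℝ)) 1 : ℝ) : ℂ) * (ζ - z),
    by fun_prop⟩
  have hψ0 : ∀ t : unitInterval, 2 * (t : ℝ) ≤ 1 → ψ t = 0 := fun t ht =>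
    projIcc_of_le_left zero_le_one (by linarith)
  have hle : ∀ t : unitInterval, 2 * (t : ℝ) ≤ 1 →
      γ' t = AffineMap.lineMap ζ z (2 * (t : ℝ)) := fun t ht => by
    simp only [γ', ContinuousMap.coe_mk, hψ0 t ht, hγ0, min_eq_left ht,
      AffineMap.lineMap_apply_module, Complex.real_smul]
    push_cast
    ring
  have hge : ∀ t : unitInterval, 1 ≤ 2 * (t : ℝ) → γ' t = γ (ψ t) := fun t ht => by
    simp [γ', min_eq_right ht]
  have h0 : γ' 0 = ζ := by rw [hle 0 (by simp)]; simp
  obtain ⟨f, hf⟩ := hcont γ' (by rw [h0]; exact hζ) fun t ht => by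
    rcases le_or_gt (2 * (t : ℝ)) 1 with h | h
    · rw [hle t h]
      have ht' : (0:ℝ) < t := unitInterval.pos_iff_ne_zero.2 ht
      exact hseg _ (by linarith) h
    · rw [hge t h.le]; exact hγ _
  let φ₁ : C(unitInterval, unitInterval) := ⟨fun t => ⟨(t : ℝ) / 2, by
    constructor <;> linarith [t.2.1, t.2.2]⟩, by fun_prop⟩
  let φ₂ : C(unitInterval, unitInterval) := ⟨fun t => ⟨(1 + (t : ℝ)) / 2, by
    constructor <;> linarith [t.2.1, t.2.2]⟩, by fun_prop⟩
  have hφ12 : φ₁ 1 = φ₂ 0 := Subtype.ext (by simp [φ₁, φ₂])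
  have hφ1 : ∀ t, γ' (φ₁ t) = AffineMap.lineMap ζ z (t : ℝ) := fun t => by
    have : 2 * (φ₁ t : ℝ) = t := by simp only [φ₁, ContinuousMap.coe_mk]; ring
    rw [hle _ (by rw [this]; exact t.2.2), this]
  have hφ2 : ∀ t, γ' (φ₂ t) = γ t := fun t => by
    have h1 : 2 * (φ₂ t : ℝ) - 1 = t := by simp only [φ₂, ContinuousMap.coe_mk]; ring
    rw [hge _ (by linarith [t.2.1])]
    congr 1
    simp only [ψ, ContinuousMap.coe_mk, h1]
    exact projIcc_val zero_le_one t
  have hfam := hf.isGermFamily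
  have hcomp2 : γ'.comp φ₂ = γ := by ext t; exact hφ2 t
  have hfam2 := hfam.comp φ₂
  rw [hcomp2] at hfam2
  refine ⟨f ∘ φ₂, hfam2, ?_⟩
  have h1 := (hfam.comp φ₁).unique (IsGermFamily.const (S := S) fun t => by
    rw [ContinuousMap.comp_apply, hφ1]
    exact hS _ ((convex_ball ζ₀ r).lineMap_mem hζr hzr t.2)) (t₀ := 0) (by
      have : φ₁ 0 = 0 := Subtype.ext (by simp [φ₁])
      rw [ContinuousMap.comp_apply, Function.comp, this]
      exact hf.2.1) 1
  rw [ContinuousMap.comp_apply, hφ1] at h1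
  simpa [hφ12] using! h1

/-! ### Green's formula through cutoff functions. -/

lemma integrable_mul_of_continuousOn {U : Set ℂ} (hU : IsOpen U) {h k : ℂ → ℂ}
    (hh : ContinuousOn h U) (hk : Continuous k) (hkc : HasCompactSupport k)
    (hkU : tsupport k ⊆ U) : Integrable fun z => h z * k z := by
  refine Continuous.integrable_of_hasCompactSupport ?_ hkc.mul_left
  refine continuous_iff_continuousAt.2 fun x => ?_
  by_cases hx : x ∈ tsupport k
  · exact (hh.continuousAt (hU.mem_nhds (hkU hx))).mul hk.continuousAt
  · have : (fun z => h z * k z) =ᶠ[𝓝 x] fun _ => 0 := by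
      filter_upwards [notMem_tsupport_iff_eventuallyEq.1 hx] with z hz
      rw [hz]; simp
    exact continuousAt_const.congr this.symm

/-- Twice the `∂/∂(conj z)` derivative. -/
noncomputable def dbar (M : ℂ → ℂ) (z : ℂ) : ℂ := fderiv ℝ M z 1 + Complex.I * fderiv ℝ M z Complex.I

/-- Integration by parts, with `dbar` of conj z equal to 2; this replaces ∫_Γ conj z dz = 2i
area(Ω). -/
lemma integral_conj_mul_dbar {M : ℂ → ℂ} (hM : ContDiff ℝ 2 M) (hMc : HasCompactSupport M) :
    ∫ z, (starRingEnd ℂ) z * dbar M z = -2 * ∫ z, M z := by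
  have hconj : ∀ z v : ℂ, fderiv ℝ (fun z => (starRingEnd ℂ) z) z v = (starRingEnd ℂ) v :=
    fun z v => by
      have : HasFDerivAt (fun z => (starRingEnd ℂ) z) (Complex.conjCLE : ℂ →L[ℝ] ℂ) z :=
        Complex.conjCLE.hasFDerivAt
      rw [this.fderiv]; rfl
  have hMd : Continuous (fderiv ℝ M) := hM.continuous_fderiv (by norm_num)
  have hint : ∀ v : ℂ, Integrable fun z => (starRingEnd ℂ) z * fderiv ℝ M z v := fun v =>
    integrable_mul_of_continuousOn isOpen_univ Complex.continuous_conj.continuousOn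
      (hMd.clm_apply continuous_const) ((hMc.fderiv_apply ℝ v)) (subset_univ _)
  have key : ∀ v : ℂ, ∫ z, (starRingEnd ℂ) z * fderiv ℝ M z v =
      -((starRingEnd ℂ) v * ∫ z, M z) := fun v => by
    rw [integral_mul_fderiv_eq_neg_fderiv_mul_of_integrable]
    · simp_rw [hconj, integral_const_mul]
    · simp_rw [hconj]
      exact (hM.continuous.integrable_of_hasCompactSupport hMc).const_mul _
    · exact hint v
    · exact integrable_mul_of_continuousOn isOpen_univ Complex.continuous_conj.continuousOn
        hM.continuous hMc (subset_univ _)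
    · exact fun x _ => Complex.conjCLE.differentiableAt
    · exact fun x _ => hM.differentiable (by norm_num) x
  have : ∀ z, (starRingEnd ℂ) z * dbar M z = (starRingEnd ℂ) z * fderiv ℝ M z 1 +
      Complex.I * ((starRingEnd ℂ) z * fderiv ℝ M z Complex.I) := fun z => by
    rw [dbar]; ring
  simp_rw [this]
  rw [integral_add (hint 1) ((hint Complex.I).const_mul _), integral_const_mul, key, key]
  simp only [map_one, Complex.conj_I]
  linear_combination (∫ z, M z) * Complex.I_mul_I

/-- Only the derivative of M is supported in U, so holomorphy of S alone would not suffice. The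
primitive G allows a second integration by parts, after which the two terms cancel by symmetry of
the second derivatives of M; this replaces ∫_Γ S dz = 0. -/
lemma integral_mul_dbar_eq_zero {U : Set ℂ} (hU : IsOpen U) {G S M : ℂ → ℂ}
    (hG : ∀ z ∈ U, HasDerivAt G (S z) z) (hM : ContDiff ℝ 2 M) (hMc : HasCompactSupport M)
    (hMU : tsupport (fderiv ℝ M) ⊆ U) : ∫ z, S z * dbar M z = 0 := by
  have hGd : DifferentiableOn ℂ G U := fun z hz =>
    (hG z hz).differentiableAt.differentiableWithinAt
  have hS : ContinuousOn S U := ((hGd.deriv hU).congr fun z hz => (hG z hz).deriv.symm).continuousOn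
  have hMd : ContDiff ℝ 1 (fderiv ℝ M) := hM.fderiv_right (by norm_num)
  have hMv : ∀ v : ℂ, ContDiff ℝ 1 fun z => fderiv ℝ M z v := fun v => hMd.clm_apply contDiff_const
  have hMvc : ∀ v : ℂ, HasCompactSupport fun z => fderiv ℝ M z v := fun v => hMc.fderiv_apply ℝ v
  have hMvU : ∀ v : ℂ, tsupport (fun z => fderiv ℝ M z v) ⊆ U := fun v => by
    refine subset_trans (closure_mono fun z hz => ?_) hMU
    rw [Function.mem_support] at hz ⊢
    intro h0
    rw [h0] at hz
    exact hz rfl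
  have hGfd : ∀ z ∈ U, ∀ v, fderiv ℝ G z v = S z * v := fun z hz v => by
    rw [((hG z hz).complexToReal_fderiv).fderiv]
    simp
  have hGv : ∀ u v z, fderiv ℝ G z u * fderiv ℝ M z v = u * (S z * fderiv ℝ M z v) := by
    intro u v z
    by_cases hz : z ∈ U
    · rw [hGfd z hz]; ring
    · have : fderiv ℝ M z v = 0 :=
        image_eq_zero_of_notMem_tsupport (f := fun z => fderiv ℝ M z v) fun h => hz (hMvU v h)
      rw [this]; ring
  have hint : ∀ v : ℂ, Integrable fun z => S z * fderiv ℝ M z v := fun v =>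
    integrable_mul_of_continuousOn hU hS (hMv v).continuous (hMvc v) (hMvU v)
  have key : ∀ u v : ℂ, ∫ z, G z * fderiv ℝ (fun z => fderiv ℝ M z v) z u =
      -(u * ∫ z, S z * fderiv ℝ M z v) := fun u v => by
    rw [integral_mul_fderiv_eq_neg_fderiv_mul_of_integrable]
    · simp_rw [hGv, integral_const_mul]
    · simp_rw [hGv]
      exact (hint v).const_mul _
    · refine integrable_mul_of_continuousOn hU hGd.continuousOn
        (((hMv v).continuous_fderiv one_ne_zero).clm_apply continuous_const)
        ((hMvc v).fderiv_apply ℝ u) (subset_trans ?_ (hMvU v))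
      exact tsupport_fderiv_apply_subset ℝ u
    · exact integrable_mul_of_continuousOn hU hGd.continuousOn (hMv v).continuous (hMvc v) (hMvU v)
    · intro x hx
      exact (hG x (hMvU v hx)).differentiableAt.restrictScalars ℝ
    · exact fun x _ => (hMv v).differentiable one_ne_zero x
  have hsymm : ∀ z, fderiv ℝ (fun z => fderiv ℝ M z Complex.I) z 1 =
      fderiv ℝ (fun z => fderiv ℝ M z 1) z Complex.I := fun z => by
    have h1 : IsSymmSndFDerivAt ℝ M z := hM.contDiffAt.isSymmSndFDerivAt (by simp)
    have h2 : ∀ u v : ℂ, fderiv ℝ (fun z => fderiv ℝ M z v) z u =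
        fderiv ℝ (fderiv ℝ M) z u v := fun u v => by
      rw [fderiv_clm_apply (hMd.differentiable one_ne_zero z) (differentiableAt_const v)]
      simp
    rw [h2, h2]
    exact h1 1 Complex.I
  have e1 := key 1 Complex.I
  simp_rw [hsymm] at e1
  rw [key] at e1
  have : ∀ z, S z * dbar M z = S z * fderiv ℝ M z 1 +
      Complex.I * (S z * fderiv ℝ M z Complex.I) := fun z => by
    rw [dbar]; ring
  simp_rw [this]
  rw [integral_add (hint 1) ((hint Complex.I).const_mul _), integral_const_mul]
  linear_combination Complex.I * e1 + (∫ z, S z * fderiv ℝ M z 1) * Complex.I_mul_I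

/-- Smooth cutoff functions at scale `δ`. -/
lemma exists_cutoff : ∃ C : ℝ, ∀ δ : ℝ, 0 < δ → ∃ T : ℂ → ℂ, ContDiff ℝ 2 T ∧
    (∀ w, ‖w‖ ≤ δ → T w = 0) ∧ (∀ w, 2 * δ ≤ ‖w‖ → T w = 1) ∧ (∀ w, ‖T w‖ ≤ 1) ∧
    ∀ w, ‖w‖ * ‖fderiv ℝ T w‖ ≤ C := by
  let b : ContDiffBump (0:ℂ) := ⟨1, 2, one_pos, one_lt_two⟩
  let Θ : ℂ → ℂ := fun w => ((1 - b w : ℝ) : ℂ)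
  have hb : ContDiff ℝ 2 b := b.contDiff
  have hΘ : ContDiff ℝ 2 Θ := Complex.ofRealCLM.contDiff.comp (contDiff_const.sub hb)
  have hΘ0 : ∀ w, ‖w‖ ≤ 1 → Θ w = 0 := fun w hw => by
    simp [Θ, b.one_of_mem_closedBall (x := w) (by simpa using hw)]
  have hΘ1 : ∀ w, 2 ≤ ‖w‖ → Θ w = 1 := fun w hw => by
    simp [Θ, b.zero_of_le_dist (x := w) (by simpa using hw)]
  have hΘd : Continuous (fderiv ℝ Θ) := hΘ.continuous_fderiv (by norm_num)
  obtain ⟨C, hC⟩ := ((isCompact_closedBall (0:ℂ) 2).image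
    (continuous_norm.mul hΘd.norm)).isBounded.exists_norm_le
  have hC' : ∀ w, ‖w‖ * ‖fderiv ℝ Θ w‖ ≤ C := fun w => by
    by_cases hw : ‖w‖ ≤ 2
    · exact (le_abs_self _).trans (hC _ ⟨w, by simpa using hw, rfl⟩)
    · have h1 : Θ =ᶠ[𝓝 w] fun _ => 1 := by
        filter_upwards [(isOpen_lt continuous_const continuous_norm).mem_nhds
          (show w ∈ {w : ℂ | 2 < ‖w‖} from not_le.1 hw)] with y hy using hΘ1 y hy.le
      rw [h1.fderiv_eq]
      simp only [fderiv_fun_const, Pi.zero_apply, norm_zero, mul_zero]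
      exact (norm_nonneg _).trans (hC _ ⟨0, by simp, rfl⟩)
  -- Rescaling by 1/δ leaves |w| · |DΘ(w)| invariant, so C does not depend on δ.
  refine ⟨C, fun δ hδ => ⟨fun w => Θ ((δ⁻¹ : ℝ) • w), hΘ.comp (contDiff_const_smul _), ?_, ?_, ?_, ?_⟩⟩
  · intro w hw
    refine hΘ0 _ ?_
    rw [norm_smul, Real.norm_of_nonneg (inv_nonneg.2 hδ.le), inv_mul_le_iff₀ hδ]
    linarith
  · intro w hw
    refine hΘ1 _ ?_
    rw [norm_smul, Real.norm_of_nonneg (inv_nonneg.2 hδ.le), le_inv_mul_iff₀ hδ]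
    linarith
  · intro w
    have h1 := b.nonneg (x := (δ⁻¹ : ℝ) • w)
    have h2 := b.le_one (x := (δ⁻¹ : ℝ) • w)
    rw [Complex.norm_real, Real.norm_eq_abs, abs_le]
    constructor <;> linarith
  · intro w
    have h1 : fderiv ℝ (fun w => Θ ((δ⁻¹ : ℝ) • w)) w = (δ⁻¹ : ℝ) • fderiv ℝ Θ ((δ⁻¹ : ℝ) • w) := by
      rw [fderiv_comp_smul]
    rw [h1, norm_smul]
    have := hC' ((δ⁻¹ : ℝ) • w)
    rw [norm_smul] at this
    calc _ = ‖δ⁻¹‖ * ‖w‖ * ‖fderiv ℝ Θ ((δ⁻¹ : ℝ) • w)‖ := by ring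
      _ ≤ C := this

lemma tsupport_dbar_subset (M : ℂ → ℂ) : tsupport (dbar M) ⊆ tsupport (fderiv ℝ M) := by
  refine closure_mono fun z hz => ?_
  rw [Function.mem_support] at hz ⊢
  intro h0
  rw [dbar, h0] at hz
  simp at hz

lemma norm_dbar_le (M : ℂ → ℂ) (z : ℂ) : ‖dbar M z‖ ≤ 2 * ‖fderiv ℝ M z‖ := by
  have h1 := (fderiv ℝ M z).le_opNorm 1
  have h2 := (fderiv ℝ M z).le_opNorm Complex.I
  rw [norm_one, mul_one] at h1
  rw [Complex.norm_I, mul_one] at h2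
  refine (norm_add_le _ _).trans ?_
  rw [norm_mul, Complex.norm_I, one_mul]
  linarith

/-- Cutoff functions of the domain that depend, near the boundary, on a defining function `W`
only. -/
lemma exists_domain_cutoff {Ω V : Set ℂ} (hΩo : IsOpen Ω) (hΩ : Bornology.IsBounded Ω)
    (hV : IsOpen V) (hΓV : frontier Ω ⊆ V) {W : ℂ → ℂ} (hW : ContDiffOn ℝ 2 W V)
    (hW0 : ∀ z ∈ frontier Ω, W z = 0) (hWne : ∀ z ∈ V ∩ Ω, W z ≠ 0) :
    ∃ δ₀ > 0, ∃ C : ℝ, ∀ δ > 0, 2 * δ < δ₀ → ∃ M : ℂ → ℂ, ContDiff ℝ 2 M ∧ HasCompactSupport M ∧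
      tsupport (fderiv ℝ M) ⊆ V ∩ Ω ∧ (∀ z, ‖M z‖ ≤ 1) ∧ (∀ z ∉ Ω, M =ᶠ[𝓝 z] 0) ∧
      (∀ z ∈ Ω, (z ∉ V ∨ 2 * δ < ‖W z‖) → M =ᶠ[𝓝 z] 1) ∧
      ∀ z ∈ Ω, ‖W z‖ * ‖fderiv ℝ M z‖ ≤ C := by
  have hΓc : IsCompact (frontier Ω) :=
    hΩ.isCompact_closure.of_isClosed_subset isClosed_frontier frontier_subset_closure
  obtain ⟨ε, hε, hεV⟩ := hΓc.exists_cthickening_subset_open hV hΓV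
  set K := Metric.cthickening ε (frontier Ω) with hK
  set V₁ := Metric.thickening ε (frontier Ω) with hV₁
  have hKc : IsCompact K := hΓc.cthickening
  have hV₁o : IsOpen V₁ := Metric.isOpen_thickening
  have hV₁K : V₁ ⊆ K := Metric.thickening_subset_cthickening _ _
  have hΓV₁ : frontier Ω ⊆ V₁ := Metric.self_subset_thickening hε _
  have hWc : ContinuousOn W V := hW.continuousOn
  obtain ⟨B, hB⟩ := (hKc.image_of_continuousOn
    ((hW.continuousOn_fderiv_of_isOpen hV (by norm_num)).mono hεV)).isBounded.exists_norm_le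
  -- A lower bound for |W| on the part of K outside V₁ in the closure of Ω. For 2δ < δ₀ the cutoff
  -- T(W) is already 1 there, so it fits the constant 1 used in Ω outside V₁.
  obtain ⟨δ₀, hδ₀, hδ₀W⟩ : ∃ δ₀ > 0, ∀ z ∈ (K \ V₁) ∩ closure Ω, δ₀ ≤ ‖W z‖ := by
    refine IsCompact.exists_forall_le' (f := fun z => ‖W z‖)
      ((hKc.diff hV₁o).inter_right isClosed_closure)
      ((hWc.mono fun z hz => hεV hz.1.1).norm) fun z hz => ?_
    refine norm_pos_iff.2 (hWne z ⟨hεV hz.1.1, ?_⟩)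
    by_contra hzΩ
    refine hz.1.2 (hΓV₁ ?_)
    rw [hΩo.frontier_eq]
    exact ⟨hz.2, hzΩ⟩
  obtain ⟨C, hC⟩ := exists_cutoff
  have hC0 : 0 ≤ C := by
    obtain ⟨T, -, -, -, -, h⟩ := hC 1 one_pos
    exact (by positivity : (0:ℝ) ≤ _).trans (h 0)
  refine ⟨δ₀, hδ₀, C * |B|, fun δ hδ hδδ₀ => ?_⟩
  obtain ⟨T, hT, hT0, hT1, hTn, hTd⟩ := hC δ hδ
  classical
  let M : ℂ → ℂ := fun z => if z ∈ Ω then (if z ∈ V₁ then T (W z) else 1) else 0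
  have hA : ∀ z ∈ Ω ∩ V₁, M =ᶠ[𝓝 z] fun y => T (W y) := fun z hz => by
    filter_upwards [(hΩo.inter hV₁o).mem_nhds hz] with y hy
    simp [M, hy.1, hy.2]
  have hWev : ∀ z ∈ V, ∀ c, c < ‖W z‖ → ∀ᶠ y in 𝓝 z, c < ‖W y‖ := fun z hz c hc =>
    (hWc.continuousAt (hV.mem_nhds hz)).norm.eventually_const_lt hc
  have hB1 : ∀ z ∈ Ω, z ∉ V₁ → M =ᶠ[𝓝 z] 1 := fun z hz hzV => by
    by_cases hzK : z ∈ K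
    · have h1 := hδ₀W z ⟨⟨hzK, hzV⟩, subset_closure hz⟩
      filter_upwards [hWev z (hεV hzK) (2 * δ) (by linarith), hΩo.mem_nhds hz] with y hy hyΩ
      by_cases h : y ∈ V₁
      · simp [M, hyΩ, h, hT1 _ hy.le]
      · simp [M, hyΩ, h]
    · filter_upwards [hKc.isClosed.isOpen_compl.mem_nhds hzK, hΩo.mem_nhds hz] with y hy hyΩ
      have : y ∉ V₁ := fun h => hy (hV₁K h)
      simp [M, hyΩ, this]
  have hB2 : ∀ z ∈ Ω, (z ∉ V ∨ 2 * δ < ‖W z‖) → M =ᶠ[𝓝 z] 1 := fun z hz h => by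
    by_cases hzV : z ∈ V₁
    · have h' := h.resolve_left fun h => h (hεV (hV₁K hzV))
      filter_upwards [hA z ⟨hz, hzV⟩, hWev z (hεV (hV₁K hzV)) _ h'] with y h1 h2
      rw [h1, hT1 _ h2.le]; rfl
    · exact hB1 z hz hzV
  have hC' : ∀ z ∉ Ω, M =ᶠ[𝓝 z] 0 := fun z hz => by
    by_cases hzc : z ∈ closure Ω
    · have hzΓ : z ∈ frontier Ω := by rw [hΩo.frontier_eq]; exact ⟨hzc, hz⟩
      have h1 : ∀ᶠ y in 𝓝 z, ‖W y‖ < δ :=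
        (hWc.continuousAt (hV.mem_nhds (hΓV hzΓ))).norm.eventually_lt_const
          (by simpa [hW0 z hzΓ] using hδ)
      filter_upwards [h1, hV₁o.mem_nhds (hΓV₁ hzΓ)] with y hy hyV
      simp [M, hyV, hT0 _ hy.le]
    · filter_upwards [isClosed_closure.isOpen_compl.mem_nhds hzc] with y hy
      have : y ∉ Ω := fun h => hy (subset_closure h)
      simp [M, this]
  have hWat : ∀ z ∈ V, ContDiffAt ℝ 2 W z := fun z hz => hW.contDiffAt (hV.mem_nhds hz)
  refine ⟨M, ?_, ?_, ?_, ?_, hC', hB2, ?_⟩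
  · refine contDiff_iff_contDiffAt.2 fun z => ?_
    by_cases hz : z ∈ Ω
    · by_cases hzV : z ∈ V₁
      · exact ((hT.contDiffAt (x := W z)).comp z (hWat z (hεV (hV₁K hzV)))).congr_of_eventuallyEq
          (hA z ⟨hz, hzV⟩)
      · exact (contDiffAt_const (c := (1:ℂ))).congr_of_eventuallyEq (hB1 z hz hzV)
    · exact (contDiffAt_const (c := (0:ℂ))).congr_of_eventuallyEq (hC' z hz)
  · refine HasCompactSupport.intro hΩ.isCompact_closure fun z hz => ?_
    have : z ∉ Ω := fun h => hz (subset_closure h)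
    simp [M, this]
  · intro z hz
    by_contra hnot
    have hc : ∃ c : ℂ, M =ᶠ[𝓝 z] fun _ => c := by
      by_cases hzΩ : z ∈ Ω
      · exact ⟨1, hB2 z hzΩ (Or.inl fun h => hnot ⟨h, hzΩ⟩)⟩
      · exact ⟨0, hC' z hzΩ⟩
    obtain ⟨c, hc⟩ := hc
    refine notMem_tsupport_iff_eventuallyEq.2 ?_ hz
    filter_upwards [hc.fderiv (𝕜 := ℝ)] with y hy
    rw [hy]; simp
  · intro z
    simp only [M]
    split_ifs
    · exact hTn _
    · simp
    · simp
  · intro z hz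
    by_cases hzV : z ∈ V₁
    · have hzV' := hεV (hV₁K hzV)
      have h1 : HasFDerivAt M ((fderiv ℝ T (W z)).comp (fderiv ℝ W z)) z :=
        (((hT.differentiable (by norm_num) (W z)).hasFDerivAt.comp z
          ((hWat z hzV').differentiableAt (by norm_num)).hasFDerivAt)).congr_of_eventuallyEq
          (hA z ⟨hz, hzV⟩)
      rw [h1.fderiv]
      calc _ ≤ ‖W z‖ * (‖fderiv ℝ T (W z)‖ * ‖fderiv ℝ W z‖) := by
            gcongr; exact ContinuousLinearMap.opNorm_comp_le _ _
        _ = (‖W z‖ * ‖fderiv ℝ T (W z)‖) * ‖fderiv ℝ W z‖ := by ring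
        _ ≤ C * |B| := by
            gcongr
            · exact hTd _
            · exact (hB _ ⟨z, hV₁K hzV, rfl⟩).trans (le_abs_self _)
    · rw [(hB1 z hz hzV).fderiv_eq]
      simp only [Pi.one_def, fderiv_fun_const, Pi.zero_apply, norm_zero, mul_zero]
      positivity

/-- Green's formula for a domain with boundary in the zero set of `conj z - S z`: if `S` has a
primitive near the boundary, then the domain has area zero. -/
lemma not_exists_primitive_schwarz {Ω V : Set ℂ} (hΩo : IsOpen Ω) (hΩ : Bornology.IsBounded Ω)
    (hne : Ω.Nonempty) (hV : IsOpen V) (hΓV : frontier Ω ⊆ V) {S G : ℂ → ℂ}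
    (hS : DifferentiableOn ℂ S V) (hS0 : ∀ z ∈ frontier Ω, S z = (starRingEnd ℂ) z)
    (hSne : ∀ z ∈ V ∩ Ω, S z ≠ (starRingEnd ℂ) z) (hG : ∀ z ∈ V ∩ Ω, HasDerivAt G (S z) z) :
    False := by
  let W : ℂ → ℂ := fun z => (starRingEnd ℂ) z - S z
  have hW : ContDiffOn ℝ 2 W V := by
    refine (Complex.conjCLE.contDiff.contDiffOn).sub ?_
    exact fun z hz => (((hS.analyticOnNhd hV) z hz).contDiffAt (n := 2)).restrict_scalars ℝ
      |>.contDiffWithinAt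
  obtain ⟨δ₀, hδ₀, C, hM⟩ := exists_domain_cutoff hΩo hΩ hV hΓV hW
    (fun z hz => by simp [W, hS0 z hz])
    (fun z hz => sub_ne_zero.2 (hSne z hz).symm)
  let δ : ℕ → ℝ := fun n => δ₀ / 2 / (n + 2)
  have hδ : ∀ n, 0 < δ n := fun n => by positivity
  have hδ' : ∀ n, 2 * δ n < δ₀ := fun n => by
    have : (1:ℝ) < (n:ℝ) + 2 := by
      have : (0:ℝ) ≤ n := n.cast_nonneg
      linarith
    have h2 := div_lt_self hδ₀ this
    calc 2 * δ n = δ₀ / ((n:ℝ) + 2) := by simp only [δ]; ring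
      _ < δ₀ := h2
  have hδ0 : Tendsto (fun n => 2 * δ n) atTop (𝓝 0) := by
    have h1 : Tendsto (fun n : ℕ => (n:ℝ) + 2) atTop atTop :=
      tendsto_atTop_add_const_right _ _ tendsto_natCast_atTop_atTop
    have := (tendsto_const_nhds (x := δ₀ / 2)).div_atTop h1
    simpa using! this.const_mul 2
  choose M hMd hMc hMt hMn hM0 hM1 hMb using fun n => hM (δ n) (hδ n) (hδ' n)
  have hdc : ∀ n, Continuous (dbar (M n)) := fun n => by
    have h1 : Continuous (fderiv ℝ (M n)) := (hMd n).continuous_fderiv (by norm_num)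
    unfold dbar
    fun_prop
  have hdt : ∀ n, tsupport (dbar (M n)) ⊆ V ∩ Ω := fun n => (tsupport_dbar_subset _).trans (hMt n)
  have hds : ∀ n, HasCompactSupport (dbar (M n)) := fun n =>
    ((hMc n).fderiv ℝ).of_isClosed_subset (isClosed_tsupport _) (tsupport_dbar_subset _)
  have hVo : IsOpen (V ∩ Ω) := hV.inter hΩo
  have hic : ∀ n, Integrable fun z => (starRingEnd ℂ) z * dbar (M n) z := fun n =>
    integrable_mul_of_continuousOn hVo Complex.continuous_conj.continuousOn (hdc n) (hds n) (hdt n)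
  have hiS : ∀ n, Integrable fun z => S z * dbar (M n) z := fun n =>
    integrable_mul_of_continuousOn hVo (hS.continuousOn.mono inter_subset_left) (hdc n) (hds n)
      (hdt n)
  have hWM : ∀ n, (fun z => W z * dbar (M n) z) =
      fun z => (starRingEnd ℂ) z * dbar (M n) z - S z * dbar (M n) z := fun n => by
    ext z; simp only [W]; ring
  -- The left side tends to 0: W · `dbar` M is bounded by 2C, and vanishes at each point for large
  -- n. On the right M tends to the indicator of Ω, so the area would be 0.
  have heq : ∀ n, ∫ z, W z * dbar (M n) z = -2 * ∫ z, M n z := fun n => by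
    rw [hWM, integral_sub (hic n) (hiS n), integral_conj_mul_dbar (hMd n) (hMc n),
      integral_mul_dbar_eq_zero hVo hG (hMd n) (hMc n) (hMt n), sub_zero]
  have hfin : volume Ω ≠ ⊤ := hΩ.measure_lt_top.ne
  have hind : ∀ c : ℝ, Integrable (Ω.indicator fun _ => c) := fun c =>
    (integrable_indicator_iff hΩo.measurableSet).2 (integrableOn_const hfin)
  have hev : ∀ z ∈ Ω, ∀ᶠ n in atTop, M n =ᶠ[𝓝 z] 1 := fun z hz => by
    by_cases hzV : z ∈ V
    · have hpos : 0 < ‖W z‖ := norm_pos_iff.2 (sub_ne_zero.2 (hSne z ⟨hzV, hz⟩).symm)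
      filter_upwards [hδ0.eventually_lt_const hpos] with n hn using hM1 n z hz (Or.inr hn)
    · exact Eventually.of_forall fun n => hM1 n z hz (Or.inl hzV)
  have hdz : ∀ n z (c : ℂ), (M n =ᶠ[𝓝 z] fun _ => c) → dbar (M n) z = 0 := fun n z c h => by
    rw [dbar, h.fderiv_eq]; simp
  have lim1 : Tendsto (fun n => ∫ z, W z * dbar (M n) z) atTop (𝓝 (∫ _ : ℂ, (0:ℂ))) := by
    refine tendsto_integral_of_dominated_convergence (Ω.indicator fun _ => 2 * C)
      (fun n => ?_) (hind _) (fun n => Eventually.of_forall fun z => ?_)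
      (Eventually.of_forall fun z => ?_)
    · rw [hWM]; exact ((hic n).sub (hiS n)).aestronglyMeasurable
    · by_cases hz : z ∈ Ω
      · rw [indicator_of_mem hz, norm_mul]
        calc _ ≤ ‖W z‖ * (2 * ‖fderiv ℝ (M n) z‖) := by gcongr; exact norm_dbar_le _ _
          _ = 2 * (‖W z‖ * ‖fderiv ℝ (M n) z‖) := by ring
          _ ≤ 2 * C := by gcongr; exact hMb n z hz
      · rw [indicator_of_notMem hz, hdz n z 0 (hM0 n z hz)]; simp
    · refine tendsto_const_nhds.congr' ?_
      by_cases hz : z ∈ Ω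
      · filter_upwards [hev z hz] with n hn
        rw [hdz n z 1 hn, mul_zero]
      · exact Eventually.of_forall fun n => by simp [hdz n z 0 (hM0 n z hz)]
  have lim2 : Tendsto (fun n => ∫ z, M n z) atTop (𝓝 (∫ z, Ω.indicator (fun _ => (1:ℂ)) z)) := by
    refine tendsto_integral_of_dominated_convergence (Ω.indicator fun _ => (1:ℝ))
      (fun n => (hMd n).continuous.aestronglyMeasurable) (hind _)
      (fun n => Eventually.of_forall fun z => ?_) (Eventually.of_forall fun z => ?_)
    · by_cases hz : z ∈ Ω
      · rw [indicator_of_mem hz]; exact hMn n z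
      · rw [indicator_of_notMem hz, (hM0 n z hz).self_of_nhds]; simp
    · refine tendsto_const_nhds.congr' ?_
      by_cases hz : z ∈ Ω
      · filter_upwards [hev z hz] with n hn
        rw [indicator_of_mem hz, hn.self_of_nhds]; rfl
      · exact Eventually.of_forall fun n => by
          simp [indicator_of_notMem hz, (hM0 n z hz).self_of_nhds]
  simp_rw [heq] at lim1
  have h1 := tendsto_nhds_unique lim1 (lim2.const_mul _)
  rw [integral_indicator_const _ hΩo.measurableSet, integral_zero] at h1
  have h2 : (volume.real Ω : ℝ) = 0 := by simpa using h1
  have h3 : 0 < volume.real Ω :=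
    ENNReal.toReal_pos (hΩo.measure_pos volume hne).ne' hfin
  exact h3.ne' h2

/-! ### A Schwarz function has a singularity in the domain. -/

/-- A Schwarz function has a singularity in `Ω`. -/
lemma not_forall_isAnalyticContinuationAlong {Ω : Set ℂ} (hΩo : IsOpen Ω)
    (hΩ : Bornology.IsBounded Ω) (hsc : IsSimplyConnected Ω) {P : Polynomial ℂ}
    (hP : ∀ ζ ∈ frontier Ω, ζ * (starRingEnd ℂ) ζ = P.eval ζ + (starRingEnd ℂ) (P.eval ζ))
    {S : ℂ → ℂ} (hS : IsSchwarzFunction Ω S) :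
    ∃ γ : C(unitInterval, ℂ), γ 0 ∈ frontier Ω ∧ (∀ t, t ≠ 0 → γ t ∈ Ω) ∧
      ¬ ∃ f : unitInterval → ℂ → ℂ, IsAnalyticContinuationAlong S γ f := by
  by_contra! hcont
  let V : Set ℂ := {y | ∃ ζ ∈ frontier Ω, ∃ r : ℝ, y ∈ Metric.ball ζ r ∧
    ∀ x ∈ Metric.ball ζ r, AnalyticAt ℂ S x ∧ curveEq P (P.map (starRingEnd ℂ)) x (S x) = 0}
  have hV : IsOpen V := by
    refine isOpen_iff_mem_nhds.2 ?_
    rintro y ⟨ζ, hζ, r, hy, h⟩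
    filter_upwards [Metric.isOpen_ball.mem_nhds hy] with x hx using ⟨ζ, hζ, r, hx, h⟩
  have hΓV : frontier Ω ⊆ V := fun ζ hζ => by
    have hgerm : IsSchwarzGermAt Ω S ζ := ⟨hζ, hS.1 ζ hζ, by
      filter_upwards [self_mem_nhdsWithin] with z hz using hS.2 z hz⟩
    obtain ⟨r, hr, h⟩ := Metric.eventually_nhds_iff_ball.1
      (hgerm.2.1.eventually_analyticAt.and (hgerm.curveEq_eq_zero hΩo hsc hP))
    exact ⟨ζ, hζ, r, Metric.mem_ball_self hr, h⟩
  have hVS : DifferentiableOn ℂ S V := by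
    rintro y ⟨ζ, -, r, hy, h⟩
    exact (h y hy).1.differentiableAt.differentiableWithinAt
  have hne : ∀ z ∈ V ∩ Ω, S z ≠ (starRingEnd ℂ) z := by
    rintro z ⟨⟨ζ, -, r, hz, h⟩, hzΩ⟩ heq
    have h1 := (h z hz).2
    rw [heq, curveEq, eval_map_conj] at h1
    exact mul_conj_ne_of_mem hΩo hΩ hP hzΩ (by linear_combination h1)
  -- The extension may depend on the part of V ∩ Ω that contains z. Setting it to 0 off Ω makes
  -- extensions that agree on Ω equal as functions, so z ↦ F z is locally constant and the chosen
  -- primitives fit together locally.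
  have hF : ∀ z ∈ V ∩ Ω, ∃ F : ℂ → ℂ, DifferentiableOn ℂ F Ω ∧ F =ᶠ[𝓝 z] S ∧ ∀ x ∉ Ω, F x = 0 := by
    rintro z ⟨⟨ζ, hζ, r, hz, h⟩, hzΩ⟩
    obtain ⟨F, hF, hFS⟩ := exists_extension_of_forall_continuation hΩo hsc hcont hζ
      (fun x hx => (h x hx).1) hzΩ hz
    refine ⟨Ω.indicator F, hF.congr fun x hx => indicator_of_mem hx F, ?_,
      fun x hx => indicator_of_notMem hx F⟩
    filter_upwards [hFS, hΩo.mem_nhds hzΩ] with x hx hxΩ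
    rw [indicator_of_mem hxΩ, hx]
  choose! F hFd hFS hF0 using hF
  have hprim : ∀ H : ℂ → ℂ, ∃ G : ℂ → ℂ, DifferentiableOn ℂ H Ω → ∀ z ∈ Ω, HasDerivAt G (H z) z :=
    fun H => by
      by_cases hH : DifferentiableOn ℂ H Ω
      · obtain ⟨G, hG⟩ := exists_primitive_of_isSimplyConnected hΩo hsc hH
        exact ⟨G, fun _ => hG⟩
      · exact ⟨0, fun h => absurd h hH⟩
  choose prim hprim using hprim
  refine not_exists_primitive_schwarz hΩo hΩ hsc.nonempty hV hΓV hVS hS.2 hne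
    (G := fun z => prim (F z) z) fun z hz => ?_
  have hloc : ∀ᶠ y in 𝓝 z, F y = F z := by
    filter_upwards [(hFS z hz).eventually_nhds, (hV.inter hΩo).mem_nhds hz] with y hy hyV
    have h1 : F y =ᶠ[𝓝 y] F z := (hFS y hyV).trans (EventuallyEq.symm (f := F z) (g := S) hy)
    have h2 := ((hFd y hyV).analyticOnNhd hΩo).eqOn_of_preconnected_of_eventuallyEq
      ((hFd z hz).analyticOnNhd hΩo) hsc.isPathConnected.isConnected.isPreconnected hyV.2 h1
    ext x
    by_cases hx : x ∈ Ω
    · exact h2 hx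
    · rw [hF0 y hyV x hx, hF0 z hz x hx]
  have h1 := hprim (F z) (hFd z hz) z hz.2
  rw [(hFS z hz).self_of_nhds] at h1
  refine h1.congr_of_eventuallyEq ?_
  filter_upwards [hloc] with y hy
  rw [hy]

/-! ### Assembly of the three assertions. -/

theorem proposition2p5 (Ω : Set ℂ) (hΩ_open : IsOpen Ω) (hΩ_bdd : Bornology.IsBounded Ω)
    (hΩ_sc : IsSimplyConnected Ω) (p : Polynomial ℂ)
    (hp : IsBestApproxConj Ω (fun z => p.eval z)) :
    (1 ≤ p.natDegree → ¬ HasMeromorphicSchwarzFunction Ω) ∧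
    (¬ IsDisk Ω → SchwarzFunctionHasAlgebraicSingularitiesNoPoles Ω) ∧
    (IsQuadratureDomain Ω → IsDisk Ω) := by
  obtain ⟨P, hPp, hP⟩ := exists_primitive_of_isBestApproxConj hΩ_open hΩ_bdd hΩ_sc hp
  have hc : IsConnected Ω := hΩ_sc.isPathConnected.isConnected
  have hdeg : p.natDegree = P.natDegree - 1 := by
    rw [← hPp, Polynomial.natDegree_derivative]
  refine ⟨fun h1 => ?_, fun hdisk => ⟨?_, fun S hS => ?_⟩, fun hQ => ?_⟩
  · exact not_hasMeromorphicSchwarzFunction hΩ_open hΩ_bdd hc (by omega) hP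
  · have hn : 2 ≤ P.natDegree := by
      by_contra hlt
      exact hdisk (isDisk_of_natDegree_le_one hΩ_open hΩ_bdd hc.nonempty (by omega) hP)
    have hB : 2 ≤ (P.map (starRingEnd ℂ)).natDegree := by
      rwa [Polynomial.natDegree_map_eq_of_injective (starRingEnd ℂ).injective P]
    have hfin := finite_branchPoints_of_frontier hΩ_open hΩ_bdd hc hn hP
    refine ⟨branchPoints P (P.map (starRingEnd ℂ)), hfin,
      fun ζ hζ => exists_isSchwarzGermAt hP hζ.1 hζ.2, fun S γ hS => ⟨fun hγ => ?_, ?_⟩⟩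
    · exact exists_isAnalyticContinuationAlong_of_curveEq P hB hfin hS.2.1
        (hS.curveEq_eq_zero hΩ_open hΩ_sc hP) hγ
    · intro f hf e r hd hz
      refine isPoleFreeAlgebraicBranch_of_curveEq P hB hd hz (hf.1 1).continuousAt ?_
      refine hf.isGermFamily.curveEq_eq_zero (t₀ := 0) ?_ 1
      filter_upwards [hf.2.1, hS.curveEq_eq_zero hΩ_open hΩ_sc hP] with z h1 h2
      rw [h1, h2]
  · exact not_forall_isAnalyticContinuationAlong hΩ_open hΩ_bdd hΩ_sc hP hS
  · exact isDisk_of_natDegree_le_one hΩ_open hΩ_bdd hc.nonempty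
      (Nat.lt_succ_iff.1 (hQ.natDegree_lt_two hΩ_open hΩ_bdd hΩ_sc hP)) hP
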